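/- We work over $\mathbb C$. Let $X$ and $Y$ be surfaces (integral separated schemes of finite type over $\mathbb C$, of dimension $2$) with only Kawamata log terminal singularities, and let $\varepsilon\colon X\to Y$ be a proper birational morphism whose contracted curves are exactly the members of a chain of rational curves $F_1,\dots,F_k$ ($k\ge 1$), i.e. the $F_i$ are distinct rational curves, $F_i\cap F_j=\emptyset$ for $|i-j|>1$, and the integral curves on $X$ which $\varepsilon$ maps to a point are precisely $F_1,\dots,F_k$. Let $L$ be a $\mathbb Q$-Cartier ($\mathbb Q$-)divisor on $X$ and let $C$ be a curve on $X$ (reduced and complete, possibly reducible) such that 1. $(L+C)\cdot C\ge 0$; 2. $C\cdot F_i$ is a non-negative integer for every $i=1,\dots,k$; 3. $F_1^2\le -1$, and $F_i^2\le -2$ and $F_{i-1}\cdot F_i=1$ for every $i=2,\dots,k$; 4. $-1\le L\cdot F_1<0$, and $L\cdot F_i=0$ for every $i=2,\dots,k$. Let $\overline L=\varepsilon_*L$ and $\overline C=\varepsilon_*C$ be the push-forwards as divisors. Then $$(\overline L+\overline C)\cdot\overline C\ge 0 .$$ (Every Weil divisor on a surface with Kawamata log terminal singularities is $\mathbb Q$-Cartier,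 so all these intersection numbers are defined, as rational numbers.) -/

import Mathlib

open CategoryTheory AlgebraicGeometry Order

namespace KltSurface

noncomputable section

/-! ### Orders of vanishing along curves -/

/-- The order function of a one-dimensional local domain `A` with fraction field `K`:
`ord (a / b) = length (A / a) - length (A / b)` for non-zero `a`, `b` in `A`.
(Value `0` if `u = 0` or `u` is not a fraction of elements of `A`.) -/
def fracOrd {K : Type*} [Field K] (A : Subring K) (u : K) : ℤ :=
  open Classical in
  if h : ∃ q : A × A, q.1 ≠ 0 ∧ q.2 ≠ 0 ∧ u * (q.2 : K) = (q.1 : K) then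
    ((Ring.ord A h.choose.1).toNat : ℤ) - ((Ring.ord A h.choose.2).toNat : ℤ)
  else 0

/-- `fracOrd` does not depend on the chosen fraction. -/
theorem fracOrd_eq {K : Type*} [Field K] (A : Subring K)
    (hA : ∀ a : A, a ≠ 0 → Ring.ord A a ≠ ⊤) (u : K) (a b : A) (ha : a ≠ 0) (hb : b ≠ 0)
    (hu : u * (b : K) = (a : K)) :
    fracOrd A u = ((Ring.ord A a).toNat : ℤ) - ((Ring.ord A b).toNat : ℤ) := by
  have h : ∃ q : A × A, q.1 ≠ 0 ∧ q.2 ≠ 0 ∧ u * (q.2 : K) = (q.1 : K) := ⟨(a, b), ha, hb, hu⟩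
  rw [fracOrd, dif_pos h]
  obtain ⟨h1, h2, h3⟩ := h.choose_spec
  set c := h.choose.1
  set d := h.choose.2
  have e : c * b = a * d := by
    apply Subtype.ext
    push_cast
    rw [← h3, ← hu]
    ring
  have e' : Ring.ord A c + Ring.ord A b = Ring.ord A a + Ring.ord A d := by
    rw [← Ring.ord_mul A (mem_nonZeroDivisors_of_ne_zero hb),
      ← Ring.ord_mul A (mem_nonZeroDivisors_of_ne_zero h2), e]
  have e'' := congrArg ENat.toNat e'
  rw [ENat.toNat_add (hA _ h1) (hA _ hb), ENat.toNat_add (hA _ ha) (hA _ h2)] at e''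
  omega

variable {X Y : Scheme.{0}}

/-- The local ring at `p` of the integral curve with generic point `c` (i.e. of the reduced closed
subscheme supported on the closure of `c`), as a subring of the function field `κ(c)` of this
curve: the image of `𝒪_{X,p} → 𝒪_{X,c} → κ(c)`. -/
def curveLocalRing (c p : X) (h : c ⤳ p) : Subring (X.residueField c) :=
  (X.presheaf.stalkSpecializes h ≫ X.residue c).hom.range

/-- The restriction to the subvariety with generic point `c` of a rational function that is regular
at `c`, as an element of `κ(c)`. (Value `0` if `f` is not regular at `c`.) -/
def valueAt [IsIntegral X] (c : X) (f : X.functionField) : X.residueField c :=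
  open Classical in
  if h : ∃ a : X.presheaf.stalk c, algebraMap (X.presheaf.stalk c) X.functionField a = f then
    X.residue c h.choose
  else 0

/-! ### Weil divisors and intersection numbers

A prime divisor is given by its generic point, a point of codimension one; a Weil `ℚ`-divisor is an
algebraic cycle with rational coefficients concentrated in codimension one. -/

/-- The cycle `D` is a Weil `ℚ`-divisor. -/
def IsWeilDivisor (D : AlgebraicCycle X ℚ) : Prop :=
  ∀ x : X, D x ≠ 0 → coheight x = 1

/-- The reduced divisor `∑ c`, for `c` in a finite set of (generic points of) prime divisors. -/
def reducedDivisor (C : Finset X) : AlgebraicCycle X ℚ :=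
  open Classical in
  ∑ c ∈ C, Function.locallyFinsuppWithin.single c (1 : ℚ)

/-- The prime divisor with generic point `c`, as a divisor. -/
abbrev primeDivisor (c : X) : AlgebraicCycle X ℚ := reducedDivisor {c}

section

variable [IsIntegral X] [IsLocallyNoetherian X]

/-- `f` is a local equation of `m D` at `x`: the divisor of `f` agrees with `m D` at all prime
divisors through `x` (equivalently, in a neighbourhood of `x`). -/
def IsLocalEquation (D : AlgebraicCycle X ℚ) (m : ℕ) (x : X) (f : X.functionField) : Prop :=
  f ≠ 0 ∧ ∀ z : X, coheight z = 1 → z ⤳ x → ((X.ord f z : ℤ) : ℚ) = m * D z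

/-- On a normal variety: `D` is a `ℚ`-Cartier `ℚ`-divisor, i.e. some positive multiple `m D` is a
Cartier divisor, given by local equations `f x`. -/
def IsQCartier (D : AlgebraicCycle X ℚ) : Prop :=
  IsWeilDivisor D ∧
    ∃ q : ℕ × (X → X.functionField), 0 < q.1 ∧ ∀ x, IsLocalEquation D q.1 x (q.2 x)

/-- The degree on the integral curve with generic point `c` of the line bundle given by the local
equations `f x` (`x ∈ X`): the degree of the divisor on this curve which at a closed point `p` is
cut out by the restriction of `f p / f c`. All closed points have residue field `ℂ`
in the situation of interest, so that they count with multiplicity one. -/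
def curveDegree (f : X → X.functionField) (c : X) : ℤ :=
  ∑ᶠ p : {p : X // IsClosed ({p} : Set X) ∧ c ⤳ p},
    fracOrd (curveLocalRing c p.1 p.2.2) (valueAt c (f p.1 / f c))

/-- The intersection number `D · c` of a `ℚ`-Cartier divisor `D` with the complete integral curve
with generic point `c`: it is `1/m` times the degree of `𝒪(m D)` on this curve, for `m D` Cartier.
(Value `0` if `D` is not `ℚ`-Cartier; on a surface with Kawamata log terminal singularities every
Weil divisor is `ℚ`-Cartier.) -/
def inter (D : AlgebraicCycle X ℚ) (c : X) : ℚ :=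
  open Classical in
  if h : IsQCartier D then (curveDegree h.2.choose.2 c : ℚ) / (h.2.choose.1 : ℚ) else 0

/-- The intersection number `D · Z = ∑ Z(c) (D · c)`, for a divisor `Z` with complete components
on a surface. -/
def interDivisor (D Z : AlgebraicCycle X ℚ) : ℚ :=
  ∑ᶠ c : X, Z c * inter D c

end

/-! ### Birational morphisms -/

section

variable [IsIntegral X] [IsIntegral Y]

/-- The map on function fields induced by a dominant morphism of integral schemes. -/
def pullbackFun (g : X ⟶ Y) (h : g (genericPoint X) = genericPoint Y) :
    Y.functionField →+* X.functionField :=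
  (Y.presheaf.stalkSpecializes (specializes_of_eq h) ≫ g.stalkMap (genericPoint X)).hom

/-- A morphism of integral schemes is birational if it is dominant and induces an isomorphism
of function fields. -/
def IsBirational (g : X ⟶ Y) : Prop :=
  ∃ h : g (genericPoint X) = genericPoint Y, Function.Bijective (pullbackFun g h)

end

/-- The prime divisor with generic point `x` is contracted to a point by `g`. -/
def IsContracted (g : X ⟶ Y) (x : X) : Prop :=
  coheight x = 1 ∧ IsClosed ({g x} : Set Y)

/-- The push-forward `g_* D` of divisors under a proper birational morphism of surfaces: a prime
divisor `c` goes to `[κ(c) : κ(g c)] g(c)` if `g(c)` is a prime divisor, and to `0` otherwise. -/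
def pushforward (g : X ⟶ Y) [QuasiCompact g] (D : AlgebraicCycle X ℚ) : AlgebraicCycle Y ℚ :=
  AlgebraicCycle.map g (fun x : X => coheight x) (fun y : Y => coheight y) D

/-! ### Rational two-forms and Kawamata log terminal singularities -/

section

variable (K : Type) [Field K] [Algebra ℂ K]

/-- Rational two-forms: the second exterior power over `K` of the Kähler differentials of `K/ℂ`. -/
abbrev TwoForm : Type := ⋀[K]^2 (KaehlerDifferential ℂ K)

/-- The `R`-module of two-forms generated by all `da ∧ db` with `a, b ∈ R`, that is, the image of
`⋀² Ω_{R/ℂ}` in `⋀² Ω_{K/ℂ}`. -/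
def regularTwoForms (R : Subring K) : Submodule R (TwoForm K) :=
  Submodule.span R {w | ∃ a ∈ R, ∃ b ∈ R,
    w = exteriorPower.ιMulti K 2 ![KaehlerDifferential.D ℂ K a, KaehlerDifferential.D ℂ K b]}

/-- For a discrete valuation ring `R` of `K`, smooth over `ℂ` of relative dimension two, with
valuation `v`: the two-form `ω` has order `n` along `R`, i.e. `ω = h ω₀` with `ω₀` a generator of
the module of regular two-forms and `v h = n`. -/
def HasFormOrder (R : Subring K) (v : K → ℤ) (ω : TwoForm K) (n : ℤ) : Prop :=
  ∃ (ω₀ : TwoForm K) (h : K),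
    Submodule.span R {ω₀} = regularTwoForms K R ∧ ω = h • ω₀ ∧ v h = n

end

section

variable [IsIntegral Y]

/-- The embedding of `ℂ` in the function field of a complex variety. -/
@[reducible] def functionFieldAlgebra (sY : Y ⟶ Spec (.of ℂ)) : Algebra ℂ Y.functionField :=
  RingHom.toAlgebra
    ((Scheme.ΓSpecIso (.of ℂ)).inv ≫ sY.appTop ≫
      Y.presheaf.germ ⊤ (genericPoint Y) trivial).hom

/-- The local ring of `X` at `x`, as a subring of the function field of `Y`, for a birational
morphism `g : X ⟶ Y`. -/
def localSubring [IsIntegral X] (g : X ⟶ Y) (h : g (genericPoint X) = genericPoint Y) (x : X) :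
    Subring Y.functionField :=
  (algebraMap (X.presheaf.stalk x) X.functionField).range.comap (pullbackFun g h)

variable [IsLocallyNoetherian Y]

/-- `Y` is a normal surface over `ℂ`: a normal integral separated scheme of finite type over `ℂ`
of dimension two. -/
structure IsNormalSurface (sY : Y ⟶ Spec (.of ℂ)) : Prop where
  separated : IsSeparated sY
  locallyOfFiniteType : LocallyOfFiniteType sY
  quasiCompact : QuasiCompact sY
  dim_eq_two : topologicalKrullDim Y = 2
  normal : ∀ y : Y, IsIntegrallyClosed (Y.presheaf.stalk y)

/-- The normal surface `Y` has only Kawamata log terminal singularities: for a non-zero rational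
two-form `ω`, with canonical divisor `K_Y = div ω`,
* `m K_Y` is Cartier for some `m > 0`, with local equations `f y`;
* for every proper birational morphism `g : Y' ⟶ Y` from a normal variety and every prime divisor
  `E` of `Y'`, the discrepancy of `E`, that is the coefficient of `E` in
  `K_{Y'} - g^* K_Y = div (g^* ω) - (1/m) g^* (m K_Y)`, is greater than `-1`. -/
def IsKlt (sY : Y ⟶ Spec (.of ℂ)) : Prop :=
  letI := functionFieldAlgebra sY
  IsNormalSurface sY ∧
  ∃ (ω : TwoForm Y.functionField) (m : ℕ) (f : Y → Y.functionField), ω ≠ 0 ∧ 0 < m ∧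
    (∀ y : Y, f y ≠ 0 ∧ ∀ z : Y, coheight z = 1 → z ⤳ y → ∃ n : ℤ,
      HasFormOrder Y.functionField (algebraMap (Y.presheaf.stalk z) Y.functionField).range
        (fun h => Y.ord h z) ω n ∧ Y.ord (f y) z = m * n) ∧
    ∀ (Y' : Scheme.{0}) [IsIntegral Y'] [IsLocallyNoetherian Y'] (g : Y' ⟶ Y) [IsProper g]
      (hg : g (genericPoint Y') = genericPoint Y), Function.Bijective (pullbackFun g hg) →
      (∀ y : Y', IsIntegrallyClosed (Y'.presheaf.stalk y)) →
      ∀ E : Y', coheight E = 1 → ∃ n : ℤ,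
        HasFormOrder Y.functionField (localSubring g hg E)
          (fun h => Y'.ord (pullbackFun g hg h) E) ω n ∧
        (-1 : ℚ) < n - (Y'.ord (pullbackFun g hg (f (g E))) E : ℚ) / m

end

/-! ### Curves -/

/-- `c` is the generic point of a complete integral curve of the surface `X`. -/
def IsCompleteCurve (sX : X ⟶ Spec (.of ℂ)) (c : X) : Prop :=
  coheight c = 1 ∧ ∃ (Z : Scheme.{0}) (i : Z ⟶ X) (_ : IsIntegral Z),
    IsClosedImmersion i ∧ i (genericPoint Z) = c ∧ IsProper (i ≫ sX)

/-- `c` is the generic point of a rational (possibly singular) integral curve of the surface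
`X`. -/
def IsRationalCurve (sX : X ⟶ Spec (.of ℂ)) (c : X) : Prop :=
  coheight c = 1 ∧ ∃ (Z : Scheme.{0}) (i : Z ⟶ X) (_ : IsIntegral Z),
    IsClosedImmersion i ∧ i (genericPoint Z) = c ∧ Scheme.IsRationalOver (i ≫ sX)

/-- `F 0, …, F k` is a chain of rational curves (without the condition on the intersection numbers
of consecutive members): distinct rational curves, non-consecutive ones being disjoint. -/
structure IsChainOfRationalCurves (sX : X ⟶ Spec (.of ℂ)) {k : ℕ} (F : Fin (k + 1) → X) :
    Prop where
  rational : ∀ i, IsRationalCurve sX (F i)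
  injective : Function.Injective F
  disjoint : ∀ i j : Fin (k + 1), (i : ℕ) + 1 < j → Disjoint (closure {F i}) (closure {F j})

end

end KltSurface

namespace KltSurface

/-! ### Orders on one-dimensional subrings of a field -/

section FracOrd

variable {K : Type*} [Field K]

/-! Write the pull-back of the divisor on `Y` as D' = ε^*(L̄ + C̄) = L + C + ∑ e_i F_i. It has
degree zero on every contracted curve, so the e_i solve the linear system L·F_j + C·F_j + ∑_i e_i
(F_i·F_j) = 0. By the projection formula the number to be bounded is D'·C = (L + C)·C + ∑ e_i
(F_i·C). The first term is non-negative by assumption, so it remains to show ∑ e_i n_i ≥ 0 for n_i =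
C·F_i.

This is elementary (`nonneg_of_chain`): e_i ≥ 0 whenever n_i > 0. With a_j = -F_j², the system is
the recursion a_j e_j = n_j + ℓ_j + e_{j-1} + e_{j+1}, where ℓ_j = L·F_j and e vanishes beyond the
ends of the chain. Where e is negative, a_j ≥ 2 makes it concave. It must increase strictly at each
negative entry, since otherwise it would go on decreasing and miss the value zero past the last
index. Consequently negativity at one index spreads back to all earlier ones. The bounds a_0 ≥ 1 and
ℓ_0 ≥ -1 limit the first increment to 1 - n_0, and concavity then limits the i-th one to 1 - n_i. If
n_i is a positive integer, this is at most zero, which contradicts strict increase. Entries with n_i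
= 0 contribute nothing, whatever their sign.

Most of the work lies in the intersection theory on normal surfaces that makes these manipulations
legitimate.

Well-definedness and additivity: two systems of local equations of the same divisor differ by units
(algebraic Hartogs, `mem_range_of_forall_dvr`), and a principal divisor on a complete curve has
degree zero. The latter is the product formula `IsCurveField.finsum_places_eq_zero` on the function
field, carried to singular curves by writing the order at a point as the sum of the orders at the
places above it (`fracOrd_eq_finsum_placesOver`). Completeness enters only as existence and
uniqueness of centers of places, through the valuative criteria.

Projection formula (`curveDegree_pullback`): a curve that is not contracted has the same function
field as its image, and both degrees equal the same sum over places.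

Symmetry (`sum_curveDegree_comm`): at a point the multiplicity is χ(f, A/g) = length coker f -
length ker f on A/g, which is symmetric in f and g and, by dévissage, is a sum over the components
of g. -/

theorem fracOrd_one (A : Subring K) : fracOrd A 1 = 0 := by
  rw [fracOrd]
  split_ifs with hq
  · obtain ⟨-, -, h⟩ := hq.choose_spec
    rw [one_mul] at h
    rw [Subtype.ext h, sub_self]
  · rfl

/-- `A` is a Noetherian ring of dimension at most one with fraction field `K`. -/
structure IsOrdRing (A : Subring K) : Prop where
  noetherian : IsNoetherianRing A
  dim : Ring.KrullDimLE 1 A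
  frac : IsFractionRing A K

namespace IsOrdRing

variable {A : Subring K} (hA : IsOrdRing A)

include hA

theorem ord_ne_top (a : A) (ha : a ≠ 0) : Ring.ord A a ≠ ⊤ :=
  have := hA.noetherian
  have := hA.dim
  Ring.ord_ne_top (mem_nonZeroDivisors_of_ne_zero ha)

theorem exists_eq_div (u : K) (hu : u ≠ 0) :
    ∃ a b : A, a ≠ 0 ∧ b ≠ 0 ∧ u * (b : K) = (a : K) := by
  have := hA.frac
  obtain ⟨a, b, hb, rfl⟩ := IsFractionRing.div_surjective (A := A) u
  have hb' : b ≠ 0 := nonZeroDivisors.ne_zero hb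
  have hbK : (algebraMap A K b) ≠ 0 := by
    simpa using hb'
  refine ⟨a, b, ?_, hb', div_mul_cancel₀ _ hbK⟩
  rintro rfl
  simp at hu

theorem fracOrd_mul {u v : K} (hu : u ≠ 0) (hv : v ≠ 0) :
    fracOrd A (u * v) = fracOrd A u + fracOrd A v := by
  obtain ⟨a, b, ha, hb, e⟩ := hA.exists_eq_div u hu
  obtain ⟨c, d, hc, hd, e'⟩ := hA.exists_eq_div v hv
  rw [fracOrd_eq A hA.ord_ne_top u a b ha hb e, fracOrd_eq A hA.ord_ne_top v c d hc hd e',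
    fracOrd_eq A hA.ord_ne_top (u * v) (a * c) (b * d) (mul_ne_zero ha hc) (mul_ne_zero hb hd)
      (by push_cast; rw [← e, ← e']; ring),
    Ring.ord_mul A (mem_nonZeroDivisors_of_ne_zero hc),
    Ring.ord_mul A (mem_nonZeroDivisors_of_ne_zero hd),
    ENat.toNat_add (hA.ord_ne_top _ ha) (hA.ord_ne_top _ hc),
    ENat.toNat_add (hA.ord_ne_top _ hb) (hA.ord_ne_top _ hd)]
  push_cast
  ring

theorem fracOrd_coe (a : A) (ha : a ≠ 0) : fracOrd A (a : K) = (Ring.ord A a).toNat := by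
  rw [fracOrd_eq A hA.ord_ne_top a a 1 ha one_ne_zero (by simp)]
  simp

theorem fracOrd_inv {u : K} (hu : u ≠ 0) : fracOrd A u⁻¹ = - fracOrd A u := by
  have := hA.fracOrd_mul hu (inv_ne_zero hu)
  rw [mul_inv_cancel₀ hu, KltSurface.fracOrd_one] at this
  omega

theorem fracOrd_div {u v : K} (hu : u ≠ 0) (hv : v ≠ 0) :
    fracOrd A (u / v) = fracOrd A u - fracOrd A v := by
  rw [div_eq_mul_inv, hA.fracOrd_mul hu (inv_ne_zero hv), hA.fracOrd_inv hv, sub_eq_add_neg]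

theorem fracOrd_eq_zero {u : K} (hu : u ∈ A) (hu' : u⁻¹ ∈ A) : fracOrd A u = 0 := by
  -- The hypotheses also hold for `u = 0`, as `0⁻¹ = 0`; no fraction with non-zero numerator exists
  -- then, and the default value is `0`.
  rcases eq_or_ne u 0 with rfl | h
  · rw [fracOrd, dif_neg]
    rintro ⟨q, h1, h2, h3⟩
    rw [zero_mul] at h3
    exact h1 (Subtype.ext h3.symm)
  have h' : IsUnit (⟨u, hu⟩ : A) :=
    IsUnit.of_mul_eq_one ⟨u⁻¹, hu'⟩ (Subtype.ext (mul_inv_cancel₀ h))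
  rw [show u = ((⟨u, hu⟩ : A) : K) from rfl, hA.fracOrd_coe _ h'.ne_zero, Ring.ord_of_isUnit h']
  simp

theorem fracOrd_zpow {u : K} (hu : u ≠ 0) (n : ℤ) : fracOrd A (u ^ n) = n * fracOrd A u := by
  have key : ∀ m : ℕ, fracOrd A (u ^ m) = m * fracOrd A u := by
    intro m
    induction m with
    | zero => simp [KltSurface.fracOrd_one]
    | succ m ih =>
      rw [pow_succ, hA.fracOrd_mul (pow_ne_zero _ hu) hu, ih]
      push_cast
      ring
  obtain ⟨m, rfl | rfl⟩ := n.eq_nat_or_neg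
  · simpa using key m
  · rw [zpow_neg, hA.fracOrd_inv (zpow_ne_zero _ hu), zpow_natCast, key]
    ring

end IsOrdRing

end FracOrd

end KltSurface

namespace KltSurface

/-! ### Places of the fraction field of a Dedekind domain -/

section Dedekind

open IsDedekindDomain HeightOneSpectrum UniqueFactorizationMonoid

variable {B : Type*} [CommRing B] [IsDedekindDomain B]

/-- `I` covers `P * I`: an ideal between them is `I * L` with `L ∣ P`, so `L` is trivial or equal to
`P`. Hence `I / PI` is simple, and lengths add along `0 → I/PI → B/PI → B/I → 0`. -/
theorem length_quotient_prime_mul {P I : Ideal B} (hP : Prime P) (hI : I ≠ 0) :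
    Module.length B (B ⧸ P * I) = Module.length B (B ⧸ I) + 1 := by
  have hle : P * I ≤ I := Ideal.mul_le_right
  have hcov : P * I ⋖ I := by
    refine ⟨lt_of_le_of_ne hle fun h ↦ ?_, fun J h1 h2 ↦ ?_⟩
    · have : P * I = 1 * I := by rw [h, one_mul]
      exact hP.not_isUnit ((mul_right_cancel₀ hI this) ▸ isUnit_one)
    · obtain ⟨L, rfl⟩ := Ideal.dvd_iff_le.mpr h2.le
      have h3 : I * L ∣ I * P := by rw [mul_comm I P]; exact Ideal.dvd_iff_le.mpr h1.le
      have h4 : L ∣ P := (mul_dvd_mul_iff_left hI).mp h3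
      rcases hP.irreducible.dvd_iff.mp h4 with h | h
      · rw [Ideal.isUnit_iff.mp h] at h2
        simp at h2
      · rw [associated_iff_eq.mp h, mul_comm] at h1
        exact lt_irrefl _ h1
  have hs := (covBy_iff_quot_is_simple hle).mp hcov
  rw [← Module.length_eq_one_iff] at hs
  let f : (I ⧸ Submodule.comap I.subtype (P * I)) →ₗ[B] (B ⧸ P * I) :=
    Submodule.mapQ _ _ I.subtype le_rfl
  have hf : Function.Injective f := by
    rw [← LinearMap.ker_eq_bot]
    exact Submodule.ker_liftQ_eq_bot _ _ _ (by rw [LinearMap.ker_comp, Submodule.ker_mkQ])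
  have hg : Function.Surjective (Submodule.factor hle) := Submodule.factor_surjective hle
  have hex : Function.Exact f (Submodule.factor hle) := by
    intro x
    obtain ⟨x, rfl⟩ := Submodule.mkQ_surjective _ x
    constructor
    · intro h
      have hx : x ∈ I := by
        exact (Submodule.Quotient.mk_eq_zero I).mp h
      exact ⟨Submodule.Quotient.mk ⟨x, hx⟩, rfl⟩
    · rintro ⟨y, hy⟩
      obtain ⟨y, rfl⟩ := Submodule.mkQ_surjective _ y
      rw [← hy]
      exact (Submodule.Quotient.mk_eq_zero _).mpr y.2
  rw [Module.length_eq_add_of_exact f (Submodule.factor hle) hf hg hex, hs, add_comm]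

theorem length_quotient_eq_card_normalizedFactors {I : Ideal B} (hI : I ≠ 0) :
    Module.length B (B ⧸ I) = (normalizedFactors I).card := by
  induction I using UniqueFactorizationMonoid.induction_on_prime with
  | h₁ => exact absurd rfl hI
  | h₂ J hJ =>
    rw [Ideal.isUnit_iff.mp hJ, ← Ideal.one_eq_top, normalizedFactors_one, Ideal.one_eq_top]
    simp
  | h₃ J P hJ hP ih =>
    rw [length_quotient_prime_mul hP hJ, ih hJ, normalizedFactors_mul hP.ne_zero hJ,
      normalizedFactors_irreducible hP.irreducible]
    simp [add_comm]

variable {K : Type*} [Field K] [Algebra B K] [IsFractionRing B K]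

theorem isOrdRing_valuationSubringAtPrime (v : HeightOneSpectrum B) :
    IsOrdRing (valuationSubringAtPrime K v).toSubring where
  noetherian := inferInstanceAs (IsNoetherianRing (valuationSubringAtPrime K v))
  dim := inferInstanceAs (Ring.KrullDimLE 1 (valuationSubringAtPrime K v))
  frac := inferInstanceAs (IsFractionRing (valuationSubringAtPrime K v) K)

/-- The order is additive and vanishes on elements of valuation one, so it is a constant multiple of
the `v`-adic exponent. An irreducible element of the discrete valuation ring has order one, which
fixes the constant. -/
theorem fracOrd_valuationSubringAtPrime (v : HeightOneSpectrum B) (b : B) (hb : b ≠ 0) :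
    fracOrd (valuationSubringAtPrime K v).toSubring (algebraMap B K b) =
      multiplicity v.asIdeal (Ideal.span {b}) := by
  have hO := isOrdRing_valuationSubringAtPrime (K := K) v
  have : IsDiscreteValuationRing (valuationSubringAtPrime K v) :=
    IsLocalization.AtPrime.isDiscreteValuationRing_of_dedekind_domain B v.ne_bot _
  have hmem : ∀ x : K, x ∈ (valuationSubringAtPrime K v).toSubring ↔ v.valuation K x ≤ 1 := by
    intro x
    rw [valuationSubringAtPrime_eq_valuationSubring]
    exact Iff.rfl
  obtain ⟨π, hπ⟩ := v.valuation_exists_uniformizer K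
  have hπ0 : π ≠ 0 := by
    rintro rfl
    rw [map_zero] at hπ
    exact WithZero.exp_ne_zero hπ.symm
  have hunit : ∀ x : K, v.valuation K x = 1 →
      fracOrd (valuationSubringAtPrime K v).toSubring x = 0 := by
    intro x hx
    exact hO.fracOrd_eq_zero ((hmem _).mpr hx.le) ((hmem _).mpr (by rw [map_inv₀, hx, inv_one]))
  have hzp : ∀ n : ℤ, v.valuation K (π ^ n) = WithZero.exp (-n) := by
    intro n
    rw [map_zpow₀, hπ, ← WithZero.exp_zsmul]
    simp
  obtain ⟨ϖ, hϖ⟩ := IsDiscreteValuationRing.exists_irreducible (valuationSubringAtPrime K v)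
  have hϖ0 : (ϖ : K) ≠ 0 := fun h ↦ hϖ.ne_zero (Subtype.ext h)
  have hϖ1 : fracOrd (valuationSubringAtPrime K v).toSubring (ϖ : K) = 1 := by
    have h1 := hO.fracOrd_coe ϖ hϖ.ne_zero
    have h2 : Ring.ord (valuationSubringAtPrime K v).toSubring ϖ = 1 :=
      Ring.ord_of_irreducible (R := valuationSubringAtPrime K v) hϖ
    rw [h1, h2]
    rfl
  have key : ∀ (x : K) (n : ℤ), v.valuation K x = WithZero.exp (-n) →
      fracOrd (valuationSubringAtPrime K v).toSubring x =
        n * fracOrd (valuationSubringAtPrime K v).toSubring π := by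
    intro x n hx
    have h1 : v.valuation K (x / π ^ n) = 1 := by
      rw [map_div₀, hx, hzp, div_self (WithZero.exp_ne_zero)]
    have hx0 : x ≠ 0 := by
      rintro rfl
      rw [map_zero] at hx
      exact WithZero.exp_ne_zero hx.symm
    have h2 := hunit _ h1
    rw [hO.fracOrd_div hx0 (zpow_ne_zero _ hπ0), hO.fracOrd_zpow hπ0] at h2
    linarith
  obtain ⟨n, hn⟩ : ∃ n : ℤ, v.valuation K (ϖ : K) = WithZero.exp (-n) := by
    have h := (v.valuation K).ne_zero_iff.mpr hϖ0
    refine ⟨-WithZero.log (v.valuation K (ϖ : K)), ?_⟩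
    rw [neg_neg, WithZero.exp_log h]
  have h1 := key _ _ hn
  rw [hϖ1] at h1
  have hn0 : 0 ≤ n := by
    have := (hmem _).mp ϖ.2
    rw [hn] at this
    have h3 : WithZero.exp (-n) ≤ WithZero.exp (0 : ℤ) := by simpa using this
    rw [WithZero.exp_le_exp] at h3
    omega
  -- `1 = n * c` in the integers with `n ≥ 0` leaves only `c = 1`.
  have hπ1 : fracOrd (valuationSubringAtPrime K v).toSubring π = 1 := by
    rcases Int.eq_one_or_neg_one_of_mul_eq_one h1.symm with h | h
    · rw [h] at h1
      linarith
    · omega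
  rw [key _ _ ((v.valuation_of_algebraMap b).trans (v.intValuation_eq_exp_neg_multiplicity hb)),
    hπ1, mul_one]

theorem valuationSubringAtPrime_injective :
    Function.Injective (valuationSubringAtPrime K : HeightOneSpectrum B → ValuationSubring K) := by
  intro v w h
  rw [valuationSubringAtPrime_eq_valuationSubring, valuationSubringAtPrime_eq_valuationSubring] at h
  exact eq_of_valuation_isEquiv_valuation (K := K)
    ((Valuation.isEquiv_iff_valuationSubring _ _).mpr h)

/-- Given a proper `V` containing `B`, let `P` be the contraction of its maximal ideal. If `P = 0`,
all fractions lie in `V`, which is excluded; otherwise `B_P ≤ V`, and a discrete valuation ring has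
no larger proper subring of `K`. -/
theorem range_valuationSubringAtPrime :
    Set.range (valuationSubringAtPrime K : HeightOneSpectrum B → ValuationSubring K) =
      {V | V ≠ ⊤ ∧ (algebraMap B K).range ≤ V.toSubring} := by
  ext V
  constructor
  · rintro ⟨v, rfl⟩
    constructor
    · rw [valuationSubringAtPrime_eq_valuationSubring, ne_eq,
        Valuation.valuationSubring_eq_top_iff, not_not]
      infer_instance
    · rintro _ ⟨b, rfl⟩
      rw [valuationSubringAtPrime_eq_valuationSubring]
      exact v.valuation_le_one b
  · rintro ⟨hV, hB⟩
    let φ : B →+* V := (algebraMap B K).codRestrict V.toSubring fun b ↦ hB ⟨b, rfl⟩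
    have hφ : ∀ b, (φ b : K) = algebraMap B K b := fun b ↦ rfl
    let P : Ideal B := (IsLocalRing.maximalIdeal V).comap φ
    have hPp : P.IsPrime := Ideal.IsPrime.comap φ
    have hmemP : ∀ b, b ∉ P → (algebraMap B K b)⁻¹ ∈ V := by
      intro b hb
      have hu : IsUnit (φ b) := by
        by_contra h
        exact hb ((IsLocalRing.mem_maximalIdeal _).mpr h)
      obtain ⟨c, hc⟩ := hu.exists_right_inv
      have : (algebraMap B K b) * (c : K) = 1 := by
        rw [← hφ]
        exact_mod_cast congrArg (Subtype.val) hc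
      rw [inv_eq_of_mul_eq_one_right this]
      exact c.2
    have hP0 : P ≠ ⊥ := by
      intro h0
      apply hV
      rw [eq_top_iff]
      rintro x -
      obtain ⟨a, b, hb, rfl⟩ := IsFractionRing.div_surjective (A := B) x
      rw [div_eq_mul_inv]
      refine mul_mem (hB ⟨a, rfl⟩) (hmemP b ?_)
      rw [h0, Ideal.mem_bot]
      exact nonZeroDivisors.ne_zero hb
    refine ⟨⟨P, hPp, hP0⟩, ValuationSubring.eq_of_le_of_ne_top _ ?_ hV⟩
    rintro x ⟨a, s, hs, rfl⟩
    exact mul_mem (hB ⟨a, rfl⟩) (hmemP s hs)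

/-- The places of `K` which are integral on the subring `A`. -/
def placesOver (A : Subring K) : Set (ValuationSubring K) :=
  {V | V ≠ ⊤ ∧ A ≤ V.toSubring}

theorem isOrdRing_of_mem_placesOver {V : ValuationSubring K}
    (hV : V ∈ placesOver (algebraMap B K).range) : IsOrdRing V.toSubring := by
  rw [placesOver, ← range_valuationSubringAtPrime (B := B)] at hV
  obtain ⟨v, rfl⟩ := hV
  exact isOrdRing_valuationSubringAtPrime v

theorem finite_placesOver_coe (b : B) (hb : b ≠ 0) :
    {V | V ∈ placesOver (algebraMap B K).range ∧
      fracOrd V.toSubring (algebraMap B K b) ≠ 0}.Finite := by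
  have hI : Ideal.span {b} ≠ (0 : Ideal B) := by
    simpa [Ideal.zero_eq_bot, Ideal.span_singleton_eq_bot] using hb
  refine ((Ideal.finite_factors hI).image (valuationSubringAtPrime K)).subset ?_
  rintro V ⟨hV, hne⟩
  rw [placesOver, ← range_valuationSubringAtPrime (B := B)] at hV
  obtain ⟨v, rfl⟩ := hV
  refine ⟨v, ?_, rfl⟩
  rw [fracOrd_valuationSubringAtPrime v b hb] at hne
  by_contra h
  exact hne (by exact_mod_cast multiplicity_eq_zero.mpr h)

/-- The length of `B / (b)` counts the prime factors of `(b)` with multiplicity, and the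
multiplicity of `P` is the order of `b` at the place `B_P`. -/
theorem ord_eq_finsum_placesOver (b : B) (hb : b ≠ 0) :
    ((Ring.ord B b).toNat : ℤ) =
      ∑ᶠ V ∈ placesOver (algebraMap B K).range, fracOrd V.toSubring (algebraMap B K b) := by
  classical
  have hI : Ideal.span {b} ≠ (0 : Ideal B) := by
    simpa [Ideal.zero_eq_bot, Ideal.span_singleton_eq_bot] using hb
  rw [placesOver, ← range_valuationSubringAtPrime (B := B),
    finsum_mem_range valuationSubringAtPrime_injective]
  simp_rw [fracOrd_valuationSubringAtPrime _ b hb]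
  rw [Ring.ord, length_quotient_eq_card_normalizedFactors hI]
  set s := normalizedFactors (Ideal.span {b}) with hs
  have hcount : ∀ v : HeightOneSpectrum B,
      multiplicity v.asIdeal (Ideal.span {b}) = s.count v.asIdeal :=
    fun v ↦ (count_normalizedFactors_eq_multiplicity hI v).symm
  simp_rw [hcount]
  rw [ENat.toNat_natCast, ← Multiset.toFinset_sum_count_eq]
  push_cast
  have hset : Set.BijOn HeightOneSpectrum.asIdeal {v : HeightOneSpectrum B | v.asIdeal ∈ s}
      (s.toFinset : Set (Ideal B)) := by
    refine ⟨fun v hv ↦ by simpa using hv, fun v _ w _ h ↦ HeightOneSpectrum.ext h, fun J hJ ↦ ?_⟩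
    have hJ' : J ∈ s := by simpa using hJ
    have hJp := prime_of_normalized_factor J hJ'
    exact ⟨⟨J, Ideal.isPrime_of_prime hJp, hJp.ne_zero⟩, hJ', rfl⟩
  rw [← finsum_mem_coe_finset, ← finsum_mem_eq_of_bijOn _ hset (fun v _ ↦ rfl)]
  refine (finsum_mem_inter_support_eq (fun v : HeightOneSpectrum B ↦ (s.count v.asIdeal : ℤ))
    _ Set.univ ?_).trans (finsum_mem_univ _)
  ext v
  simp only [Set.mem_inter_iff, Set.mem_ofPred_eq, Function.mem_support, Set.mem_univ, true_and,
    and_iff_right_iff_imp]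
  intro h
  by_contra h'
  exact h (by simpa using Multiset.count_eq_zero_of_notMem h')

end Dedekind

end KltSurface

namespace KltSurface

/-! ### Lengths over algebras with trivial residue field extensions -/

section Length

variable {k : Type*} [Field k]

/-- All residue fields of the `k`-algebra `R` at maximal ideals are equal to `k`. -/
def HasTrivialResidueFields (k : Type*) [Field k] (R : Type*) [CommRing R] [Algebra k R] : Prop :=
  ∀ I : Ideal R, I.IsMaximal → ∀ r : R, ∃ z : k, r - algebraMap k R z ∈ I

section

variable {R : Type*} [CommRing R] [Algebra k R] (hR : HasTrivialResidueFields k R)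

include hR

theorem HasTrivialResidueFields.length_quotient (I : Ideal R) (hI : I.IsMaximal) :
    Module.length k (R ⧸ I) = 1 := by
  have hs : Function.Surjective (algebraMap k (R ⧸ I)) := by
    intro x
    obtain ⟨r, rfl⟩ := Ideal.Quotient.mk_surjective x
    obtain ⟨z, hz⟩ := hR I hI r
    exact ⟨z, (Ideal.Quotient.eq.mpr hz).symm⟩
  rw [Module.length_eq_of_surjective (R := R ⧸ I) (M := R ⧸ I) hs]
  let := Ideal.Quotient.field I
  rw [Module.length_eq_one_iff]
  infer_instance

/-- Each factor of a composition series over `R` is some `R / m`, which is one-dimensional over `k`.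
-/
theorem HasTrivialResidueFields.length_eq (M : Type*) [AddCommGroup M] [Module R M] [Module k M]
    [IsScalarTower k R M] : Module.length k M = Module.length R M := by
  by_cases h : IsFiniteLength R M
  · obtain ⟨s, hs_bot, hs_top⟩ := isFiniteLength_iff_exists_compositionSeries.mp h
    rw [← Module.length_compositionSeries s hs_bot hs_top]
    suffices ∀ j, Module.length k (s j) = j by
      rw [← Fin.val_last s.length, ← this, ← RelSeries.last, hs_top]
      exact Module.length_top.symm
    intro j
    induction j using Fin.induction with
    | zero => rw [← RelSeries.head, hs_bot]; simp
    | succ i hi =>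
      have hcov : s i.castSucc ⋖ s i.succ := s.step i
      let f : s i.castSucc →ₗ[R] s i.succ := Submodule.inclusion hcov.le
      have key : IsSimpleModule R (s i.succ ⧸ LinearMap.range f) := by
        rwa [Submodule.range_inclusion, ← covBy_iff_quot_is_simple hcov.le]
      obtain ⟨m, hm, ⟨e⟩⟩ := isSimpleModule_iff_quot_maximal.mp key
      let g : s i.succ →ₗ[R] R ⧸ m := e.toLinearMap.comp (LinearMap.range f).mkQ
      have h1 : Function.Injective f := Submodule.inclusion_injective _
      have h2 : Function.Surjective g := e.surjective.comp (Submodule.mkQ_surjective _)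
      have h3 : Function.Exact f g :=
        LinearMap.exact_iff.mpr ((e.ker_comp _).trans (Submodule.ker_mkQ _))
      rw [Module.length_eq_add_of_exact (f.restrictScalars k) (g.restrictScalars k) h1 h2 h3, hi,
        hR.length_quotient m hm]
      simp
  -- Every `R`-submodule is a `k`-subspace, so finite length over `k` would imply finite length over
  -- `R`.
  · have h' : ¬ IsFiniteLength k M := by
      contrapose! h
      rw [isFiniteLength_iff_isNoetherian_isArtinian] at h ⊢
      exact h.imp (isNoetherian_of_tower k) (isArtinian_of_tower k)
    rw [← Module.length_ne_top_iff, not_ne_iff] at h h'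
    rw [h, h']

end

variable {K : Type*} [Field K] [Algebra k K]

/-- The length of the quotient of two nested subspaces. -/
noncomputable def relLength (S T : Submodule k K) : ℕ∞ :=
  Module.length k (T ⧸ S.submoduleOf T)

theorem relLength_add {S T U : Submodule k K} (h1 : S ≤ T) (h2 : T ≤ U) :
    relLength S U = relLength S T + relLength T U := by
  let f : (T ⧸ S.submoduleOf T) →ₗ[k] (U ⧸ S.submoduleOf U) :=
    Submodule.mapQ _ _ (Submodule.inclusion h2) (fun x hx ↦ hx)
  have hle : S.submoduleOf U ≤ T.submoduleOf U := fun x hx ↦ h1 hx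
  refine Module.length_eq_add_of_exact f (Submodule.factor hle) ?_
    (Submodule.factor_surjective hle) ?_
  · rw [← LinearMap.ker_eq_bot]
    refine Submodule.ker_liftQ_eq_bot _ _ _ ?_
    rw [LinearMap.ker_comp, Submodule.ker_mkQ]
    exact fun x hx ↦ hx
  · intro x
    obtain ⟨x, rfl⟩ := Submodule.mkQ_surjective _ x
    constructor
    · intro h
      have hx : x ∈ T.submoduleOf U := (Submodule.Quotient.mk_eq_zero _).mp h
      exact ⟨Submodule.Quotient.mk ⟨x, hx⟩, rfl⟩
    · rintro ⟨y, hy⟩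
      obtain ⟨y, rfl⟩ := Submodule.mkQ_surjective _ y
      rw [← hy]
      exact (Submodule.Quotient.mk_eq_zero _).mpr y.2

/-- Multiplication by `a` as a linear automorphism of the field `K`. -/
noncomputable def mulEquiv (k : Type*) [Field k] {K : Type*} [Field K] [Algebra k K] (a : K)
    (ha : a ≠ 0) : K ≃ₗ[k] K :=
  LinearEquiv.ofBijective (LinearMap.mulLeft k a)
    ⟨mul_right_injective₀ ha, fun x ↦ ⟨a⁻¹ * x, mul_inv_cancel_left₀ ha x⟩⟩

theorem relLength_map (e : K ≃ₗ[k] K) (S T : Submodule k K) :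
    relLength (S.map e.toLinearMap) (T.map e.toLinearMap) = relLength S T := by
  refine (LinearEquiv.length_eq (Submodule.Quotient.equiv _ _ (e.submoduleMap T) ?_)).symm
  ext ⟨y, hy⟩
  constructor
  · rintro ⟨⟨x, hx⟩, hx', h⟩
    exact ⟨x, hx', congrArg Subtype.val h⟩
  · rintro ⟨x, hx, rfl⟩
    obtain ⟨x', hx', h⟩ := hy
    obtain rfl : x' = x := e.injective h
    exact ⟨⟨x', hx'⟩, hx, rfl⟩

theorem relLength_mul_eq_ord (A : Subalgebra k K) (hA : HasTrivialResidueFields k A) (a : A)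
    (ha : (a : K) ≠ 0) :
    relLength (A.toSubmodule.map (mulEquiv k (a : K) ha).toLinearMap) A.toSubmodule =
      Ring.ord A a := by
  rw [Ring.ord, ← hA.length_eq]
  refine LinearEquiv.length_eq (Submodule.Quotient.equiv _
    ((Ideal.span {a}).restrictScalars k) (LinearEquiv.refl k A) ?_)
  ext x
  simp only [LinearEquiv.refl_toLinearMap, Submodule.map_id, Submodule.restrictScalars_mem,
    Ideal.mem_span_singleton']
  constructor
  · rintro ⟨y, hy, h⟩
    exact ⟨⟨y, hy⟩, Subtype.ext ((mul_comm _ _).trans h)⟩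
  · rintro ⟨y, rfl⟩
    exact ⟨y, y.2, mul_comm _ _⟩

/-- A one-dimensional ring and a one-dimensional birational extension of it with bounded
denominators have the same order function. -/
theorem ord_eq_ord_of_le {A B : Subalgebra k K} (hA : HasTrivialResidueFields k A)
    (hB : HasTrivialResidueFields k B) (hAB : A ≤ B)
    (hB' : ∀ b : B, b ≠ 0 → Ring.ord B b ≠ ⊤)
    (d : A) (hd : d ≠ 0) (hdB : ∀ b ∈ B, (d : K) * b ∈ A) (a : A) (ha : a ≠ 0) :
    Ring.ord A a = Ring.ord B ⟨a, hAB a.2⟩ := by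
  have haK : (a : K) ≠ 0 := fun h ↦ ha (Subtype.ext h)
  have hdK : (d : K) ≠ 0 := fun h ↦ hd (Subtype.ext h)
  rw [← relLength_mul_eq_ord A hA a haK,
    ← relLength_mul_eq_ord B hB ⟨a, hAB a.2⟩ haK]
  set SA := A.toSubmodule
  set SB := B.toSubmodule
  have hle : SA ≤ SB := hAB
  set m := (mulEquiv k (a : K) haK).toLinearMap
  have h1 : SA.map m ≤ SA := by
    rintro _ ⟨x, hx, rfl⟩
    exact A.mul_mem a.2 hx
  have h2 : SB.map m ≤ SB := by
    rintro _ ⟨x, hx, rfl⟩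
    exact B.mul_mem (hAB a.2) hx
  -- The length of `B / aA` is computed along `aA ≤ A ≤ B` and along `aA ≤ aB ≤ B`. Multiplication
  -- by `a` identifies `B / A` with `aB / aA`, and this common term cancels once it is finite.
  have e1 := relLength_add h1 hle
  have e2 := relLength_add (Submodule.map_mono (f := m) hle) h2
  rw [relLength_map (mulEquiv k (a : K) haK)] at e2
  have h3 : SB.map (mulEquiv k (d : K) hdK).toLinearMap ≤ SA := by
    rintro _ ⟨x, hx, rfl⟩
    exact hdB x hx
  have e3 := relLength_add h3 hle
  -- `dB ≤ A ≤ B`, and `B / dB` has finite length.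
  have hfin : relLength SA SB ≠ ⊤ := by
    intro h
    rw [h, add_top] at e3
    refine hB' ⟨d, hAB d.2⟩ (fun h ↦ hdK (congrArg Subtype.val h)) ?_
    rw [← relLength_mul_eq_ord B hB ⟨d, hAB d.2⟩ hdK]
    exact e3
  rw [e1, add_comm] at e2
  exact WithTop.add_left_cancel hfin e2

end Length

end KltSurface

namespace KltSurface

/-! ### Orders at a one-dimensional local ring and its normalization -/

section Normalization

variable {k : Type*} [Field k] [IsAlgClosed k]

/-- `B / I` is integral over `A / (I ∩ A)`, a quotient of `k`, and `k` is algebraically closed. -/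
theorem hasTrivialResidueFields_of_isIntegral {A B : Type*} [CommRing A] [CommRing B] [Algebra k A]
    [Algebra k B] [Algebra A B] [IsScalarTower k A B] [Algebra.IsIntegral A B]
    (hA : HasTrivialResidueFields k A) : HasTrivialResidueFields k B := by
  intro I hI r
  have hm : (I.comap (algebraMap A B)).IsMaximal :=
    Ideal.isMaximal_comap_of_isIntegral_of_isMaximal I
  have h1 : (algebraMap k (A ⧸ I.comap (algebraMap A B))).IsIntegral := by
    refine RingHom.isIntegral_of_surjective _ fun x ↦ ?_
    obtain ⟨a, rfl⟩ := Ideal.Quotient.mk_surjective x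
    obtain ⟨z, hz⟩ := hA _ hm a
    exact ⟨z, (Ideal.Quotient.eq.mpr hz).symm⟩
  have h2 : (Ideal.quotientMap I (algebraMap A B) le_rfl).IsIntegral := by
    have h3 : ((Ideal.quotientMap I (algebraMap A B) le_rfl).comp
        (Ideal.Quotient.mk (I.comap (algebraMap A B)))).IsIntegral := by
      rw [Ideal.quotientMap_comp_mk]
      exact RingHom.IsIntegral.trans _ _ (algebraMap_isIntegral_iff.mpr inferInstance)
        (RingHom.isIntegral_of_surjective _ Ideal.Quotient.mk_surjective)
    exact RingHom.IsIntegral.tower_top _ _ h3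
  have h4 := RingHom.IsIntegral.trans _ _ h1 h2
  have h5 : (Ideal.quotientMap I (algebraMap A B) le_rfl).comp
      (algebraMap k (A ⧸ I.comap (algebraMap A B))) = algebraMap k (B ⧸ I) := by
    ext z
    change Ideal.Quotient.mk I (algebraMap A B (algebraMap k A z)) =
      Ideal.Quotient.mk I (algebraMap k B z)
    rw [← IsScalarTower.algebraMap_apply]
  rw [h5] at h4
  have : Algebra.IsIntegral k (B ⧸ I) := algebraMap_isIntegral_iff.mp h4
  have : IsDomain (B ⧸ I) := (Ideal.Quotient.isDomain_iff_prime I).mpr hI.isPrime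
  obtain ⟨z, hz⟩ := (IsAlgClosed.algebraMap_bijective_of_isIntegral (k := k) (K := B ⧸ I)).2
    (Ideal.Quotient.mk I r)
  exact ⟨z, Ideal.Quotient.eq.mp hz.symm⟩

variable {K : Type*} [Field K] [Algebra k K]

theorem le_of_isIntegral {A : Subring K} {V : ValuationSubring K} (hV : A ≤ V.toSubring) {x : K}
    (hx : IsIntegral A x) : x ∈ V := by
  let : Algebra A V := (Subring.inclusion hV).toAlgebra
  have : IsScalarTower A V K := IsScalarTower.of_algebraMap_eq fun _ ↦ rfl
  obtain ⟨y, hy⟩ := IsIntegrallyClosed.algebraMap_eq_of_integral (R := V) (hx.tower_top (A := V))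
  rw [← hy]
  exact y.2

-- Valuation rings are integrally closed, so passing to the integral closure imposes no new
-- condition.
omit [IsAlgClosed k] in
theorem placesOver_integralClosure (A : Subalgebra k K) :
    placesOver (algebraMap (integralClosure A K) K).range = placesOver A.toSubring := by
  ext V
  refine and_congr_right fun hV ↦ ⟨fun h x hx ↦ h ⟨⟨x, ?_⟩, rfl⟩, ?_⟩
  · exact isIntegral_algebraMap (R := A) (x := ⟨x, hx⟩)
  · rintro h _ ⟨b, rfl⟩
    exact le_of_isIntegral h b.2

section

variable {A : Subalgebra k K} (hO : IsOrdRing A.toSubring) (hA : HasTrivialResidueFields k A)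
  (hfin : Module.Finite A (integralClosure A K))

include hO hfin

omit [IsAlgClosed k] in
theorem isDedekindDomain_integralClosure : IsDedekindDomain (integralClosure A K) := by
  have : IsFractionRing A K := hO.frac
  have : IsNoetherianRing A := hO.noetherian
  have : Ring.KrullDimLE 1 A := hO.dim
  have : Ring.DimensionLEOne A := ⟨fun hp hp' ↦
    (Ring.krullDimLE_one_iff_of_noZeroDivisors (R := A)).mp ‹_› _ hp hp'⟩
  have : IsNoetherianRing (integralClosure A K) := IsNoetherianRing.of_finite A _
  exact
  { (inferInstance : IsNoetherianRing (integralClosure A K)),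
    Ring.DimensionLEOne.of_isIntegral A (integralClosure A K),
    (isIntegrallyClosed_iff K).mpr fun {x} hx =>
      ⟨⟨x, isIntegral_trans (R := A) x hx⟩, rfl⟩ with : IsDedekindDomain (integralClosure A K) }

omit [IsAlgClosed k] in
theorem isOrdRing_of_mem_placesOver' {V : ValuationSubring K} (hV : V ∈ placesOver A.toSubring) :
    IsOrdRing V.toSubring := by
  have := isDedekindDomain_integralClosure hO hfin
  have : IsFractionRing A K := hO.frac
  rw [← placesOver_integralClosure] at hV
  exact isOrdRing_of_mem_placesOver hV

include hA

/-- A common denominator `d` of finitely many generators of the integral closure multiplies all of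
it into `A`; this is the bounded denominator required by `ord_eq_ord_of_le`. -/
theorem ord_eq_ord_integralClosure (a : A) (ha : a ≠ 0) :
    Ring.ord A a = Ring.ord (integralClosure A K) (algebraMap A (integralClosure A K) a) := by
  have := isDedekindDomain_integralClosure hO hfin
  have : IsFractionRing A K := hO.frac
  classical
  obtain ⟨s, hs⟩ := hfin.fg_top
  obtain ⟨d, hd⟩ := IsLocalization.exist_integer_multiples_of_finset (nonZeroDivisors A)
    (s.image (algebraMap (integralClosure A K) K))
  have hdB : ∀ b : integralClosure A K, ∃ c : A, (c : K) = (d : A) * (b : K) := by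
    intro b
    have hb : b ∈ Submodule.span A (s : Set (integralClosure A K)) := by rw [hs]; trivial
    induction hb using Submodule.span_induction with
    | mem x hx =>
      obtain ⟨c, hc⟩ := hd (x : K) (Finset.mem_image_of_mem _ hx)
      exact ⟨c, hc⟩
    | zero => exact ⟨0, by simp⟩
    | add x y _ _ hx hy =>
      obtain ⟨c, hc⟩ := hx
      obtain ⟨c', hc'⟩ := hy
      exact ⟨c + c', by push_cast; rw [hc, hc']; ring⟩
    | smul r x _ hx =>
      obtain ⟨c, hc⟩ := hx
      refine ⟨r * c, ?_⟩
      push_cast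
      rw [hc]
      change _ = _ * ((r : K) * (x : K))
      ring
  have hB : HasTrivialResidueFields k (integralClosure A K) :=
    hasTrivialResidueFields_of_isIntegral hA
  refine ord_eq_ord_of_le (A := A) (B := (integralClosure A K).restrictScalars k) hA hB
    (fun x hx ↦ isIntegral_algebraMap (R := A) (x := ⟨x, hx⟩)) ?_ d (nonZeroDivisors.ne_zero d.2) ?_
    a ha
  · intro b hb
    exact Ring.ord_ne_top (R := integralClosure A K) (mem_nonZeroDivisors_of_ne_zero hb)
  · intro b hb
    obtain ⟨c, hc⟩ := hdB ⟨b, hb⟩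
    rw [← hc]
    exact c.2

/-- The order of a function at a one-dimensional ring is the sum of its orders at the places
over the ring. -/
theorem fracOrd_eq_finsum_placesOver (h : K) (hh : h ≠ 0) :
    {V | V ∈ placesOver A.toSubring ∧ fracOrd V.toSubring h ≠ 0}.Finite ∧
    fracOrd A.toSubring h = ∑ᶠ V ∈ placesOver A.toSubring, fracOrd V.toSubring h := by
  have hD := isDedekindDomain_integralClosure hO hfin
  have : IsFractionRing A K := hO.frac
  have key : ∀ a : A, a ≠ 0 → {V | V ∈ placesOver A.toSubring ∧
      fracOrd V.toSubring (a : K) ≠ 0}.Finite ∧ ((Ring.ord A a).toNat : ℤ) =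
      ∑ᶠ V ∈ placesOver A.toSubring, fracOrd V.toSubring (a : K) := by
    intro a ha
    have ha' : algebraMap A (integralClosure A K) a ≠ 0 := by
      intro h
      exact ha (Subtype.ext (congrArg (algebraMap (integralClosure A K) K) h))
    have h1 := ord_eq_finsum_placesOver (K := K) _ ha'
    have h2 := finite_placesOver_coe (K := K) _ ha'
    rw [placesOver_integralClosure] at h1 h2
    rw [ord_eq_ord_integralClosure hO hA hfin a ha]
    exact ⟨h2, h1⟩
  obtain ⟨a, b, ha, hb, e⟩ := hO.exists_eq_div h hh
  have haK : (a : K) ≠ 0 := fun h ↦ ha (Subtype.ext h)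
  have hbK : (b : K) ≠ 0 := fun h ↦ hb (Subtype.ext h)
  obtain ⟨fa, ea⟩ := key a ha
  obtain ⟨fb, eb⟩ := key b hb
  have hV : ∀ V ∈ placesOver A.toSubring, fracOrd V.toSubring h =
      fracOrd V.toSubring (a : K) - fracOrd V.toSubring (b : K) := by
    intro V hV
    rw [eq_div_of_mul_eq hbK e, (isOrdRing_of_mem_placesOver' hO hfin hV).fracOrd_div haK hbK]
  have fh : {V | V ∈ placesOver A.toSubring ∧ fracOrd V.toSubring h ≠ 0}.Finite := by
    refine (fa.union fb).subset ?_
    rintro V ⟨hV', hne⟩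
    rw [hV V hV'] at hne
    by_contra hcon
    simp only [Set.mem_union, Set.mem_ofPred_eq, hV', true_and, not_or, not_not] at hcon
    rw [hcon.1, hcon.2] at hne
    exact hne rfl
  refine ⟨fh, ?_⟩
  rw [fracOrd_eq A.toSubring hO.ord_ne_top h a b ha hb e, sub_eq_iff_eq_add]
  refine ea.trans ?_
  rw [show ((Ring.ord A.toSubring b).toNat : ℤ) = _ from eb,
    ← finsum_mem_add_distrib' (fh.subset fun V h ↦ h) (fb.subset fun V h ↦ h)]
  exact finsum_mem_congr rfl fun V hV' ↦ by rw [hV V hV', sub_add_cancel]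

end

end Normalization

end KltSurface

namespace KltSurface

/-! ### The product formula on a function field of one variable -/

section ProductFormula

variable {k : Type*} [Field k] [IsAlgClosed k] {K : Type*} [Field K] [Algebra k K]

theorem mem_range_of_isIntegral {x : K} (hx : IsIntegral k x) : x ∈ (algebraMap k K).range := by
  have := Algebra.IsIntegral.adjoin (R := k) (A := K) (S := {x}) (by simpa using hx)
  obtain ⟨z, hz⟩ := (IsAlgClosed.algebraMap_bijective_of_isIntegral
    (k := k) (K := Algebra.adjoin k {x})).2 ⟨x, Algebra.self_mem_adjoin_singleton k x⟩
  exact ⟨z, congrArg Subtype.val hz⟩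

/-- The Nullstellensatz: residue fields are finite over the algebraically closed field `k`. -/
theorem hasTrivialResidueFields_of_finiteType (A : Type*) [CommRing A] [Algebra k A]
    [Algebra.FiniteType k A] : HasTrivialResidueFields k A := by
  intro I hI r
  let := Ideal.Quotient.field I
  have : Module.Finite k (A ⧸ I) := finite_of_finite_type_of_isJacobsonRing k (A ⧸ I)
  obtain ⟨z, hz⟩ := (IsAlgClosed.algebraMap_bijective_of_isIntegral (k := k) (K := A ⧸ I)).2
    (Ideal.Quotient.mk I r)
  exact ⟨z, Ideal.Quotient.eq.mp hz.symm⟩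

variable (k K) in
/-- `K` is finitely generated of transcendence degree at most one over `k`. -/
structure IsCurveField : Prop where
  essFiniteType : Algebra.EssFiniteType k K
  trdeg_le : Algebra.trdeg k K ≤ 1

open scoped IntermediateField.algebraAdjoinAdjoin
open scoped IntermediateField

/-- The identity `∑ e f = n` over the maximal ideal `(t)` with residue field `k`: the length of `B /
tB` is its dimension over `k = A / t`, which for a finite extension of a Dedekind domain is the
degree of the fraction fields. -/
theorem ord_eq_finrank_of_bijective {k : Type*} [Field k] {A B : Type*} [CommRing A] [CommRing B]
    [Algebra k A] [Algebra k B] [Algebra A B] [IsScalarTower k A B] [IsDedekindDomain A]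
    [IsDomain B] [Module.Finite A B] (hB : HasTrivialResidueFields k B) {t : A}
    (ht : Function.Bijective (algebraMap k (A ⧸ Ideal.span {t}))) (F L : Type*) [Field F] [Field L]
    [Algebra A F] [IsFractionRing A F] [Algebra B L] [IsFractionRing B L] [Algebra F L]
    [Algebra A L] [IsScalarTower A F L] [IsScalarTower A B L] :
    Ring.ord B (algebraMap A B t) = Module.finrank F L := by
  have hmax : (Ideal.span {t}).IsMaximal := by
    have e := RingEquiv.ofBijective _ ht
    exact Ideal.Quotient.maximal_of_isField _ (e.symm.toMulEquiv.isField (Field.toIsField k))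
  let := Ideal.Quotient.field (Ideal.span {t})
  have hspan : Ideal.span {algebraMap A B t} = (Ideal.span {t}).map (algebraMap A B) := by
    rw [Ideal.map_span, Set.image_singleton]
  rw [Ring.ord, hspan, ← hB.length_eq,
    ← Ideal.finrank_quotient_map (R := A) (S := B) (Ideal.span {t}) F L]
  have : Module.Finite (A ⧸ Ideal.span {t}) (B ⧸ (Ideal.span {t}).map (algebraMap A B)) :=
    Module.Finite.of_restrictScalars_finite A _ _
  have : IsScalarTower k (A ⧸ Ideal.span {t}) (B ⧸ (Ideal.span {t}).map (algebraMap A B)) := by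
    refine IsScalarTower.of_algebraMap_eq fun z ↦ ?_
    change Ideal.Quotient.mk _ (algebraMap k B z) =
      Ideal.Quotient.mk _ (algebraMap A B (algebraMap k A z))
    rw [← IsScalarTower.algebraMap_apply]
  rw [← Module.length_eq_finrank, Module.length_eq_of_surjective ht.2]

section

variable [CharZero k] (hK : IsCurveField k K) {h : K} (hh : Transcendental k h)

include hK hh

-- In transcendence degree at most one, `h` alone is a transcendence basis; an algebraic extension
-- that is essentially of finite type is finite.
omit [IsAlgClosed k] [CharZero k] in
theorem IsCurveField.finiteDimensional : FiniteDimensional k⟮h⟯ K := by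
  have := hK.essFiniteType
  have := Algebra.EssFiniteType.of_comp k k⟮h⟯ K
  have hb : IsTranscendenceBasis k (fun _ : Unit ↦ h) := by
    refine AlgebraicIndependent.isTranscendenceBasis_of_lift_trdeg_le ?_
      (hK.trdeg_le.trans_lt Cardinal.one_lt_aleph0) (by simpa using hK.trdeg_le)
    exact algebraicIndependent_unique_type_iff.mpr hh
  have := hb.isAlgebraic_field
  rw [Set.range_const] at this
  exact Algebra.finite_of_essFiniteType_of_isAlgebraic

omit [IsAlgClosed k] [CharZero k] hK hh in
theorem isPrincipalIdealRing_adjoin : IsPrincipalIdealRing (Algebra.adjoin k {h}) := by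
  rw [Algebra.adjoin_singleton_eq_range_aeval]
  exact IsPrincipalIdealRing.of_surjective (Polynomial.aeval h).rangeRestrict.toRingHom
    (AlgHom.rangeRestrict_surjective _)

omit [IsAlgClosed k] [CharZero k] hh hK in
theorem placesOver_adjoin : placesOver (Algebra.adjoin k {h}).toSubring =
    {V | V ∈ placesOver (algebraMap k K).range ∧ h ∈ V} := by
  ext V
  constructor
  · rintro ⟨hV, h1⟩
    refine ⟨⟨hV, ?_⟩, h1 (Algebra.self_mem_adjoin_singleton k h)⟩
    rintro _ ⟨z, rfl⟩
    exact h1 (Subalgebra.algebraMap_mem _ z)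
  · rintro ⟨⟨hV, h1⟩, h2⟩
    refine ⟨hV, fun x hx ↦ ?_⟩
    let S : Subalgebra k K := { V.toSubring with algebraMap_mem' := fun z ↦ h1 ⟨z, rfl⟩ }
    exact (Algebra.adjoin_le (S := S) (Set.singleton_subset_iff.mpr h2)) hx

omit [IsAlgClosed k] in
theorem isDedekindDomain_integralClosure_adjoin :
    IsDedekindDomain (integralClosure (Algebra.adjoin k {h}) K) := by
  have := isPrincipalIdealRing_adjoin (k := k) (h := h)
  have := hK.finiteDimensional hh
  have : IsDedekindDomain (Algebra.adjoin k {h}) := inferInstance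
  exact IsIntegralClosure.isDedekindDomain (Algebra.adjoin k {h}) k⟮h⟯ K _

omit [IsAlgClosed k] [CharZero k] in
theorem isFractionRing_integralClosure_adjoin :
    IsFractionRing (integralClosure (Algebra.adjoin k {h}) K) K := by
  have := hK.finiteDimensional hh
  exact IsIntegralClosure.isFractionRing_of_finite_extension (Algebra.adjoin k {h}) k⟮h⟯ K _

/-- The zeros of `h`, counted with multiplicity, number `[K : k(h)]`, because `k[h] / (h) = k`. -/
theorem ord_integralClosure_adjoin :
    Ring.ord (integralClosure (Algebra.adjoin k {h}) K)
      (algebraMap (Algebra.adjoin k {h}) _ ⟨h, Algebra.self_mem_adjoin_singleton k h⟩) =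
      Module.finrank k⟮h⟯ K := by
  have := isPrincipalIdealRing_adjoin (k := k) (h := h)
  have := hK.finiteDimensional hh
  have := isDedekindDomain_integralClosure_adjoin hK hh
  have := isFractionRing_integralClosure_adjoin hK hh
  have : Algebra.FiniteType k (Algebra.adjoin k {h}) :=
    .adjoin_of_finite (Set.finite_singleton h)
  have hA := hasTrivialResidueFields_of_finiteType (k := k) (Algebra.adjoin k {h})
  have hB : HasTrivialResidueFields k (integralClosure (Algebra.adjoin k {h}) K) :=
    hasTrivialResidueFields_of_isIntegral hA
  have hfin : Module.Finite (Algebra.adjoin k {h}) (integralClosure (Algebra.adjoin k {h}) K) :=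
    IsIntegralClosure.finite (Algebra.adjoin k {h}) k⟮h⟯ K _
  let A := Algebra.adjoin k {h}
  let t : A := ⟨h, Algebra.self_mem_adjoin_singleton k h⟩
  -- A polynomial in `h` is congruent to its constant coefficient modulo `h`.
  have hsurj : Function.Surjective (algebraMap k (A ⧸ Ideal.span {t})) := by
    intro x
    obtain ⟨a, rfl⟩ := Ideal.Quotient.mk_surjective x
    have ha := a.2
    have ha' : (a : K) ∈ (Polynomial.aeval (R := k) h).range := by
      rw [← Algebra.adjoin_singleton_eq_range_aeval]
      exact ha
    obtain ⟨p, hp⟩ := ha'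
    have hp' : a = Polynomial.aeval t p := by
      apply Subtype.ext
      rw [← hp, ← Subalgebra.coe_val, ← Polynomial.aeval_algHom_apply]
      rfl
    refine ⟨p.coeff 0, ?_⟩
    change Ideal.Quotient.mk _ (algebraMap k A _) = _
    rw [hp', eq_comm, Ideal.Quotient.eq, Ideal.mem_span_singleton]
    nth_rw 1 [← Polynomial.divX_mul_X_add p]
    simp
  -- If `h * p(h) = 1`, the polynomial `X * p - 1` vanishes at the transcendental `h`, yet its value
  -- at `0` is `-1`.
  have hne : Ideal.span {t} ≠ ⊤ := by
    intro htop
    obtain ⟨u, hu⟩ := (Ideal.span_singleton_eq_top.mp htop).exists_right_inv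
    obtain ⟨p, hp⟩ : (u : K) ∈ (Polynomial.aeval (R := k) h).range := by
      rw [← Algebra.adjoin_singleton_eq_range_aeval]
      exact u.2
    have h1 : h * (u : K) = 1 := congrArg Subtype.val hu
    have h2 : Polynomial.aeval h (Polynomial.X * p - 1) = 0 := by
      have hp' : Polynomial.aeval h p = (u : K) := hp
      simp [hp', h1]
    have h3 := (transcendental_iff.mp hh) _ h2
    have h4 := congrArg (Polynomial.eval 0) h3
    simp at h4
  have hbij : Function.Bijective (algebraMap k (A ⧸ Ideal.span {t})) := by
    have : Nontrivial (A ⧸ Ideal.span {t}) := Ideal.Quotient.nontrivial_iff.mpr hne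
    exact ⟨(algebraMap k (A ⧸ Ideal.span {t})).injective, hsurj⟩
  exact ord_eq_finrank_of_bijective hB hbij k⟮h⟯ K

theorem finsum_placesOver_adjoin :
    {V | V ∈ placesOver (Algebra.adjoin k {h}).toSubring ∧ fracOrd V.toSubring h ≠ 0}.Finite ∧
    ∑ᶠ V ∈ placesOver (Algebra.adjoin k {h}).toSubring, fracOrd V.toSubring h =
      Module.finrank k⟮h⟯ K := by
  have := isDedekindDomain_integralClosure_adjoin hK hh
  have := isFractionRing_integralClosure_adjoin hK hh
  have h0 : algebraMap (Algebra.adjoin k {h}) (integralClosure (Algebra.adjoin k {h}) K)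
      ⟨h, Algebra.self_mem_adjoin_singleton k h⟩ ≠ 0 := by
    intro h'
    have : h = 0 := congrArg Subtype.val h'
    exact hh (this ▸ isAlgebraic_zero)
  have h1 := finite_placesOver_coe (K := K) _ h0
  have h2 := ord_eq_finsum_placesOver (K := K) _ h0
  rw [ord_integralClosure_adjoin hK hh, ENat.toNat_natCast] at h2
  rw [placesOver_integralClosure] at h1 h2
  exact ⟨h1, h2.symm⟩

omit [IsAlgClosed k] in
theorem isOrdRing_of_mem_placesOver_adjoin {V : ValuationSubring K}
    (hV : V ∈ placesOver (Algebra.adjoin k {h}).toSubring) : IsOrdRing V.toSubring := by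
  have := isDedekindDomain_integralClosure_adjoin hK hh
  have := isFractionRing_integralClosure_adjoin hK hh
  rw [← placesOver_integralClosure] at hV
  exact isOrdRing_of_mem_placesOver hV

end

variable [CharZero k] (hK : IsCurveField k K)

include hK

/-- An element `y` outside `V` is transcendental, since `V` contains the constants; so `V` is a
place over `k[y⁻¹]`, whose integral closure is a Dedekind domain. -/
theorem IsCurveField.isOrdRing {V : ValuationSubring K}
    (hV : V ∈ placesOver (algebraMap k K).range) : IsOrdRing V.toSubring := by
  obtain ⟨y, hy⟩ : ∃ y, y ∉ V := by
    by_contra! hcon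
    exact hV.1 (eq_top_iff.mpr fun x _ ↦ hcon x)
  have hy' : Transcendental k y⁻¹ := by
    intro h
    have h1 := (isAlgebraic_iff_isIntegral.mp (IsAlgebraic.inv_iff.mp h))
    exact hy (hV.2 (mem_range_of_isIntegral h1))
  refine isOrdRing_of_mem_placesOver_adjoin hK hy' ?_
  rw [placesOver_adjoin]
  exact ⟨hV, (V.mem_or_inv_mem y).resolve_left hy⟩

/-- The product formula: a non-zero function has finitely many zeros and poles, and the sum of
its orders at all places is zero. -/
theorem IsCurveField.finsum_places_eq_zero {h : K} (h0 : h ≠ 0) :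
    {V | V ∈ placesOver (algebraMap k K).range ∧ fracOrd V.toSubring h ≠ 0}.Finite ∧
    ∑ᶠ V ∈ placesOver (algebraMap k K).range, fracOrd V.toSubring h = 0 := by
  -- The places over `k[h]` carry the zeros of `h`, those over `k[h⁻¹]` its poles. The two totals
  -- are `[K : k(h)]` and `-[K : k(h⁻¹)]`, the two fields agree, and places common to both sets
  -- contribute nothing because `h` is a unit there.
  by_cases hh : Transcendental k h
  · have hh' : Transcendental k h⁻¹ := fun h' ↦ hh (IsAlgebraic.inv_iff.mp h')
    obtain ⟨f1, e1⟩ := finsum_placesOver_adjoin hK hh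
    obtain ⟨f2, e2⟩ := finsum_placesOver_adjoin hK hh'
    have hneg : ∀ V ∈ placesOver (Algebra.adjoin k {h⁻¹}).toSubring,
        fracOrd V.toSubring h⁻¹ = -fracOrd V.toSubring h := fun V hV ↦
      (isOrdRing_of_mem_placesOver_adjoin hK hh' hV).fracOrd_inv h0
    have f2' : {V | V ∈ placesOver (Algebra.adjoin k {h⁻¹}).toSubring ∧
        fracOrd V.toSubring h ≠ 0}.Finite := by
      refine f2.subset ?_
      rintro V ⟨hV, hne⟩
      exact ⟨hV, by rw [hneg V hV]; omega⟩
    have e2' : ∑ᶠ V ∈ placesOver (Algebra.adjoin k {h⁻¹}).toSubring, fracOrd V.toSubring h =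
        -(Module.finrank k⟮h⁻¹⟯ K : ℤ) := by
      have f2'' : Set.Finite (placesOver (Algebra.adjoin k {h⁻¹}).toSubring ∩
          Function.support fun V ↦ fracOrd V.toSubring h⁻¹) := f2
      rw [← e2, eq_neg_iff_add_eq_zero, ← finsum_mem_add_distrib' f2' f2'']
      exact (finsum_mem_congr rfl fun V hV ↦ by rw [hneg V hV, add_neg_cancel]).trans
        (finsum_mem_zero _)
    have hadj : k⟮h⁻¹⟯ = k⟮h⟯ := by
      apply le_antisymm
      · exact IntermediateField.adjoin_simple_le_iff.mpr
          (inv_mem (IntermediateField.mem_adjoin_simple_self k h))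
      · refine IntermediateField.adjoin_simple_le_iff.mpr ?_
        simpa using inv_mem (IntermediateField.mem_adjoin_simple_self k h⁻¹)
    have hunion : placesOver (algebraMap k K).range =
        placesOver (Algebra.adjoin k {h}).toSubring ∪
          placesOver (Algebra.adjoin k {h⁻¹}).toSubring := by
      rw [placesOver_adjoin, placesOver_adjoin]
      ext V
      simp only [Set.mem_union, Set.mem_ofPred_eq, ← and_or_left]
      exact ⟨fun hV ↦ ⟨hV, V.mem_or_inv_mem h⟩, fun hV ↦ hV.1⟩
    have hinter : ∑ᶠ V ∈ placesOver (Algebra.adjoin k {h}).toSubring ∩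
        placesOver (Algebra.adjoin k {h⁻¹}).toSubring, fracOrd V.toSubring h = 0 := by
      refine (finsum_mem_congr rfl fun V hV ↦ ?_).trans (finsum_mem_zero _)
      have hO := isOrdRing_of_mem_placesOver_adjoin hK hh hV.1
      rw [placesOver_adjoin, placesOver_adjoin] at hV
      exact hO.fracOrd_eq_zero hV.1.2 hV.2.2
    have hsum := finsum_mem_union_inter' (f := fun V : ValuationSubring K ↦ fracOrd V.toSubring h)
      (s := placesOver (Algebra.adjoin k {h}).toSubring)
      (t := placesOver (Algebra.adjoin k {h⁻¹}).toSubring) f1 f2'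
    rw [hinter, add_zero, e1, e2', hadj, add_neg_cancel] at hsum
    rw [hunion]
    refine ⟨(f1.union f2').subset ?_, hsum⟩
    rintro V ⟨hV | hV, hne⟩
    exacts [Or.inl ⟨hV, hne⟩, Or.inr ⟨hV, hne⟩]
  -- An algebraic `h` is a constant, hence a unit at every place.
  · have hint : IsIntegral k h := isAlgebraic_iff_isIntegral.mp (not_not.mp hh)
    have hz : ∀ V ∈ placesOver (algebraMap k K).range, fracOrd V.toSubring h = 0 := by
      intro V hV
      obtain ⟨z, rfl⟩ := mem_range_of_isIntegral hint
      refine (hK.isOrdRing hV).fracOrd_eq_zero (hV.2 ⟨z, rfl⟩) (hV.2 ⟨z⁻¹, ?_⟩)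
      rw [map_inv₀]
    refine ⟨?_, (finsum_mem_congr rfl hz).trans (finsum_mem_zero _)⟩
    convert Set.finite_empty
    ext V
    simp only [Set.mem_ofPred_eq, Set.mem_empty_iff_false, iff_false, not_and, not_not]
    exact hz V

end ProductFormula

end KltSurface

namespace KltSurface

/-! ### Degrees on complete curves as sums over places -/

section CurveModel

variable {k : Type*} [Field k] [IsAlgClosed k] {K : Type*} [Field K] [Algebra k K]

/-- The subalgebra `A` of `K` behaves like the local ring at a closed point of a curve over `k`
with function field `K`. -/
structure IsCurvePoint (A : Subalgebra k K) : Prop where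
  ordRing : IsOrdRing A.toSubring
  residue : HasTrivialResidueFields k A
  finite : Module.Finite A (integralClosure A K)

/-- The family `A` of subalgebras of `K` behaves like the local rings at the closed points of a
complete curve over `k` with function field `K`. -/
structure IsCompleteModel {P : Type*} (A : P → Subalgebra k K) : Prop where
  point : ∀ p, IsCurvePoint (A p)
  center : ∀ V ∈ placesOver (algebraMap k K).range, ∃! p, (A p).toSubring ≤ V.toSubring

/-- The set of points `p` at which `h p` is not a unit. -/
def nonUnitLocus {P : Type*} (A : P → Subalgebra k K) (h : P → K) : Set P :=
  {p | ¬ (h p ∈ A p ∧ (h p)⁻¹ ∈ A p)}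

omit [IsAlgClosed k] in
theorem placesOver_le (A : Subalgebra k K) {V : ValuationSubring K}
    (hV : V ∈ placesOver A.toSubring) : V ∈ placesOver (algebraMap k K).range := by
  refine ⟨hV.1, ?_⟩
  rintro _ ⟨z, rfl⟩
  exact hV.2 (A.algebraMap_mem z)

variable {P : Type*} {A : P → Subalgebra k K}

/-- The order at a point is a sum over the places above it, and each place has exactly one center,
so the sum over points rearranges into a single sum over all places. Finiteness of the non-unit
locus permits the interchange. -/
theorem IsCompleteModel.finsum_eq (hA : IsCompleteModel A) (h : P → K) (h0 : ∀ p, h p ≠ 0)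
    (hfin : (nonUnitLocus A h).Finite) (c : ValuationSubring K → P)
    (hc : ∀ V ∈ placesOver (algebraMap k K).range, (A (c V)).toSubring ≤ V.toSubring) :
    ∑ᶠ p, fracOrd (A p).toSubring (h p) =
      ∑ᶠ V ∈ placesOver (algebraMap k K).range, fracOrd V.toSubring (h (c V)) := by
  have hcV : ∀ p, ∀ V ∈ placesOver (A p).toSubring, c V = p := fun p V hV ↦
    (hA.center V (placesOver_le _ hV)).unique (hc V (placesOver_le _ hV)) hV.2
  let T : P → Set (ValuationSubring K) := fun p ↦
    {V | V ∈ placesOver (A p).toSubring ∧ fracOrd V.toSubring (h p) ≠ 0}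
  have hT : ∀ p, (T p).Finite ∧ fracOrd (A p).toSubring (h p) =
      ∑ᶠ V ∈ placesOver (A p).toSubring, fracOrd V.toSubring (h p) := fun p ↦
    fracOrd_eq_finsum_placesOver (hA.point p).ordRing (hA.point p).residue (hA.point p).finite
      (h p) (h0 p)
  have hT' : ∀ p, fracOrd (A p).toSubring (h p) =
      ∑ᶠ V ∈ T p, fracOrd V.toSubring (h (c V)) := by
    intro p
    rw [(hT p).2, ← finsum_mem_inter_support]
    exact finsum_mem_congr rfl fun V hV ↦ by rw [hcV p V hV.1]
  have hun : ∀ p ∉ nonUnitLocus A h, ∀ V ∈ placesOver (A p).toSubring,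
      fracOrd V.toSubring (h p) = 0 := by
    intro p hp V hV
    have hp' := not_not.mp hp
    exact (isOrdRing_of_mem_placesOver' (hA.point p).ordRing (hA.point p).finite
      hV).fracOrd_eq_zero (hV.2 hp'.1) (hV.2 hp'.2)
  have hsupp : Function.support (fun p ↦ fracOrd (A p).toSubring (h p)) ⊆ nonUnitLocus A h := by
    intro p hp
    by_contra hcon
    refine hp ?_
    exact (hA.point p).ordRing.fracOrd_eq_zero (not_not.mp hcon).1 (not_not.mp hcon).2
  have hdisj : (nonUnitLocus A h).PairwiseDisjoint T := by
    intro p _ q _ hpq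
    rw [Function.onFun, Set.disjoint_left]
    intro V hV hV'
    exact hpq ((hcV p V hV.1).symm.trans (hcV q V hV'.1))
  have hsum : ∑ᶠ p, fracOrd (A p).toSubring (h p) =
      ∑ᶠ p ∈ nonUnitLocus A h, fracOrd (A p).toSubring (h p) := by
    rw [← finsum_mem_univ]
    refine finsum_mem_inter_support_eq _ _ _ ?_
    rw [Set.univ_inter, Set.inter_eq_right.mpr hsupp]
  rw [hsum, finsum_mem_congr rfl fun p _ ↦ hT' p,
    ← finsum_mem_biUnion hdisj hfin fun p _ ↦ (hT p).1,
    ← finsum_mem_inter_support _ (placesOver _)]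
  refine finsum_mem_congr ?_ fun _ _ ↦ rfl
  ext V
  simp only [Set.mem_iUnion, Set.mem_inter_iff, Function.mem_support]
  constructor
  · rintro ⟨p, hp, hV⟩
    have hp' := hcV p V hV.1
    exact ⟨placesOver_le _ hV.1, hp' ▸ hV.2⟩
  · rintro ⟨hV, hne⟩
    have hV' : V ∈ placesOver (A (c V)).toSubring := ⟨hV.1, hc V hV⟩
    refine ⟨c V, ?_, hV', hne⟩
    by_contra hcon
    exact hne (hun _ hcon V hV')

/-- A principal divisor on a complete curve has degree zero. -/
theorem IsCompleteModel.finsum_const [CharZero k] (hK : IsCurveField k K) (hA : IsCompleteModel A)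
    (h : K) (h0 : h ≠ 0) (hfin : (nonUnitLocus A fun _ ↦ h).Finite) :
    ∑ᶠ p, fracOrd (A p).toSubring h = 0 := by
  classical
  by_cases hP : Nonempty P
  · have hex : ∀ V, ∃ p, V ∈ placesOver (algebraMap k K).range →
        (A p).toSubring ≤ V.toSubring := by
      intro V
      by_cases hV : V ∈ placesOver (algebraMap k K).range
      · obtain ⟨p, hp, -⟩ := hA.center V hV
        exact ⟨p, fun _ ↦ hp⟩
      · exact ⟨hP.some, fun h ↦ absurd h hV⟩
    choose c hc using hex
    rw [hA.finsum_eq (fun _ ↦ h) (fun _ ↦ h0) hfin c hc]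
    exact (hK.finsum_places_eq_zero h0).2
  · have := not_nonempty_iff.mp hP
    exact finsum_of_isEmpty _

/-- The projection formula for a birational map of complete curves. -/
theorem IsCompleteModel.finsum_comp {Q : Type*} {B : Q → Subalgebra k K} (hA : IsCompleteModel A)
    (hB : ∀ q, IsCurvePoint (B q))
    (hB' : ∀ V ∈ placesOver (algebraMap k K).range, ∀ q q',
      (B q).toSubring ≤ V.toSubring → (B q').toSubring ≤ V.toSubring → q = q')
    (π : P → Q) (hπ : ∀ p, B (π p) ≤ A p) (hQ : Nonempty P)
    (h : Q → K) (h0 : ∀ q, h q ≠ 0) (hfin : (nonUnitLocus B h).Finite)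
    (hfin' : (nonUnitLocus A fun p ↦ h (π p)).Finite) :
    ∑ᶠ q, fracOrd (B q).toSubring (h q) = ∑ᶠ p, fracOrd (A p).toSubring (h (π p)) := by
  classical
  have hex : ∀ V, ∃ p, V ∈ placesOver (algebraMap k K).range →
      (A p).toSubring ≤ V.toSubring := by
    intro V
    by_cases hV : V ∈ placesOver (algebraMap k K).range
    · obtain ⟨p, hp, -⟩ := hA.center V hV
      exact ⟨p, fun _ ↦ hp⟩
    · exact ⟨hQ.some, fun h ↦ absurd h hV⟩
  choose c hc using hex
  have hc' : ∀ V ∈ placesOver (algebraMap k K).range,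
      (B (π (c V))).toSubring ≤ V.toSubring := fun V hV ↦ le_trans (hπ (c V)) (hc V hV)
  -- Existence of centers in `Q` is inherited from `P` through `π`; only uniqueness had to be
  -- assumed.
  have hBm : IsCompleteModel B :=
    ⟨hB, fun V hV ↦ ⟨π (c V), hc' V hV, fun q hq ↦ hB' V hV _ _ hq (hc' V hV)⟩⟩
  rw [hBm.finsum_eq h h0 hfin (fun V ↦ π (c V)) hc',
    hA.finsum_eq (fun p ↦ h (π p)) (fun p ↦ h0 _) hfin' c hc]

end CurveModel

end KltSurface

namespace KltSurface

/-! ### Intersection multiplicities: additivity and symmetry -/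

section Multiplicity

open scoped TensorProduct

variable {A : Type*} [CommRing A]

theorem length_eq_ker_add_range {M N : Type*} [AddCommGroup M] [Module A M] [AddCommGroup N]
    [Module A N] (φ : M →ₗ[A] N) :
    Module.length A M = Module.length A (LinearMap.ker φ) + Module.length A (LinearMap.range φ) :=
  Module.length_eq_add_of_exact (LinearMap.ker φ).subtype φ.rangeRestrict
    (Submodule.injective_subtype _) φ.surjective_rangeRestrict
    (by rw [LinearMap.exact_iff, LinearMap.ker_rangeRestrict, Submodule.range_subtype])

/-- Multiplication by `f` on `M`. -/
abbrev smulMap (f : A) (M : Type*) [AddCommGroup M] [Module A M] : M →ₗ[A] M :=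
  LinearMap.lsmul A M f

/-- Kernel and cokernel of multiplication by `f` on `M` have finite length. -/
def ChiFinite (f : A) (M : Type*) [AddCommGroup M] [Module A M] : Prop :=
  Module.length A (M ⧸ LinearMap.range (smulMap f M)) ≠ ⊤ ∧
    Module.length A (LinearMap.ker (smulMap f M)) ≠ ⊤

/-- The multiplicity `length (M / f M) - length (M[f])`. -/
noncomputable def chi (f : A) (M : Type*) [AddCommGroup M] [Module A M] : ℤ :=
  ((Module.length A (M ⧸ LinearMap.range (smulMap f M))).toNat : ℤ) -
    ((Module.length A (LinearMap.ker (smulMap f M))).toNat : ℤ)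

section

variable (f : A) {M N P : Type*} [AddCommGroup M] [Module A M] [AddCommGroup N] [Module A N]
  [AddCommGroup P] [Module A P]

/-- `ker + range = M = range + coker` in lengths, so kernel and cokernel have the same length. -/
theorem chi_of_length_ne_top (hM : Module.length A M ≠ ⊤) : ChiFinite f M ∧ chi f M = 0 := by
  have h1 := length_eq_ker_add_range (smulMap f M)
  have h2 : Module.length A M = Module.length A (LinearMap.range (smulMap f M)) +
      Module.length A (M ⧸ LinearMap.range (smulMap f M)) :=
    Module.length_eq_add_of_exact _ _ (Submodule.injective_subtype _)
      (Submodule.mkQ_surjective _) (LinearMap.exact_subtype_mkQ _)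
  unfold ChiFinite chi
  generalize Module.length A (M ⧸ LinearMap.range (smulMap f M)) = c at *
  generalize Module.length A (LinearMap.range (smulMap f M)) = r at *
  generalize Module.length A (LinearMap.ker (smulMap f M)) = l at *
  generalize Module.length A M = m at *
  lift m to ℕ using hM
  have hc : c ≠ ⊤ := by rintro rfl; simp at h2
  have hr : r ≠ ⊤ := by rintro rfl; simp at h2
  have hl : l ≠ ⊤ := by rintro rfl; simp at h1
  lift c to ℕ using hc
  lift r to ℕ using hr
  lift l to ℕ using hl
  have h1' : m = l + r := by exact_mod_cast h1
  have h2' : m = r + c := by exact_mod_cast h2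
  refine ⟨⟨by simp, by simp⟩, ?_⟩
  simp only [ENat.toNat_natCast]
  omega

/-- The snake lemma gives the six-term exact sequence `0 → N[f] → M[f] → P[f] → N/f → M/f → P/f →
0`, whose alternating sum of lengths is zero. -/
theorem chi_add (i : N →ₗ[A] M) (p : M →ₗ[A] P) (hi : Function.Injective i)
    (hp : Function.Surjective p) (hip : Function.Exact i p) (hN : ChiFinite f N)
    (hP : ChiFinite f P) : ChiFinite f M ∧ chi f M = chi f N + chi f P := by
  have c1 : ∀ x, i (f • x) = f • i x := fun x ↦ map_smul _ _ _
  have c2 : ∀ x, p (f • x) = f • p x := fun x ↦ map_smul _ _ _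
  let kN := LinearMap.ker (smulMap f N)
  let kM := LinearMap.ker (smulMap f M)
  let kP := LinearMap.ker (smulMap f P)
  let rN := LinearMap.range (smulMap f N)
  let rM := LinearMap.range (smulMap f M)
  let rP := LinearMap.range (smulMap f P)
  let a1 : kN →ₗ[A] kM := i.restrict (fun x hx ↦ by
    change f • i x = 0
    rw [← c1, show f • x = 0 from hx, map_zero])
  let a2 : kM →ₗ[A] kP := p.restrict (fun x hx ↦ by
    change f • p x = 0
    rw [← c2, show f • x = 0 from hx, map_zero])
  let b1 : (N ⧸ rN) →ₗ[A] (M ⧸ rM) := Submodule.mapQ _ _ i (by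
    rintro _ ⟨x, rfl⟩
    exact ⟨i x, (c1 x).symm⟩)
  let b2 : (M ⧸ rM) →ₗ[A] (P ⧸ rP) := Submodule.mapQ _ _ p (by
    rintro _ ⟨x, rfl⟩
    exact ⟨p x, (c2 x).symm⟩)
  let δ : kP →ₗ[A] (N ⧸ rN) := SnakeLemma.δ' (smulMap f N) (smulMap f M) (smulMap f P)
    i p hip i p hip (by ext x; exact (c1 x)) (by ext x; exact (c2 x))
    kP.subtype (LinearMap.exact_subtype_ker_map _) rN.mkQ (LinearMap.exact_map_mkQ_range _) hp hi
  have e1 : Function.Exact a2 δ := SnakeLemma.exact_δ'_right _ _ _ _ _ _ _ _ _ _ _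
    kM.subtype (LinearMap.exact_subtype_ker_map _) _ _ _ _ hp hi a2 (by ext x; rfl)
    (Submodule.injective_subtype _)
  have e2 : Function.Exact δ b1 := SnakeLemma.exact_δ'_left _ _ _ _ _ _ _ _ _ _ _
    _ _ _ _ rM.mkQ (LinearMap.exact_map_mkQ_range _) hp hi b1 (by ext x; rfl)
    (Submodule.mkQ_surjective _)
  have ha1 : Function.Injective a1 := fun x y h ↦ Subtype.ext (hi (congrArg Subtype.val h))
  have e0 : Function.Exact a1 a2 := by
    intro x
    constructor
    · intro hx
      obtain ⟨y, hy⟩ := (hip x).mp (congrArg Subtype.val hx)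
      refine ⟨⟨y, hi ?_⟩, Subtype.ext hy⟩
      rw [map_zero]
      change i (f • y) = 0
      rw [c1, hy]
      exact x.2
    · rintro ⟨y, rfl⟩
      exact Subtype.ext ((hip _).mpr ⟨y, rfl⟩)
  have hb2 : Function.Surjective b2 := by
    intro x
    obtain ⟨x, rfl⟩ := Submodule.mkQ_surjective _ x
    obtain ⟨y, rfl⟩ := hp x
    exact ⟨Submodule.Quotient.mk y, rfl⟩
  have e3 : Function.Exact b1 b2 := by
    intro x
    obtain ⟨x, rfl⟩ := Submodule.mkQ_surjective _ x
    constructor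
    · intro hx
      obtain ⟨z, hz⟩ : p x ∈ rP := (Submodule.Quotient.mk_eq_zero _).mp hx
      obtain ⟨w, rfl⟩ := hp z
      obtain ⟨y, hy⟩ := (hip (x - f • w)).mp (by rw [map_sub, c2]; exact sub_eq_zero.mpr hz.symm)
      refine ⟨Submodule.Quotient.mk y, ?_⟩
      change Submodule.Quotient.mk (i y) = Submodule.Quotient.mk x
      rw [hy, Submodule.Quotient.eq]
      exact ⟨-w, by simp⟩
    · rintro ⟨y, hy⟩
      obtain ⟨y, rfl⟩ := Submodule.mkQ_surjective _ y
      rw [← hy]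
      refine (Submodule.Quotient.mk_eq_zero _).mpr ?_
      rw [(hip _).mpr ⟨y, rfl⟩]
      exact zero_mem _
  have l1 := length_eq_ker_add_range a1
  have l2 := length_eq_ker_add_range a2
  have l3 := length_eq_ker_add_range δ
  have l4 := length_eq_ker_add_range b1
  have l5 := length_eq_ker_add_range b2
  rw [LinearMap.ker_eq_bot.mpr ha1, Module.length_bot, zero_add] at l1
  rw [LinearMap.exact_iff.mp e0, ← l1] at l2
  rw [LinearMap.exact_iff.mp e1] at l3
  rw [LinearMap.exact_iff.mp e2] at l4
  rw [LinearMap.exact_iff.mp e3, LinearMap.range_eq_top.mpr hb2, Module.length_top] at l5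
  obtain ⟨n1, n2⟩ := hN
  obtain ⟨p1, p2⟩ := hP
  unfold ChiFinite chi
  change Module.length A (N ⧸ rN) ≠ ⊤ at n1
  change Module.length A kN ≠ ⊤ at n2
  change Module.length A (P ⧸ rP) ≠ ⊤ at p1
  change Module.length A kP ≠ ⊤ at p2
  change (Module.length A (M ⧸ rM) ≠ ⊤ ∧ Module.length A kM ≠ ⊤) ∧
    ((Module.length A (M ⧸ rM)).toNat : ℤ) - ((Module.length A kM).toNat : ℤ) =
    ((Module.length A (N ⧸ rN)).toNat : ℤ) - ((Module.length A kN).toNat : ℤ) +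
    (((Module.length A (P ⧸ rP)).toNat : ℤ) - ((Module.length A kP).toNat : ℤ))
  generalize Module.length A (M ⧸ rM) = cM at *
  generalize Module.length A (N ⧸ rN) = cN at *
  generalize Module.length A (P ⧸ rP) = cP at *
  generalize Module.length A kM = xM at *
  generalize Module.length A kN = xN at *
  generalize Module.length A kP = xP at *
  generalize Module.length A (LinearMap.range a2) = r2 at *
  generalize Module.length A (LinearMap.range δ) = r3 at *
  generalize Module.length A (LinearMap.range b1) = r4 at *
  lift cN to ℕ using n1
  lift xN to ℕ using n2
  lift cP to ℕ using p1
  lift xP to ℕ using p2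
  have h2 : r2 ≠ ⊤ := by rintro rfl; simp at l3
  have h3 : r3 ≠ ⊤ := by rintro rfl; simp at l3
  have h4 : r4 ≠ ⊤ := by rintro rfl; simp at l4
  lift r2 to ℕ using h2
  lift r3 to ℕ using h3
  lift r4 to ℕ using h4
  subst l2 l5
  have l3' : xP = r2 + r3 := by exact_mod_cast l3
  have l4' : cN = r3 + r4 := by exact_mod_cast l4
  refine ⟨⟨by exact_mod_cast ENat.natCast_ne_top (r4 + cP),
    by exact_mod_cast ENat.natCast_ne_top (xN + r2)⟩, ?_⟩
  rw [show ((r4 : ℕ∞) + cP).toNat = r4 + cP by exact_mod_cast ENat.toNat_natCast (r4 + cP),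
    show ((xN : ℕ∞) + r2).toNat = xN + r2 by exact_mod_cast ENat.toNat_natCast (xN + r2)]
  simp only [ENat.toNat_natCast]
  omega

theorem chi_congr (e : M ≃ₗ[A] N) (h : ChiFinite f N) : ChiFinite f M ∧ chi f M = chi f N := by
  have h0 : Module.length A PUnit.{1} ≠ ⊤ := by simp
  obtain ⟨h1, h2⟩ := chi_of_length_ne_top f h0
  have := chi_add f e.symm.toLinearMap (0 : M →ₗ[A] PUnit.{1}) e.symm.injective
    (Function.surjective_to_subsingleton _)
    ((LinearMap.exact_zero_iff_surjective _ _).2 e.symm.surjective) h h1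
  rwa [h2, add_zero] at this

end

end Multiplicity

end KltSurface

namespace KltSurface

/-! ### Symmetry of the multiplicity and its expansion along components -/

section Devissage

open scoped TensorProduct

variable {A : Type*} [CommRing A]

/-- Both cokernels have the length of `A / (f, g)`. Both kernels are quotients of `J = {(a, b) | f a
= g b}` by one and the same submodule, since on `J` one has `g ∣ a` if and only if `f ∣ b`. -/
theorem chi_quotient_comm [IsDomain A] (f g : A) (hf : f ≠ 0) (hg : g ≠ 0) :
    chi f (A ⧸ Ideal.span {g}) = chi g (A ⧸ Ideal.span {f}) := by
  have hcoker : ∀ f g : A, Module.length A ((A ⧸ Ideal.span {g}) ⧸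
      LinearMap.range (smulMap f (A ⧸ Ideal.span {g}))) =
      Module.length A (A ⧸ Ideal.span {f, g}) := by
    intro f g
    let φ : A →ₗ[A] ((A ⧸ Ideal.span {g}) ⧸ LinearMap.range (smulMap f (A ⧸ Ideal.span {g}))) :=
      (Submodule.mkQ _).comp (Submodule.mkQ _)
    have hφ : Function.Surjective φ :=
      (Submodule.mkQ_surjective _).comp (Submodule.mkQ_surjective _)
    have hker : LinearMap.ker φ = Ideal.span {f, g} := by
      ext a
      rw [Ideal.mem_span_pair]
      change Submodule.Quotient.mk (Submodule.Quotient.mk a) = 0 ↔ _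
      rw [Submodule.Quotient.mk_eq_zero]
      constructor
      · rintro ⟨b, hb⟩
        obtain ⟨b, rfl⟩ := Submodule.mkQ_surjective _ b
        change Submodule.Quotient.mk (f • b) = Submodule.Quotient.mk a at hb
        rw [Submodule.Quotient.eq, Ideal.mem_span_singleton] at hb
        obtain ⟨c, hc⟩ := hb
        exact ⟨b, -c, by rw [smul_eq_mul] at hc; linear_combination hc⟩
      · rintro ⟨x, y, rfl⟩
        refine ⟨Submodule.Quotient.mk x, ?_⟩
        change Submodule.Quotient.mk (f • x) = _
        rw [Submodule.Quotient.eq, Ideal.mem_span_singleton]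
        exact ⟨-y, by rw [smul_eq_mul]; ring⟩
    rw [← (LinearMap.quotKerEquivOfSurjective φ hφ).length_eq, hker]
  let J : Submodule A (A × A) :=
    LinearMap.ker (f • LinearMap.fst A A A - g • LinearMap.snd A A A)
  have hJ : ∀ x : A × A, x ∈ J ↔ f * x.1 = g * x.2 := fun x ↦ by
    rw [LinearMap.mem_ker]
    simp [sub_eq_zero]
  have hz : ∀ (f a b : A), f • (Submodule.Quotient.mk a : A ⧸ Ideal.span {b}) = 0 ↔ b ∣ f * a := by
    intro f a b
    rw [← Submodule.Quotient.mk_smul, Submodule.Quotient.mk_eq_zero, Ideal.mem_span_singleton,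
      smul_eq_mul]
  let π₁ : J →ₗ[A] LinearMap.ker (smulMap f (A ⧸ Ideal.span {g})) :=
    LinearMap.codRestrict _ ((Submodule.mkQ (Ideal.span {g})).comp
      ((LinearMap.fst A A A).comp J.subtype)) (fun x ↦
        (hz f x.1.1 g).mpr ⟨x.1.2, (hJ x.1).mp x.2⟩)
  let π₂ : J →ₗ[A] LinearMap.ker (smulMap g (A ⧸ Ideal.span {f})) :=
    LinearMap.codRestrict _ ((Submodule.mkQ (Ideal.span {f})).comp
      ((LinearMap.snd A A A).comp J.subtype)) (fun x ↦
        (hz g x.1.2 f).mpr ⟨x.1.1, ((hJ x.1).mp x.2).symm⟩)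
  have s₁ : Function.Surjective π₁ := by
    rintro ⟨x, hx⟩
    obtain ⟨a, rfl⟩ := Submodule.mkQ_surjective _ x
    obtain ⟨b, hb⟩ := (hz f a g).mp hx
    exact ⟨⟨(a, b), (hJ _).mpr hb⟩, rfl⟩
  have s₂ : Function.Surjective π₂ := by
    rintro ⟨x, hx⟩
    obtain ⟨b, rfl⟩ := Submodule.mkQ_surjective _ x
    obtain ⟨a, ha⟩ := (hz g b f).mp hx
    exact ⟨⟨(a, b), (hJ _).mpr ha.symm⟩, rfl⟩
  have hk : LinearMap.ker π₁ = LinearMap.ker π₂ := by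
    ext ⟨⟨a, b⟩, hx⟩
    have hab : f * a = g * b := (hJ _).mp hx
    have e₁ : (⟨⟨a, b⟩, hx⟩ : J) ∈ LinearMap.ker π₁ ↔ g ∣ a := by
      rw [LinearMap.mem_ker, ← Ideal.mem_span_singleton, ← Submodule.Quotient.mk_eq_zero]
      exact Subtype.ext_iff
    have e₂ : (⟨⟨a, b⟩, hx⟩ : J) ∈ LinearMap.ker π₂ ↔ f ∣ b := by
      rw [LinearMap.mem_ker, ← Ideal.mem_span_singleton, ← Submodule.Quotient.mk_eq_zero]
      exact Subtype.ext_iff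
    rw [e₁, e₂]
    constructor
    · rintro ⟨c, rfl⟩
      exact ⟨c, mul_left_cancel₀ hg (by linear_combination -hab)⟩
    · rintro ⟨c, rfl⟩
      exact ⟨c, mul_left_cancel₀ hf (by linear_combination hab)⟩
  unfold chi
  rw [hcoker f g, hcoker g f, Set.pair_comm,
    ← (LinearMap.quotKerEquivOfSurjective π₁ s₁).length_eq,
    ← (LinearMap.quotKerEquivOfSurjective π₂ s₂).length_eq, hk]

theorem support_quotient_ideal (I : Ideal A) :
    Module.support A (A ⧸ I) = PrimeSpectrum.zeroLocus I := by
  rw [Module.support_eq_zeroLocus, Ideal.annihilator_quotient]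

/-- Length of the localization of `M`. -/
noncomputable def locLength (A : Type*) [CommRing A] (B : Type*) [CommRing B] [Algebra A B] (M : Type*) [AddCommGroup M]
    [Module A M] : ℕ∞ :=
  Module.length B (B ⊗[A] M)

section

variable (B : Type*) [CommRing B] [Algebra A B]
  {M N P : Type*} [AddCommGroup M] [Module A M] [AddCommGroup N] [Module A N]
  [AddCommGroup P] [Module A P]

theorem locLength_add [Module.Flat A B] (i : N →ₗ[A] M) (p : M →ₗ[A] P)
    (hi : Function.Injective i) (hp : Function.Surjective p) (hip : Function.Exact i p) :
    locLength A B M = locLength A B N + locLength A B P :=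
  Module.length_eq_add_of_exact (i.baseChange B) (p.baseChange B)
    (Module.Flat.lTensor_preserves_injective_linearMap i hi)
    (LinearMap.lTensor_surjective B hp) (lTensor_exact B hip hp)

theorem locLength_congr (e : M ≃ₗ[A] N) : locLength A B M = locLength A B N :=
  (e.baseChange A B M N).length_eq

theorem locLength_quotient (I : Ideal A) :
    locLength A B (A ⧸ I) = Module.length B (B ⧸ I.map (algebraMap A B)) :=
  (Algebra.TensorProduct.quotIdealMapEquivTensorQuot B I).toLinearEquiv.length_eq.symm

theorem locLength_quotient_span (g : A) :
    locLength A B (A ⧸ Ideal.span {g}) = Ring.ord B (algebraMap A B g) := by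
  rw [locLength_quotient, Ideal.map_span, Set.image_singleton, Ring.ord]

variable (q : Ideal A) [q.IsPrime] [IsLocalization.AtPrime B q]

theorem locLength_quotient_self : locLength A B (A ⧸ q) = 1 := by
  have := IsLocalization.AtPrime.isLocalRing B q
  rw [locLength_quotient, IsLocalization.AtPrime.map_eq_maximalIdeal q B, Module.length_eq_one_iff,
    isSimpleModule_iff_isCoatom]
  exact Ideal.isMaximal_def.mp (IsLocalRing.maximalIdeal.isMaximal B)

theorem locLength_quotient_of_not_le (p : Ideal A) (hp : ¬ p ≤ q) : locLength A B (A ⧸ p) = 0 := by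
  rw [locLength_quotient, Module.length_eq_zero_iff, Ideal.Quotient.subsingleton_iff]
  obtain ⟨x, hx, hxq⟩ := SetLike.not_le_iff_exists.mp hp
  exact Ideal.eq_top_of_isUnit_mem _ (Ideal.mem_map_of_mem _ hx)
    (IsLocalization.map_units B (⟨x, hxq⟩ : q.primeCompl))

end

/-- Dévissage: both sides are additive in `M`, so it suffices to treat `A / p` with `p` in the
support. For `p` maximal both sides vanish; for `p = q i` the localized length is one at `i` and
zero elsewhere. -/
theorem chi_eq_sum [IsNoetherianRing A] (f : A) {ι : Type*} [Fintype ι] (q : ι → Ideal A)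
    [∀ i, (q i).IsPrime] (B : ι → Type*) [∀ i, CommRing (B i)] [∀ i, Algebra A (B i)]
    [∀ i, IsLocalization.AtPrime (B i) (q i)] (hq : ∀ i j, q i ≤ q j → i = j)
    (hqm : ∀ i, ¬ (q i).IsMaximal) (hf : ∀ i, ChiFinite f (A ⧸ q i))
    (M : Type*) [AddCommGroup M] [Module A M] [hM : Module.Finite A M]
    (hs : ∀ p ∈ Module.support A M, p.asIdeal.IsMaximal ∨ ∃ i, p.asIdeal = q i) :
    ChiFinite f M ∧ (∀ i, locLength A (B i) M ≠ ⊤) ∧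
      chi f M = ∑ i, ((locLength A (B i) M).toNat : ℤ) * chi f (A ⧸ q i) := by
  have hflat : ∀ i, Module.Flat A (B i) := fun i ↦ IsLocalization.flat (B i) (q i).primeCompl
  classical
  induction hM using IsNoetherianRing.induction_on_isQuotientEquivQuotientPrime A with
  | subsingleton N =>
    obtain ⟨h1, h2⟩ := chi_of_length_ne_top f (M := N) (by simp)
    have h3 : ∀ i, locLength A (B i) N = 0 := fun i ↦ Module.length_eq_zero
    exact ⟨h1, by simp [h3], by simp [h3, h2]⟩
  | quotient N p e =>
    have hp : p ∈ Module.support A N := by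
      rw [e.support_eq, support_quotient_ideal]
      exact le_refl p.asIdeal
    have hΛ : ∀ i, locLength A (B i) N = locLength A (B i) (A ⧸ p.asIdeal) :=
      fun i ↦ locLength_congr (B i) e
    rcases hs p hp with hmax | ⟨i, hi⟩
    · have hl : Module.length A (A ⧸ p.asIdeal) = 1 := by
        rw [Module.length_eq_one_iff, isSimpleModule_iff_isCoatom]
        exact Ideal.isMaximal_def.mp hmax
      obtain ⟨h1, h2⟩ := chi_of_length_ne_top f (M := N) (by rw [e.length_eq, hl]; simp)
      have h3 : ∀ i, locLength A (B i) N = 0 := fun i ↦ by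
        rw [hΛ]
        refine locLength_quotient_of_not_le (B i) (q i) _ fun hle ↦ hqm i ?_
        rwa [← hmax.eq_of_le (Ideal.IsPrime.ne_top inferInstance) hle]
      exact ⟨h1, by simp [h3], by simp [h3, h2]⟩
    · rw [hi] at e
      obtain ⟨h1, h2⟩ := chi_congr f e (hf i)
      have h3 : ∀ j, locLength A (B j) N = if j = i then 1 else 0 := fun j ↦ by
        rw [hΛ, hi]
        split_ifs with hij
        · subst hij
          exact locLength_quotient_self (B j) (q j)
        · exact locLength_quotient_of_not_le (B j) (q j) _ fun hle ↦ hij (hq _ _ hle).symm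
      refine ⟨h1, fun j ↦ ?_, ?_⟩
      · rw [h3]
        split_ifs <;> simp
      · rw [h2, Finset.sum_eq_single i]
        · simp [h3]
        · intro j _ hj
          simp [h3, hj]
        · simp
  | exact N M P i p hi hp hip hN hP =>
    have hs1 : ∀ x ∈ Module.support A N, x ∈ Module.support A M := fun x hx ↦
      Module.support_subset_of_injective i hi hx
    have hs2 : ∀ x ∈ Module.support A P, x ∈ Module.support A M := fun x hx ↦
      Module.support_subset_of_surjective p hp hx
    obtain ⟨n1, n2, n3⟩ := hN fun x hx ↦ hs x (hs1 x hx)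
    obtain ⟨p1, p2, p3⟩ := hP fun x hx ↦ hs x (hs2 x hx)
    obtain ⟨m1, m2⟩ := chi_add f i p hi hp hip n1 p1
    have hl := fun j ↦ locLength_add (B j) i p hi hp hip
    refine ⟨m1, fun j ↦ ?_, ?_⟩
    · rw [hl]
      exact WithTop.add_ne_top.mpr ⟨n2 j, p2 j⟩
    · rw [m2, n3, p3, ← Finset.sum_add_distrib]
      refine Finset.sum_congr rfl fun j _ ↦ ?_
      rw [hl, ENat.toNat_add (n2 j) (p2 j)]
      push_cast
      ring

/-- Multiplication by `f` is injective on the domain `A / q`, so only the cokernel contributes. -/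
theorem chi_quotient_prime (f : A) (q : Ideal A) [q.IsPrime] (hfq : f ∉ q)
    (hf : Ring.ord (A ⧸ q) (Ideal.Quotient.mk q f) ≠ ⊤) :
    ChiFinite f (A ⧸ q) ∧
      chi f (A ⧸ q) = (Ring.ord (A ⧸ q) (Ideal.Quotient.mk q f)).toNat := by
  have hk : LinearMap.ker (smulMap f (A ⧸ q)) = ⊥ := by
    rw [LinearMap.ker_eq_bot']
    intro x hx
    obtain ⟨x, rfl⟩ := Ideal.Quotient.mk_surjective x
    have : Ideal.Quotient.mk q (f * x) = 0 := hx
    rw [Ideal.Quotient.eq_zero_iff_mem] at this ⊢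
    exact (Ideal.IsPrime.mem_or_mem inferInstance this).resolve_left hfq
  have hr : LinearMap.range (smulMap f (A ⧸ q)) =
      (Ideal.span {Ideal.Quotient.mk q f}).restrictScalars A := by
    ext x
    rw [Submodule.restrictScalars_mem, Ideal.mem_span_singleton]
    constructor
    · rintro ⟨y, rfl⟩
      exact ⟨y, Algebra.smul_def f y⟩
    · rintro ⟨y, rfl⟩
      exact ⟨y, Algebra.smul_def f y⟩
  have hl : Module.length A ((A ⧸ q) ⧸ LinearMap.range (smulMap f (A ⧸ q))) =
      Ring.ord (A ⧸ q) (Ideal.Quotient.mk q f) := by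
    rw [hr, (Submodule.Quotient.restrictScalarsEquiv A _).length_eq]
    exact Module.length_eq_of_surjective (R := A ⧸ q) (S := A) Ideal.Quotient.mk_surjective
  unfold ChiFinite chi
  rw [hl, hk, Module.length_bot]
  exact ⟨⟨hf, by simp⟩, by simp⟩

/-- Symmetry of the intersection multiplicity of two divisors at a point of a surface. -/
theorem sum_ord_mul_ord_comm [IsNoetherianRing A] [IsDomain A] (f g : A) (hf0 : f ≠ 0)
    (hg0 : g ≠ 0) {ι κ : Type*} [Fintype ι] [Fintype κ] (q : ι → Ideal A) (r : κ → Ideal A)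
    [∀ i, (q i).IsPrime] [∀ i, (r i).IsPrime] (B : ι → Type*) [∀ i, CommRing (B i)]
    [∀ i, Algebra A (B i)] [∀ i, IsLocalization.AtPrime (B i) (q i)]
    (B' : κ → Type*) [∀ i, CommRing (B' i)]
    [∀ i, Algebra A (B' i)] [∀ i, IsLocalization.AtPrime (B' i) (r i)]
    (hq : ∀ i j, q i ≤ q j → i = j) (hqm : ∀ i, ¬ (q i).IsMaximal)
    (hr : ∀ i j, r i ≤ r j → i = j) (hrm : ∀ i, ¬ (r i).IsMaximal)
    (hfq : ∀ i, f ∉ q i) (hf : ∀ i, Ring.ord (A ⧸ q i) (Ideal.Quotient.mk (q i) f) ≠ ⊤)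
    (hgr : ∀ i, g ∉ r i) (hg : ∀ i, Ring.ord (A ⧸ r i) (Ideal.Quotient.mk (r i) g) ≠ ⊤)
    (hsf : ∀ p : Ideal A, p.IsPrime → f ∈ p → p.IsMaximal ∨ ∃ i, p = r i)
    (hsg : ∀ p : Ideal A, p.IsPrime → g ∈ p → p.IsMaximal ∨ ∃ i, p = q i) :
    ∑ i, (Ring.ord (B i) (algebraMap A (B i) g)).toNat *
        (Ring.ord (A ⧸ q i) (Ideal.Quotient.mk (q i) f)).toNat =
      ∑ i, (Ring.ord (B' i) (algebraMap A (B' i) f)).toNat *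
        (Ring.ord (A ⧸ r i) (Ideal.Quotient.mk (r i) g)).toNat := by
  -- `χ(f, A/g)` expands along the components of `g`, and `χ(g, A/f)` along those of `f`; the two
  -- numbers agree by `chi_quotient_comm`.
  have h1 := (chi_eq_sum f q B hq hqm (fun i ↦ (chi_quotient_prime f (q i) (hfq i) (hf i)).1)
    (A ⧸ Ideal.span {g}) (fun p hp ↦ hsg p.asIdeal p.2 (by
      rw [support_quotient_ideal] at hp
      exact hp (Ideal.mem_span_singleton_self g)))).2.2
  have h2 := (chi_eq_sum g r B' hr hrm (fun i ↦ (chi_quotient_prime g (r i) (hgr i) (hg i)).1)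
    (A ⧸ Ideal.span {f}) (fun p hp ↦ hsf p.asIdeal p.2 (by
      rw [support_quotient_ideal] at hp
      exact hp (Ideal.mem_span_singleton_self f)))).2.2
  rw [chi_quotient_comm f g hf0 hg0, h2] at h1
  simp only [locLength_quotient_span, (chi_quotient_prime f _ (hfq _) (hf _)).2,
    (chi_quotient_prime g _ (hgr _) (hg _)).2] at h1
  exact_mod_cast h1.symm

end Devissage

end KltSurface

/-! ### Algebraic Hartogs -/

namespace KltSurface

/-- Algebraic Hartogs: a fraction which is integral at all height one primes is integral. -/
theorem mem_range_of_forall_dvr {A K : Type*} [CommRing A] [IsDomain A] [IsNoetherianRing A]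
    [IsIntegrallyClosed A] [Field K] [Algebra A K] [IsFractionRing A K] (x : K)
    (h : ∀ (q : Ideal A) (_ : q.IsPrime), IsDiscreteValuationRing (Localization.AtPrime q) →
      ∃ a s : A, s ∉ q ∧ x * algebraMap A K s = algebraMap A K a) :
    x ∈ (algebraMap A K).range := by
  by_contra hx
  have inj := IsFractionRing.injective A K
  obtain ⟨a, b, hb, rfl⟩ := IsFractionRing.div_surjective (A := A) x
  have hb0 : b ≠ 0 := nonZeroDivisors.ne_zero hb
  have hbK : algebraMap A K b ≠ 0 := fun h0 ↦ hb0 (inj (by rw [h0, map_zero]))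
  have key : ∀ r c : A, r • (Ideal.Quotient.mk (Ideal.span {b}) c) = 0 ↔
      ∃ d, algebraMap A K r * (algebraMap A K c / algebraMap A K b) = algebraMap A K d := by
    intro r c
    rw [Algebra.smul_def, Ideal.Quotient.algebraMap_eq, ← map_mul, Ideal.Quotient.eq_zero_iff_mem,
      Ideal.mem_span_singleton]
    refine exists_congr fun d ↦ ?_
    rw [← mul_div_assoc, div_eq_iff hbK, ← map_mul, ← map_mul, inj.eq_iff, mul_comm b]
  have ha0 : Ideal.Quotient.mk (Ideal.span {b}) a ≠ 0 := by
    intro h0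
    obtain ⟨d, hd⟩ := (key 1 a).mp (by rw [h0, smul_zero])
    exact hx ⟨d, by rw [← hd, map_one, one_mul]⟩
  -- An associated prime `P` of `A / (b)` containing the annihilator of the class of `a`. In terms
  -- of `y = c / b` it is `{r | r y ∈ A}`.
  obtain ⟨P, hP, hPa⟩ := exists_le_isAssociatedPrime_of_isNoetherianRing A
    (M := A ⧸ Ideal.span {b}) _ ha0
  obtain ⟨hPp, c, hPc⟩ := isAssociatedPrime_iff.mp hP
  obtain ⟨c, rfl⟩ := Ideal.Quotient.mk_surjective c
  set y : K := algebraMap A K c / algebraMap A K b with hy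
  have hPy : ∀ r, r ∈ P ↔ ∃ d, algebraMap A K r * y = algebraMap A K d := by
    intro r
    rw [← key, hPc, Submodule.mem_colon_singleton, Submodule.mem_bot]
  have hbP : b ∈ P := (hPy b).mpr ⟨c, by rw [hy, mul_div_cancel₀ _ hbK]⟩
  -- Otherwise `y P ≤ P`, so `y` is integral by the determinant trick and lies in `A`; then `1 ∈ P`.
  have hex : ∃ t ∈ P, ∃ u ∉ P, algebraMap A K t * y = algebraMap A K u := by
    by_contra hcon
    push Not at hcon
    have hint : IsIntegral A y := by
      refine isIntegral_of_smul_mem_submodule (M := K)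
        (Submodule.map (Algebra.linearMap A K) P) ?_ ?_ y ?_
      · intro h0
        have : algebraMap A K b ∈ Submodule.map (Algebra.linearMap A K) P := ⟨b, hbP, rfl⟩
        rw [h0, Submodule.mem_bot] at this
        exact hbK this
      · exact Submodule.FG.map _ ((isNoetherianRing_iff_ideal_fg A).mp inferInstance P)
      · rintro _ ⟨r, hr, rfl⟩
        obtain ⟨d, hd⟩ := (hPy r).mp hr
        refine ⟨d, ?_, ?_⟩
        · by_contra hdP
          exact hcon r hr d hdP hd
        · rw [Algebra.linearMap_apply, Algebra.linearMap_apply, ← hd, smul_eq_mul, mul_comm]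
    obtain ⟨d, hd⟩ := IsIntegrallyClosed.isIntegral_iff.mp hint
    exact hPp.ne_top ((Ideal.eq_top_iff_one P).mpr ((hPy 1).mpr ⟨d, by rw [hd, map_one, one_mul]⟩))
  obtain ⟨t, ht, u, hu, htu⟩ := hex
  let L := Localization.AtPrime P
  -- For `r ∈ P` with `r y = d` one gets `r u = d t`; as `u` is a unit in `L`, the element `t`
  -- generates the maximal ideal.
  have hprin : (IsLocalRing.maximalIdeal L).IsPrincipal := by
    refine ⟨algebraMap A L t, le_antisymm ?_ ?_⟩
    · rw [← Localization.AtPrime.map_eq_maximalIdeal, Ideal.map_le_iff_le_comap]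
      intro r hr
      obtain ⟨d, hd⟩ := (hPy r).mp hr
      have e : r * u = d * t := inj (by rw [map_mul, map_mul, ← htu, ← hd]; ring)
      rw [Ideal.mem_comap, Ideal.submodule_span_eq, Ideal.mem_span_singleton]
      have hunit : IsUnit (algebraMap A L u) :=
        IsLocalization.map_units L (⟨u, hu⟩ : P.primeCompl)
      rw [← hunit.dvd_mul_right, ← map_mul, e, map_mul]
      exact dvd_mul_left _ _
    · rw [Ideal.submodule_span_eq, Ideal.span_le, Set.singleton_subset_iff, SetLike.mem_coe,
        ← Localization.AtPrime.map_eq_maximalIdeal]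
      exact Ideal.mem_map_of_mem _ ht
  have hnf : ¬ IsField L := by
    intro hf
    have := (IsLocalRing.isField_iff_maximalIdeal_eq.mp hf)
    have h1 : algebraMap A L b ∈ IsLocalRing.maximalIdeal L := by
      rw [← Localization.AtPrime.map_eq_maximalIdeal]
      exact Ideal.mem_map_of_mem _ hbP
    rw [this, Ideal.mem_bot] at h1
    exact hb0 (IsLocalization.injective L P.primeCompl_le_nonZeroDivisors (by rw [h1, map_zero]))
  have hdvr : IsDiscreteValuationRing L :=
    ((IsDiscreteValuationRing.TFAE L hnf).out 0 4).mpr hprin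
  -- Now the hypothesis applies at `P`: it gives `s ∉ P` that kills the class of `a`, although this
  -- annihilator is contained in `P`.
  obtain ⟨a', s, hs, hxs⟩ := h P hPp hdvr
  refine hs (hPa ?_)
  rw [Submodule.mem_colon_singleton, Submodule.mem_bot, key]
  exact ⟨a', by rw [mul_comm, hxs]⟩

/-! ### Primes of a local ring and generizations of the point -/

section Stalks

variable {X : Scheme.{0}}

/-- The prime ideal of `𝒪_{X,x}` corresponding to a generalization `z` of `x`. -/
noncomputable def primeAt {z x : X} (h : z ⤳ x) : Ideal (X.presheaf.stalk x) :=
  (IsLocalRing.maximalIdeal (X.presheaf.stalk z)).comap (X.presheaf.stalkSpecializes h).hom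

instance {z x : X} (h : z ⤳ x) : (primeAt h).IsPrime := Ideal.comap_isPrime _ _

theorem fromSpecStalk_primeAt {z x : X} (h : z ⤳ x) :
    X.fromSpecStalk x ⟨primeAt h, inferInstance⟩ = z := by
  have h1 := Scheme.SpecMap_stalkSpecializes_fromSpecStalk h
  have h2 : X.fromSpecStalk z (IsLocalRing.closedPoint (X.presheaf.stalk z)) = z :=
    Scheme.fromSpecStalk_closedPoint
  rw [← h1] at h2
  exact h2

theorem exists_eq_primeAt {x : X} (q : Ideal (X.presheaf.stalk x)) (hq : q.IsPrime) :
    ∃ (z : X) (h : z ⤳ x), q = primeAt h := by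
  let z := X.fromSpecStalk x ⟨q, hq⟩
  have hz : z ⤳ x := by
    have : z ∈ Set.range (X.fromSpecStalk x) := ⟨_, rfl⟩
    rwa [Scheme.range_fromSpecStalk] at this
  refine ⟨z, hz, ?_⟩
  have := (X.fromSpecStalk x).isEmbedding.injective
    (show X.fromSpecStalk x ⟨q, hq⟩ = X.fromSpecStalk x ⟨primeAt hz, inferInstance⟩ by
      rw [fromSpecStalk_primeAt])
  exact congrArg PrimeSpectrum.asIdeal this

theorem primeAt_le_iff {z w x : X} (hz : z ⤳ x) (hw : w ⤳ x) :
    primeAt hz ≤ primeAt hw ↔ z ⤳ w := by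
  have h1 := (X.fromSpecStalk x).isEmbedding.isInducing.specializes_iff
    (x := (⟨primeAt hz, inferInstance⟩ : PrimeSpectrum (X.presheaf.stalk x)))
    (y := (⟨primeAt hw, inferInstance⟩ : PrimeSpectrum (X.presheaf.stalk x)))
  rw [fromSpecStalk_primeAt, fromSpecStalk_primeAt] at h1
  rw [h1]
  exact PrimeSpectrum.le_iff_specializes (⟨primeAt hz, inferInstance⟩ : PrimeSpectrum _)
    ⟨primeAt hw, inferInstance⟩

theorem primeAt_self (x : X) : primeAt (specializes_refl x) =
    IsLocalRing.maximalIdeal (X.presheaf.stalk x) := by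
  rw [primeAt, TopCat.Presheaf.stalkSpecializes_refl]
  exact Ideal.comap_id _

theorem isMaximal_primeAt_iff {z x : X} (h : z ⤳ x) : (primeAt h).IsMaximal ↔ z = x := by
  constructor
  · intro hm
    have h1 := IsLocalRing.eq_maximalIdeal hm
    rw [← primeAt_self] at h1
    have h2 := (primeAt_le_iff (specializes_refl x) h).mp h1.ge
    exact (h.antisymm h2).eq
  · rintro rfl
    rw [primeAt_self]
    infer_instance

variable [IsIntegral X]

theorem algebraMap_stalkSpecializes {z x : X} (h : z ⤳ x) (a : X.presheaf.stalk x) :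
    algebraMap (X.presheaf.stalk z) X.functionField ((X.presheaf.stalkSpecializes h).hom a) =
      algebraMap (X.presheaf.stalk x) X.functionField a := by
  have := X.presheaf.stalkSpecializes_comp ((genericPoint_spec X).specializes (Set.mem_univ z)) h
  exact congrArg (fun φ ↦ φ.hom a) this

theorem stalkSpecializes_injective {z x : X} (h : z ⤳ x) :
    Function.Injective (X.presheaf.stalkSpecializes h).hom := by
  intro a b hab
  apply IsFractionRing.injective (X.presheaf.stalk x) X.functionField
  rw [← algebraMap_stalkSpecializes h, hab, algebraMap_stalkSpecializes]

-- An affine open set around `x` also contains `z`, and the stalk at `z` is a localization of its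
-- ring of sections.
omit [IsIntegral X] in
theorem exists_eq_div_stalkSpecializes {z x : X} (h : z ⤳ x) (y : X.presheaf.stalk z) :
    ∃ a s : X.presheaf.stalk x, s ∉ primeAt h ∧
      y * (X.presheaf.stalkSpecializes h).hom s = (X.presheaf.stalkSpecializes h).hom a := by
  obtain ⟨_, ⟨U, hU, rfl⟩, hxU, -⟩ :=
    X.isBasis_affineOpens.exists_subset_of_mem_open (Set.mem_univ x) isOpen_univ
  have hzU : z ∈ U := h.mem_open U.2 hxU
  let _ := TopCat.Presheaf.algebra_section_stalk X.presheaf (⟨z, hzU⟩ : U)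
  have := hU.isLocalization_stalk ⟨z, hzU⟩
  obtain ⟨⟨a, s⟩, has⟩ := IsLocalization.surj (hU.primeIdealOf ⟨z, hzU⟩).asIdeal.primeCompl y
  have hs := IsLocalization.map_units (X.presheaf.stalk z) s
  have e : ∀ b, (X.presheaf.stalkSpecializes h).hom ((X.presheaf.germ U x hxU).hom b) =
      algebraMap Γ(X, U) (X.presheaf.stalk z) b := by
    intro b
    have := X.presheaf.germ_stalkSpecializes (U := U) hxU h
    exact congrArg (fun φ ↦ φ.hom b) this
  refine ⟨(X.presheaf.germ U x hxU).hom a, (X.presheaf.germ U x hxU).hom s, ?_, ?_⟩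
  · intro hmem
    rw [primeAt, Ideal.mem_comap, e] at hmem
    exact (IsLocalRing.mem_maximalIdeal _).mp hmem hs
  · rw [e, e]
    exact has

theorem isLocalization_stalkSpecializes {z x : X} (h : z ⤳ x) :
    letI := (X.presheaf.stalkSpecializes h).hom.toAlgebra
    IsLocalization.AtPrime (X.presheaf.stalk z) (primeAt h) := by
  let := (X.presheaf.stalkSpecializes h).hom.toAlgebra
  refine (isLocalization_iff _ _).mpr ⟨?_, ?_, ?_⟩
  · rintro ⟨s, hs⟩
    by_contra hcon
    exact hs ((IsLocalRing.mem_maximalIdeal _).mpr hcon)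
  · intro y
    obtain ⟨a, s, hs, h⟩ := exists_eq_div_stalkSpecializes h y
    exact ⟨⟨a, ⟨s, hs⟩⟩, h⟩
  · intro a b hab
    exact ⟨1, by rw [stalkSpecializes_injective h hab]⟩

end Stalks

end KltSurface

namespace KltSurface

/-! ### Codimension, orders of vanishing, and regularity -/

section Orders

variable {X : Scheme.{0}}

/-- Generizations are the larger points in this order, so `coheight` is the codimension of the
closure. -/
theorem lt_of_specializes {x y : X} (h : x ⤳ y) (hne : x ≠ y) : y < x :=
  lt_of_le_not_ge h fun h' ↦ hne (Specializes.antisymm h h').eq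

theorem coheight_le_of_topologicalKrullDim {n : ℕ} (hd : topologicalKrullDim X = n) (x : X) :
    coheight x ≤ n := by
  have h1 : topologicalKrullDim X = krullDim X := by
    let : PartialOrder X := specializationOrder X
    exact krullDim_eq_of_orderIso irreducibleSetEquivPoints
  have h2 := coheight_le_krullDim x
  rw [← h1, hd] at h2
  exact_mod_cast h2

/-- `p` has codimension at least two, and a further proper specialization would have codimension
three. -/
theorem isClosed_of_specializes (hd : ∀ x : X, coheight x ≤ 2) {c p : X} (hc : coheight c = 1)
    (h : c ⤳ p) (hne : c ≠ p) : IsClosed ({p} : Set X) := by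
  rw [← closure_eq_iff_isClosed]
  refine le_antisymm (fun x hx ↦ ?_) subset_closure
  have hx' : p ⤳ x := specializes_iff_mem_closure.mpr hx
  by_contra hne'
  have h1 := coheight_add_one_le (lt_of_specializes h hne)
  have h2 := coheight_add_one_le (lt_of_specializes hx' (Ne.symm hne'))
  have h3 := (h2.trans (hd x))
  rw [hc] at h1
  have h4 : (1 : ℕ∞) + 1 + 1 ≤ 2 := (add_le_add_left h1 1).trans h3
  exact absurd h4 (by decide)

theorem eq_of_specializes_of_coheight_eq_one {z c : X} (hz : coheight z = 1) (hc : coheight c = 1)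
    (h : z ⤳ c) : z = c := by
  by_contra hne
  have h1 := coheight_add_one_le (lt_of_specializes h hne)
  rw [hz, hc] at h1
  exact absurd h1 (by decide)

variable [IsIntegral X]

theorem coheight_genericPoint : coheight (genericPoint X) = 0 := by
  rw [coheight_eq_zero]
  exact fun y _ ↦ genericPoint_specializes y

theorem eq_genericPoint_of_coheight_eq_zero {z : X} (hz : coheight z = 0) : z = genericPoint X :=
  (Specializes.antisymm (coheight_eq_zero.mp hz (genericPoint_specializes z))
    (genericPoint_specializes z)).eq

variable [IsLocallyNoetherian X]

theorem isDiscreteValuationRing_stalk (z : X) (hn : IsIntegrallyClosed (X.presheaf.stalk z))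
    (hz : coheight z = 1) : IsDiscreteValuationRing (X.presheaf.stalk z) := by
  have h1 : Ring.KrullDimLE 1 (X.presheaf.stalk z) := krullDimLE_of_coheight_le hz.le
  have hdim := ringKrullDim_stalk_eq_coheight z
  have hnf : ¬ IsField (X.presheaf.stalk z) := by
    intro hf
    rw [hz, ringKrullDim_eq_zero_of_isField hf] at hdim
    exact absurd hdim (by decide)
  refine ((IsDiscreteValuationRing.TFAE _ hnf).out 0 2).mpr ?_
  have : Ring.DimensionLEOne (X.presheaf.stalk z) :=
    ⟨fun {p} ↦ Ring.krullDimLE_one_iff_of_noZeroDivisors.mp h1 p⟩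
  exact { }

theorem ord_nonneg_iff (z : X) (hn : IsIntegrallyClosed (X.presheaf.stalk z))
    (hz : coheight z = 1) {f : X.functionField} (hf : f ≠ 0) :
    0 ≤ X.ord f z ↔ ∃ a, algebraMap (X.presheaf.stalk z) X.functionField a = f := by
  have hdvr := isDiscreteValuationRing_stalk z hn hz
  rw [Scheme.le_ord_iff hz hf, Scheme.ordHom, Ring.ordFrac_eq_valuation_inv]
  rw [show Multiplicative.ofAdd (0 : ℤ) = 1 from rfl, WithZero.coe_one]
  constructor
  · intro h
    refine IsDiscreteValuationRing.exists_lift_of_le_one (inv_le_one_of_one_le₀ h |>.trans_eq' ?_)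
    rw [inv_inv]
  · rintro ⟨a, rfl⟩
    refine (one_le_inv₀ ?_).mpr (IsDedekindDomain.HeightOneSpectrum.valuation_le_one _ _)
    exact zero_lt_iff.mpr ((map_ne_zero _).mpr hf)

theorem ord_inv (z : X) {f : X.functionField} (hf : f ≠ 0) : X.ord f⁻¹ z = - X.ord f z := by
  have h1 := Scheme.ord_mul (x := z) hf (inv_ne_zero hf)
  have h2 := Scheme.ord_mul (x := z) (one_ne_zero (α := X.functionField)) one_ne_zero
  rw [mul_one] at h2
  rw [mul_inv_cancel₀ hf] at h1
  omega

theorem ord_one (z : X) : X.ord 1 z = 0 := by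
  have h2 := Scheme.ord_mul (x := z) (one_ne_zero (α := X.functionField)) one_ne_zero
  rw [mul_one] at h2
  omega

theorem ord_zpow (z : X) {f : X.functionField} (hf : f ≠ 0) (n : ℤ) :
    X.ord (f ^ n) z = n * X.ord f z := by
  induction n using Int.induction_on with
  | zero => simp [ord_one]
  | succ n ih =>
    rw [zpow_add_one₀ hf, Scheme.ord_mul (zpow_ne_zero _ hf) hf, ih]
    ring
  | pred n ih =>
    rw [zpow_sub_one₀ hf, Scheme.ord_mul (zpow_ne_zero _ hf) (inv_ne_zero hf), ih, ord_inv z hf]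
    ring

/-- A rational function without poles along prime divisors through `p` is regular at `p`. -/
theorem exists_eq_of_ord_nonneg (p : X) (hn : ∀ x : X, IsIntegrallyClosed (X.presheaf.stalk x))
    {f : X.functionField} (hf : f ≠ 0) (h : ∀ z : X, coheight z = 1 → z ⤳ p → 0 ≤ X.ord f z) :
    ∃ a, algebraMap (X.presheaf.stalk p) X.functionField a = f := by
  have := hn p
  refine mem_range_of_forall_dvr f fun q hq hdvr ↦ ?_
  obtain ⟨z, hz, rfl⟩ := exists_eq_primeAt q hq
  let := (X.presheaf.stalkSpecializes hz).hom.toAlgebra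
  have := isLocalization_stalkSpecializes hz
  let e : Localization.AtPrime (primeAt hz) ≃+* X.presheaf.stalk z :=
    (IsLocalization.algEquiv (primeAt hz).primeCompl _ _).toRingEquiv
  have hz1 : coheight z = 1 := by
    have h1 := ringKrullDim_stalk_eq_coheight z
    rw [← ringKrullDim_eq_of_ringEquiv e, IsDiscreteValuationRing.ringKrullDim_eq_one] at h1
    exact_mod_cast h1.symm
  obtain ⟨b, hb⟩ := (ord_nonneg_iff z (hn z) hz1 hf).mp (h z hz1 hz)
  obtain ⟨a, s, hs, has⟩ := exists_eq_div_stalkSpecializes hz b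
  refine ⟨a, s, hs, ?_⟩
  rw [← hb, ← algebraMap_stalkSpecializes hz, ← algebraMap_stalkSpecializes hz, ← has, map_mul]

/-- Rational functions with the same divisor near `p` differ by a unit at `p`. -/
theorem exists_unit_of_ord_eq (p : X) (hn : ∀ x : X, IsIntegrallyClosed (X.presheaf.stalk x))
    {f g : X.functionField} (hf : f ≠ 0) (hg : g ≠ 0)
    (h : ∀ z : X, coheight z = 1 → z ⤳ p → X.ord f z = X.ord g z) :
    ∃ u : (X.presheaf.stalk p)ˣ, algebraMap (X.presheaf.stalk p) X.functionField u * g = f := by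
  have h1 : ∀ z : X, coheight z = 1 → z ⤳ p → X.ord (f / g) z = 0 := by
    intro z hz hzp
    rw [div_eq_mul_inv, Scheme.ord_mul hf (inv_ne_zero hg), ord_inv z hg, h z hz hzp, add_neg_cancel]
  have h2 : ∀ z : X, coheight z = 1 → z ⤳ p → X.ord (f / g)⁻¹ z = 0 := by
    intro z hz hzp
    rw [ord_inv z (div_ne_zero hf hg), h1 z hz hzp, neg_zero]
  obtain ⟨a, ha⟩ := exists_eq_of_ord_nonneg p hn (div_ne_zero hf hg) fun z hz hzp ↦ (h1 z hz hzp).ge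
  obtain ⟨b, hb⟩ := exists_eq_of_ord_nonneg p hn (inv_ne_zero (div_ne_zero hf hg))
    fun z hz hzp ↦ (h2 z hz hzp).ge
  have hab : a * b = 1 := by
    apply IsFractionRing.injective (X.presheaf.stalk p) X.functionField
    rw [map_mul, ha, hb, mul_inv_cancel₀ (div_ne_zero hf hg), map_one]
  refine ⟨⟨a, b, hab, by rw [mul_comm, hab]⟩, ?_⟩
  rw [ha, div_mul_cancel₀ _ hg]

end Orders

end KltSurface

namespace KltSurface

/-! ### Affine curves over a field -/

section AffineModel

open scoped TensorProduct

variable {k : Type*} [Field k] {K : Type*} [Field K] [Algebra k K]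

/-- `R` is the coordinate ring of an affine curve over `k` with function field `K`. -/
structure IsAffineCurve (R : Subalgebra k K) : Prop where
  finiteType : Algebra.FiniteType k R
  frac : IsFractionRing R K
  maximal : ∀ q : Ideal R, q ≠ ⊥ → q.IsPrime → q.IsMaximal

/-- By Noether normalization `R` is finite over a polynomial ring `P`, so the closure in question is
that of `P` in `K`. It is finite because `P` is integrally closed and `K` is finite over `Frac P`,
and separable in characteristic zero. -/
theorem finite_integralClosure_of_finiteType [CharZero k] (R : Subalgebra k K)
    (hR : Algebra.FiniteType k R) (hf : IsFractionRing R K) :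
    Module.Finite R (integralClosure R K) := by
  obtain ⟨s, g, hg, hfin⟩ := exists_finite_inj_algHom_of_fg k R
  let P := MvPolynomial (Fin s) k
  let F := FractionRing P
  let := g.toRingHom.toAlgebra
  let := ((algebraMap R K).comp g.toRingHom).toAlgebra
  have : IsScalarTower P R K := IsScalarTower.of_algebraMap_eq' rfl
  have hinj : Function.Injective (algebraMap P K) :=
    (IsFractionRing.injective R K).comp hg
  have : Module.Finite P R := hfin
  have : FaithfulSMul P K := (faithfulSMul_iff_algebraMap_injective P K).mpr hinj
  have : FaithfulSMul P R := (faithfulSMul_iff_algebraMap_injective P R).mpr hg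
  let := FractionRing.liftAlgebra P K
  have : IsScalarTower P F K := FractionRing.isScalarTower_liftAlgebra P K
  -- A denominator `b ∈ R` divides a non-zero `d ∈ P`, so every fraction of `R` already has a
  -- denominator in `P`.
  have : Module.Finite F K := by
    let φ : F ⊗[P] R →ₐ[F] K := Algebra.TensorProduct.lift (Algebra.ofId F K)
      (IsScalarTower.toAlgHom P R K) (fun _ _ ↦ Commute.all _ _)
    refine Module.Finite.of_surjective φ.toLinearMap fun x ↦ ?_
    obtain ⟨a, b, hb, rfl⟩ := IsFractionRing.div_surjective (A := R) x
    obtain ⟨d, hd, c, hc⟩ := (Algebra.IsAlgebraic.isAlgebraic (R := P) b).exists_nonzero_dvd hb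
    have hdK : algebraMap P K d ≠ 0 := fun h0 ↦ hd (hinj (by rw [h0, map_zero]))
    have hbK : algebraMap R K b ≠ 0 :=
      IsFractionRing.to_map_ne_zero_of_mem_nonZeroDivisors hb
    refine ⟨(algebraMap P F d)⁻¹ ⊗ₜ (a * c), ?_⟩
    have h1 : algebraMap F K (algebraMap P F d) = algebraMap P K d :=
      (IsScalarTower.algebraMap_apply P F K d).symm
    have h2 : algebraMap P K d = algebraMap R K b * algebraMap R K c := by
      rw [IsScalarTower.algebraMap_apply P R K, hc, map_mul]
    change algebraMap F K (algebraMap P F d)⁻¹ * algebraMap R K (a * c) = _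
    rw [map_inv₀, h1, inv_mul_eq_div, div_eq_div_iff hdK hbK, h2, map_mul]
    ring
  have : CharZero F := charZero_of_injective_algebraMap (FaithfulSMul.algebraMap_injective k F)
  have : IsIntegralClosure (integralClosure R K) P K := by
    refine ⟨FaithfulSMul.algebraMap_injective _ _, fun {x} ↦ ⟨fun hx ↦ ?_, ?_⟩⟩
    · exact ⟨⟨x, hx.tower_top⟩, rfl⟩
    · rintro ⟨y, rfl⟩
      exact isIntegral_trans (R := P) (A := R) _ y.2
  have := IsIntegralClosure.finite P F K (integralClosure R K)
  exact Module.Finite.of_restrictScalars_finite P R _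

namespace IsAffineCurve

variable {R : Subalgebra k K} (hR : IsAffineCurve R)

include hR

theorem isCurveField : IsCurveField k K := by
  have := hR.finiteType
  have := hR.frac
  refine ⟨?_, ?_⟩
  · have : Algebra.EssFiniteType R K :=
      Algebra.EssFiniteType.of_isLocalization K (nonZeroDivisors R)
    exact Algebra.EssFiniteType.comp k R K
  · obtain ⟨s, g, hg, hfin⟩ := exists_finite_inj_algHom_of_fg k R
    let P := MvPolynomial (Fin s) k
    let := g.toRingHom.toAlgebra
    have : Module.Finite P R := hfin
    have hint : Algebra.IsIntegral P R := inferInstance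
    have : FaithfulSMul P R := (faithfulSMul_iff_algebraMap_injective P R).mpr hg
    -- With two variables, a prime of `R` over `(X i)` is non-zero, hence maximal, so `(X i)` would
    -- be maximal as well. But it is strictly smaller than the ideal of polynomials without constant
    -- term, which contains `X j`.
    have hs : s ≤ 1 := by
      by_contra hs
      let i : Fin s := ⟨0, by omega⟩
      let j : Fin s := ⟨1, by omega⟩
      have hij : j ≠ i := by simp [i, j]
      have hprime : (Ideal.span {(MvPolynomial.X i : P)}).IsPrime :=
        (Ideal.span_singleton_prime (MvPolynomial.X_ne_zero i)).mpr (MvPolynomial.X_prime)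
      obtain ⟨Q, hQp, hQ⟩ := Ideal.exists_ideal_over_prime_of_isIntegral_of_isDomain (S := R)
        (Ideal.span {(MvPolynomial.X i : P)}) (by
          rw [(RingHom.injective_iff_ker_eq_bot _).mp (FaithfulSMul.algebraMap_injective P R)]
          exact bot_le)
      have hXmem : algebraMap P R (MvPolynomial.X i) ∈ Q := by
        rw [← Ideal.mem_comap, hQ]
        exact Ideal.mem_span_singleton_self _
      have hQ0 : Q ≠ ⊥ := by
        rintro rfl
        rw [Ideal.mem_bot] at hXmem
        exact MvPolynomial.X_ne_zero i (hg (hXmem.trans (map_zero _).symm))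
      have hQm := hR.maximal Q hQ0 hQp
      have hm : (Ideal.span {(MvPolynomial.X i : P)}).IsMaximal := by
        rw [← hQ]
        exact Ideal.isMaximal_comap_of_isIntegral_of_isMaximal Q
      have hle : Ideal.span {(MvPolynomial.X i : P)} ≤
          RingHom.ker (MvPolynomial.constantCoeff (R := k) (σ := Fin s)) := by
        rw [Ideal.span_le, Set.singleton_subset_iff, SetLike.mem_coe, RingHom.mem_ker,
          MvPolynomial.constantCoeff_X]
      have heq := hm.eq_of_le (RingHom.ker_ne_top _) hle
      have hj : (MvPolynomial.X j : P) ∈ Ideal.span {(MvPolynomial.X i : P)} := by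
        rw [heq, RingHom.mem_ker, MvPolynomial.constantCoeff_X]
      rw [Ideal.mem_span_singleton, MvPolynomial.X_dvd_X] at hj
      exact hij hj.symm
    let := ((algebraMap R K).comp g.toRingHom).toAlgebra
    have : IsScalarTower P R K := IsScalarTower.of_algebraMap_eq' rfl
    have : IsScalarTower k P K := IsScalarTower.of_algebraMap_eq fun z ↦ by
      change _ = algebraMap R K (g (algebraMap k P z))
      rw [AlgHom.commutes]
      rfl
    have hinj : Function.Injective (algebraMap P K) := (IsFractionRing.injective R K).comp hg
    have : FaithfulSMul P K := (faithfulSMul_iff_algebraMap_injective P K).mpr hinj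
    have halg : Algebra.IsAlgebraic P K := by
      have : Algebra.IsAlgebraic R K := IsLocalization.isAlgebraic K (nonZeroDivisors R)
      exact Algebra.IsAlgebraic.trans P R K
    have h1 := lift_trdeg_add_eq k P K
    rw [trdeg_eq_zero (R := P) (A := K), Cardinal.lift_zero, add_zero,
      MvPolynomial.trdeg_of_isDomain, Cardinal.mk_fin, Cardinal.lift_natCast,
      Cardinal.lift_natCast, eq_comm, Cardinal.lift_eq_nat_iff] at h1
    rw [h1]
    exact_mod_cast hs

/-- The localization of an affine curve at a closed point. -/
theorem isCurvePoint [IsAlgClosed k] [CharZero k] (A : Subalgebra k K) (hRA : R ≤ A)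
    (hloc : IsLocalRing A) (hne : A ≠ ⊤)
    (hA : ∀ x ∈ A, ∃ a ∈ R, ∃ s ∈ R, s ≠ 0 ∧ s⁻¹ ∈ A ∧ x * s = a) : IsCurvePoint A := by
  have hfrac := hR.frac
  have := hR.finiteType
  have : IsNoetherianRing R := Algebra.FiniteType.isNoetherianRing k R
  let ι : R →+* A := (Subalgebra.inclusion hRA).toRingHom
  let := ι.toAlgebra
  have hιinj : Function.Injective (algebraMap R A) := Subalgebra.inclusion_injective hRA
  have hRAK : IsScalarTower R A K := IsScalarTower.of_algebraMap_eq' rfl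
  have hkRA : IsScalarTower k R A := IsScalarTower.of_algebraMap_eq' rfl
  have hunit : ∀ x : A, x ≠ 0 → ((x : K)⁻¹ ∈ A ↔ IsUnit x) := by
    intro x hx
    have hx' : (x : K) ≠ 0 := fun h ↦ hx (Subtype.ext h)
    constructor
    · intro h
      exact IsUnit.of_mul_eq_one ⟨_, h⟩ (Subtype.ext (mul_inv_cancel₀ hx'))
    · rintro ⟨u, rfl⟩
      have : ((↑u⁻¹ : A) : K) = ((u : A) : K)⁻¹ := by
        refine eq_inv_of_mul_eq_one_left ?_
        exact congrArg Subtype.val u.inv_mul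
      rw [← this]
      exact (↑u⁻¹ : A).2
  let m : Ideal R := (IsLocalRing.maximalIdeal A).comap (algebraMap R A)
  have hmp : m.IsPrime := Ideal.comap_isPrime _ _
  have hfA : IsFractionRing A K := by
    refine (isLocalization_iff _ _).mpr ⟨?_, ?_, ?_⟩
    · rintro ⟨y, hy⟩
      rw [isUnit_iff_ne_zero]
      intro h0
      exact nonZeroDivisors.ne_zero hy (Subtype.ext h0)
    · intro z
      obtain ⟨⟨a, s⟩, has⟩ := IsLocalization.surj (nonZeroDivisors R) z
      refine ⟨⟨algebraMap R A a, ⟨algebraMap R A s, ?_⟩⟩, has⟩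
      rw [mem_nonZeroDivisors_iff_ne_zero]
      intro h0
      exact nonZeroDivisors.coe_ne_zero s (hιinj (h0.trans (map_zero _).symm))
    · intro x y hxy
      exact ⟨1, by rw [Subtype.ext hxy]⟩
  have hlocm : IsLocalization.AtPrime A m := by
    refine (isLocalization_iff _ _).mpr ⟨?_, ?_, ?_⟩
    · rintro ⟨y, hy⟩
      by_contra hcon
      exact hy ((IsLocalRing.mem_maximalIdeal _).mpr hcon)
    · intro z
      obtain ⟨a, ha, s, hs, hs0, hsA, hzs⟩ := hA z z.2
      refine ⟨⟨⟨a, ha⟩, ⟨⟨s, hs⟩, fun hmem ↦ ?_⟩⟩, Subtype.ext hzs⟩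
      have h1 := (hunit (⟨s, hRA hs⟩ : A) (fun h ↦ hs0 (congrArg Subtype.val h))).mp hsA
      exact (IsLocalRing.mem_maximalIdeal _).mp hmem h1
    · intro x y hxy
      exact ⟨1, by rw [hιinj hxy]⟩
  have hmap : ∀ q : Ideal A, (q.comap (algebraMap R A)).map (algebraMap R A) = q :=
    fun q ↦ IsLocalization.map_under m.primeCompl A q
  -- If the contracted ideal were zero, `A` would be a field with fraction field `K`, contrary to `A
  -- ≠ ⊤`.
  have hm0 : m ≠ ⊥ := by
    intro h0
    have h1 : IsLocalRing.maximalIdeal A = ⊥ := by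
      rw [← hmap (IsLocalRing.maximalIdeal A)]
      change Ideal.map _ m = ⊥
      rw [h0, Ideal.map_bot]
    have hfield := IsLocalRing.isField_iff_maximalIdeal_eq.mpr h1
    refine hne (eq_top_iff.mpr fun x _ ↦ ?_)
    obtain ⟨a, b, hb, rfl⟩ := IsFractionRing.div_surjective (A := A) x
    have hb0 := nonZeroDivisors.ne_zero hb
    have := (hunit b hb0).mpr (by
      let := hfield.toField
      exact isUnit_iff_ne_zero.mpr hb0)
    rw [div_eq_mul_inv]
    exact A.mul_mem a.2 this
  have hmax : m.IsMaximal := hR.maximal m hm0 hmp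
  refine ⟨⟨IsLocalization.isNoetherianRing m.primeCompl A inferInstance, ?_, hfA⟩, ?_, ?_⟩
  · refine Ring.krullDimLE_one_iff_of_noZeroDivisors.mpr fun (q : Ideal A) hq hqp ↦ ?_
    have hqm : (q.comap (algebraMap R A)).IsMaximal := by
      refine hR.maximal _ ?_ (Ideal.comap_isPrime _ _)
      intro h0
      refine hq ?_
      rw [← hmap q, h0, Ideal.map_bot]
    have hle : q.comap (algebraMap R A) ≤ m :=
      Ideal.comap_mono (IsLocalRing.le_maximalIdeal hqp.ne_top)
    have he := hqm.eq_of_le hmp.ne_top hle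
    rw [← hmap q, he, hmap]
    infer_instance
  · intro I hI r
    obtain rfl := IsLocalRing.eq_maximalIdeal hI
    obtain ⟨⟨a, s⟩, has⟩ := IsLocalization.surj m.primeCompl r
    have htriv := hasTrivialResidueFields_of_finiteType (k := k) R m hmax
    obtain ⟨z, hz⟩ := htriv a
    obtain ⟨w, hw⟩ := htriv s
    have hw0 : w ≠ 0 := by
      rintro rfl
      rw [map_zero, sub_zero] at hw
      exact s.2 hw
    have hsu : IsUnit (algebraMap R A s) := IsLocalization.map_units A s
    -- If `z` and `w` are the residues of numerator and denominator, the residue of the fraction is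
    -- `z / w`.
    refine ⟨z / w, ?_⟩
    rw [← Ideal.unit_mul_mem_iff_mem _ hsu]
    have hz' : algebraMap R A a - algebraMap k A z ∈ IsLocalRing.maximalIdeal A := by
      rw [IsScalarTower.algebraMap_apply k R A, ← map_sub]
      exact hz
    have hw' : algebraMap R A s - algebraMap k A w ∈ IsLocalRing.maximalIdeal A := by
      rw [IsScalarTower.algebraMap_apply k R A, ← map_sub]
      exact hw
    have hzw : algebraMap k A w * algebraMap k A (z / w) = algebraMap k A z := by
      rw [← map_mul, mul_div_cancel₀ _ hw0]
    have : algebraMap R A s * (r - algebraMap k A (z / w)) =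
        (algebraMap R A a - algebraMap k A z) -
          algebraMap k A (z / w) * (algebraMap R A s - algebraMap k A w) := by
      linear_combination has - hzw
    rw [this]
    exact Ideal.sub_mem _ hz' (Ideal.mul_mem_left _ _ hw')
  -- Integral closure commutes with localization: a multiple of `x` by a unit of `A` is integral
  -- over `R`, so generators over `R` also generate over `A`.
  · have hfin := finite_integralClosure_of_finiteType R hR.finiteType hfrac
    obtain ⟨G, hG⟩ := hfin
    let v : integralClosure R K → integralClosure A K := fun y ↦ ⟨y, y.2.tower_top⟩
    classical
    refine ⟨⟨G.image v, eq_top_iff.mpr fun x _ ↦ ?_⟩⟩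
    have hspan : ∀ y, v y ∈ Submodule.span A (G.image v : Set (integralClosure A K)) := by
      intro y
      have hy : y ∈ Submodule.span R (G : Set (integralClosure R K)) := by
        rw [hG]
        trivial
      induction hy using Submodule.span_induction with
      | mem y hy => exact Submodule.subset_span (Finset.mem_coe.mpr (Finset.mem_image_of_mem v hy))
      | zero => exact zero_mem _
      | add y z _ _ hy hz => exact add_mem hy hz
      | smul r y _ hy => exact Submodule.smul_mem _ (algebraMap R A r) hy
    obtain ⟨s, hs⟩ := IsIntegral.exists_multiple_integral_of_isLocalization m.primeCompl
      (x : K) x.2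
    have hsu : IsUnit (algebraMap R A s) := IsLocalization.map_units A s
    obtain ⟨u, hu⟩ := hsu
    have h1 := Submodule.smul_mem _ (↑u⁻¹ : A) (hspan ⟨_, hs⟩)
    convert h1
    apply Subtype.ext
    change (x : K) = ((↑u⁻¹ : A) : K) * (((algebraMap R A s : A) : K) * (x : K))
    rw [← hu, ← mul_assoc, ← Subalgebra.coe_mul, u.inv_mul, Subalgebra.coe_one, one_mul]

end IsAffineCurve

end AffineModel

end KltSurface

namespace KltSurface

/-! ### Local rings of a curve inside a field -/

section BranchRings

variable {X : Scheme.{0}}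

/-- The structure map from `ℂ` to the local ring at a point of a complex scheme. -/
noncomputable def baseMap (sX : X ⟶ Spec (.of ℂ)) (p : X) : ℂ →+* X.presheaf.stalk p :=
  ((Scheme.ΓSpecIso (.of ℂ)).inv ≫ sX.appTop ≫ X.presheaf.germ ⊤ p trivial).hom

theorem stalkSpecializes_baseMap (sX : X ⟶ Spec (.of ℂ)) {c p : X} (h : c ⤳ p) (z : ℂ) :
    (X.presheaf.stalkSpecializes h).hom (baseMap sX p z) = baseMap sX c z := by
  have := X.presheaf.germ_stalkSpecializes (U := ⊤) (show p ∈ (⊤ : X.Opens) from trivial) h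
  exact congrArg (fun φ ↦ φ.hom (sX.appTop.hom ((Scheme.ΓSpecIso (.of ℂ)).inv.hom z))) this

theorem stalkMap_baseMap {Y : Scheme.{0}} (sX : X ⟶ Spec (.of ℂ)) (sY : Y ⟶ Spec (.of ℂ))
    (g : X ⟶ Y) (hg : g ≫ sY = sX) (x : X) (z : ℂ) :
    (g.stalkMap x).hom (baseMap sY (g x) z) = baseMap sX x z := by
  subst hg
  have := Scheme.Hom.germ_stalkMap g ⊤ x trivial
  exact congrArg (fun φ ↦ φ.hom (sY.appTop.hom ((Scheme.ΓSpecIso (.of ℂ)).inv.hom z))) this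

theorem appLE_germ {Y : Scheme.{0}} (g : X ⟶ Y) (U : X.Opens) {c : X} (hc : c ∈ U) :
    g.appLE ⊤ U le_top ≫ X.presheaf.germ U c hc = g.appTop ≫ X.presheaf.germ ⊤ c trivial := by
  have h1 := g.appLE_map (U := ⊤) (V := g ⁻¹ᵁ ⊤) le_rfl
    (homOfLE (le_top : U ≤ g ⁻¹ᵁ ⊤)).op
  rw [Scheme.Hom.appLE_eq_app] at h1
  have h2 := X.presheaf.germ_res (homOfLE (le_top : U ≤ g ⁻¹ᵁ ⊤)) c hc
  exact (congrArg (· ≫ X.presheaf.germ U c hc) h1.symm).trans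
    ((Category.assoc _ _ _).trans (congrArg (g.appTop ≫ ·) h2))

variable {c : X} {K : Type} [Field K] (ψ : X.presheaf.stalk c →+* K)

/-- The image in `K` of the local ring at `p`, where `K` is a field with a map from the local ring
at a generalization `c` of `p`. -/
noncomputable def branchRing {p : X} (h : c ⤳ p) : Subring K :=
  (ψ.comp (X.presheaf.stalkSpecializes h).hom).range

theorem mem_branchRing {p : X} (h : c ⤳ p) (a : X.presheaf.stalk p) :
    ψ ((X.presheaf.stalkSpecializes h).hom a) ∈ branchRing ψ h := ⟨a, rfl⟩

/-- `branchRing` as an algebra over `ℂ`. -/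
noncomputable def branchAlg [Algebra ℂ K] (sX : X ⟶ Spec (.of ℂ))
    (hψ : ∀ z, ψ (baseMap sX c z) = algebraMap ℂ K z) {p : X} (h : c ⤳ p) : Subalgebra ℂ K :=
  { branchRing ψ h with
    algebraMap_mem' := fun z ↦ ⟨baseMap sX p z, by
      rw [← hψ, ← stalkSpecializes_baseMap sX h]; rfl⟩ }

variable (hs : Function.Surjective ψ)

include hs

theorem ker_eq_maximalIdeal : RingHom.ker ψ = IsLocalRing.maximalIdeal (X.presheaf.stalk c) :=
  IsLocalRing.eq_maximalIdeal (RingHom.ker_isMaximal_of_surjective ψ hs)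

theorem eq_zero_iff_mem_maximalIdeal (a : X.presheaf.stalk c) :
    ψ a = 0 ↔ a ∈ IsLocalRing.maximalIdeal (X.presheaf.stalk c) := by
  rw [← ker_eq_maximalIdeal ψ hs, RingHom.mem_ker]

theorem eq_zero_iff_mem_primeAt {p : X} (h : c ⤳ p) (a : X.presheaf.stalk p) :
    ψ ((X.presheaf.stalkSpecializes h).hom a) = 0 ↔ a ∈ primeAt h :=
  eq_zero_iff_mem_maximalIdeal ψ hs _

omit hs in
theorem isLocalRing_branchRing {p : X} (h : c ⤳ p) : IsLocalRing (branchRing ψ h) :=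
  IsLocalRing.of_surjective' (ψ.comp (X.presheaf.stalkSpecializes h).hom).rangeRestrict
    (RingHom.rangeRestrict_surjective _)

/-- Take `a` in the maximal ideal at `p` that does not vanish on the curve. An inverse `b` in the
image would give `a b - 1 ∈ primeAt h`, hence `1` in the maximal ideal. -/
theorem branchRing_ne_top {p : X} (h : c ⤳ p) (hne : c ≠ p) : branchRing ψ h ≠ ⊤ := by
  intro htop
  have hlt : ¬ IsLocalRing.maximalIdeal (X.presheaf.stalk p) ≤ primeAt h := by
    rw [← primeAt_self, primeAt_le_iff]
    exact fun h' ↦ hne (h.antisymm h').eq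
  obtain ⟨a, ha, hap⟩ := SetLike.not_le_iff_exists.mp hlt
  have ha0 : ψ ((X.presheaf.stalkSpecializes h).hom a) ≠ 0 := fun h0 ↦
    hap ((eq_zero_iff_mem_primeAt ψ hs h a).mp h0)
  have hinv : (ψ ((X.presheaf.stalkSpecializes h).hom a))⁻¹ ∈ branchRing ψ h := by
    rw [htop]
    trivial
  obtain ⟨b, hb⟩ := hinv
  have h1 : a * b - 1 ∈ primeAt h := by
    rw [← eq_zero_iff_mem_primeAt ψ hs h]
    rw [RingHom.comp_apply] at hb
    rw [map_sub, map_sub, map_mul, map_mul, hb, map_one, map_one, mul_inv_cancel₀ ha0, sub_self]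
  have h2 : a * b - 1 ∈ IsLocalRing.maximalIdeal (X.presheaf.stalk p) :=
    IsLocalRing.le_maximalIdeal (Ideal.IsPrime.ne_top inferInstance) h1
  have h3 := (IsLocalRing.maximalIdeal (X.presheaf.stalk p)).sub_mem
    (Ideal.mul_mem_right b _ ha) h2
  rw [sub_sub_cancel] at h3
  exact (Ideal.ne_top_iff_one _).mp (Ideal.IsPrime.ne_top inferInstance) h3

variable [Algebra ℂ K] (sX : X ⟶ Spec (.of ℂ))
  (hψ : ∀ z, ψ (baseMap sX c z) = algebraMap ℂ K z)

omit hs in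
/-- The coordinate ring of the affine curve with generic point `c` in `U`. -/
noncomputable def affineAlg (U : X.Opens) (hc : c ∈ U) : Subalgebra ℂ K :=
  { (ψ.comp (X.presheaf.germ U c hc).hom).range with
    algebraMap_mem' := fun z ↦ ⟨((Scheme.ΓSpecIso (.of ℂ)).inv ≫ sX.appLE ⊤ U le_top).hom z, by
      rw [← hψ]
      have : sX.appLE ⊤ U le_top ≫ X.presheaf.germ U c hc =
          sX.appTop ≫ X.presheaf.germ ⊤ c trivial :=
        appLE_germ sX U hc
      exact congrArg (fun φ ↦ ψ (φ.hom ((Scheme.ΓSpecIso (.of ℂ)).inv.hom z))) this⟩ }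

/-- The ring is the quotient of the sections over `U` by the prime of `c`. A non-zero prime
corresponds to a proper specialization of `c`, which is a closed point as the dimension is two; so
the prime is maximal. -/
theorem isAffineCurve_affineAlg [LocallyOfFiniteType sX] (hd : ∀ x : X, coheight x ≤ 2)
    (hc1 : coheight c = 1) (U : X.Opens) (hU : IsAffineOpen U) (hc : c ∈ U) :
    IsAffineCurve (affineAlg ψ sX hψ U hc) := by
  let φ : Γ(X, U) →+* affineAlg ψ sX hψ U hc := (ψ.comp (X.presheaf.germ U c hc).hom).rangeRestrict
  have hφ : Function.Surjective φ := RingHom.rangeRestrict_surjective _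
  have hφ0 : ∀ a, φ a = 0 ↔ a ∈ (hU.primeIdealOf ⟨c, hc⟩).asIdeal := by
    intro a
    rw [hU.primeIdealOf_eq_map_closedPoint]
    change _ ↔ (X.presheaf.germ U c hc).hom a ∈ IsLocalRing.maximalIdeal (X.presheaf.stalk c)
    rw [← eq_zero_iff_mem_maximalIdeal ψ hs]
    exact Subtype.ext_iff
  let _ := TopCat.Presheaf.algebra_section_stalk X.presheaf (⟨c, hc⟩ : U)
  have hlocU := hU.isLocalization_stalk ⟨c, hc⟩
  refine ⟨?_, ?_, ?_⟩
  · have h1 : (sX.appLE ⊤ U le_top).hom.FiniteType :=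
      LocallyOfFiniteType.finiteType_appLE sX (isAffineOpen_top _) hU _
    have h2 : (φ.comp ((sX.appLE ⊤ U le_top).hom.comp
        (Scheme.ΓSpecIso (.of ℂ)).inv.hom)).FiniteType :=
      (RingHom.FiniteType.of_surjective _ hφ).comp (h1.comp (RingHom.FiniteType.of_surjective _
        (ConcreteCategory.bijective_of_isIso (Scheme.ΓSpecIso (.of ℂ)).inv).2))
    rw [← RingHom.finiteType_algebraMap]
    convert h2
    ext z
    change algebraMap ℂ K z = _
    rw [← hψ]
    have : sX.appLE ⊤ U le_top ≫ X.presheaf.germ U c hc =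
        sX.appTop ≫ X.presheaf.germ ⊤ c trivial := appLE_germ sX U hc
    exact (congrArg (fun φ ↦ ψ (φ.hom ((Scheme.ΓSpecIso (.of ℂ)).inv.hom z))) this).symm
  · refine (isLocalization_iff _ _).mpr ⟨?_, ?_, ?_⟩
    · rintro ⟨y, hy⟩
      rw [isUnit_iff_ne_zero]
      intro h0
      exact nonZeroDivisors.ne_zero hy (Subtype.ext h0)
    · intro z
      obtain ⟨y, rfl⟩ := hs z
      obtain ⟨⟨a, s⟩, has⟩ := IsLocalization.surj (hU.primeIdealOf ⟨c, hc⟩).asIdeal.primeCompl y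
      refine ⟨⟨φ a, ⟨φ s, ?_⟩⟩, ?_⟩
      · rw [mem_nonZeroDivisors_iff_ne_zero]
        exact fun h0 ↦ s.2 ((hφ0 s).mp h0)
      · have := congrArg ψ has
        rw [map_mul] at this
        exact this
    · intro x y hxy
      exact ⟨1, by rw [Subtype.ext hxy]⟩
  · intro q hq hqp
    have hQp : (q.comap φ).IsPrime := Ideal.comap_isPrime _ _
    let Q : PrimeSpectrum Γ(X, U) := ⟨q.comap φ, hQp⟩
    have hle : (hU.primeIdealOf ⟨c, hc⟩).asIdeal ≤ Q.asIdeal := by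
      intro a ha
      change φ a ∈ q
      rw [(hφ0 a).mpr ha]
      exact zero_mem _
    have hne : hU.primeIdealOf ⟨c, hc⟩ ≠ Q := by
      intro heq
      refine hq (eq_bot_iff.mpr fun x hx ↦ ?_)
      obtain ⟨a, rfl⟩ := hφ x
      rw [Ideal.mem_bot, hφ0, heq]
      exact hx
    let z := hU.fromSpec Q
    have hzU : z ∈ U := by
      have : z ∈ Set.range hU.fromSpec := ⟨Q, rfl⟩
      rwa [hU.range_fromSpec] at this
    have hcz : c ⤳ z := by
      have h1 := ((PrimeSpectrum.le_iff_specializes (hU.primeIdealOf ⟨c, hc⟩) Q).mp hle).map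
        hU.fromSpec.continuous
      rwa [hU.fromSpec_primeIdealOf] at h1
    have hinj := hU.fromSpec.isOpenEmbedding.injective
    have hcz' : c ≠ z := by
      intro h
      refine hne (hinj ?_)
      rw [hU.fromSpec_primeIdealOf]
      exact h
    have hzcl := isClosed_of_specializes hd hc1 hcz hcz'
    have hQz : hU.primeIdealOf ⟨z, hzU⟩ = Q := hinj (hU.fromSpec_primeIdealOf _)
    have hQm := hU.primeIdealOf_isMaximal_of_isClosed ⟨z, hzU⟩ hzcl
    rw [hQz] at hQm
    have := Ideal.map_eq_top_or_isMaximal_of_surjective φ hφ hQm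
    have h2 : Ideal.map φ Q.asIdeal = q := Ideal.map_comap_of_surjective φ hφ q
    rw [h2] at this
    exact this.resolve_left hqp.ne_top

include hψ in
theorem isCurveField_branch [LocallyOfFiniteType sX] (hd : ∀ x : X, coheight x ≤ 2)
    (hc1 : coheight c = 1) : IsCurveField ℂ K := by
  obtain ⟨_, ⟨U, hU, rfl⟩, hcU, -⟩ :=
    X.isBasis_affineOpens.exists_subset_of_mem_open (Set.mem_univ c) isOpen_univ
  exact (isAffineCurve_affineAlg ψ hs sX hψ hd hc1 U hU hcU).isCurveField

theorem isCurvePoint_branchAlg [LocallyOfFiniteType sX] (hd : ∀ x : X, coheight x ≤ 2)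
    (hc1 : coheight c = 1) {p : X} (h : c ⤳ p) (hne : c ≠ p) :
    IsCurvePoint (branchAlg ψ sX hψ h) := by
  obtain ⟨_, ⟨U, hU, rfl⟩, hpU, -⟩ :=
    X.isBasis_affineOpens.exists_subset_of_mem_open (Set.mem_univ p) isOpen_univ
  have hcU : c ∈ U := h.mem_open U.2 hpU
  have e : ∀ b, (X.presheaf.stalkSpecializes h).hom ((X.presheaf.germ U p hpU).hom b) =
      (X.presheaf.germ U c hcU).hom b := by
    intro b
    have := X.presheaf.germ_stalkSpecializes (U := U) hpU h
    exact congrArg (fun φ ↦ φ.hom b) this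
  refine (isAffineCurve_affineAlg ψ hs sX hψ hd hc1 U hU hcU).isCurvePoint _ ?_
    (isLocalRing_branchRing ψ h) ?_ ?_
  · rintro _ ⟨a, rfl⟩
    exact ⟨(X.presheaf.germ U p hpU).hom a, by rw [RingHom.comp_apply, e]; rfl⟩
  · intro htop
    refine branchRing_ne_top ψ hs h hne (eq_top_iff.mpr fun x _ ↦ ?_)
    have : x ∈ branchAlg ψ sX hψ h := by
      rw [htop]
      trivial
    exact this
  · rintro _ ⟨y, rfl⟩
    let _ := TopCat.Presheaf.algebra_section_stalk X.presheaf (⟨p, hpU⟩ : U)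
    have hlocU := hU.isLocalization_stalk ⟨p, hpU⟩
    obtain ⟨⟨a, s⟩, has⟩ := IsLocalization.surj (hU.primeIdealOf ⟨p, hpU⟩).asIdeal.primeCompl y
    have hsu : IsUnit ((X.presheaf.germ U p hpU).hom s) :=
      IsLocalization.map_units (X.presheaf.stalk p) s
    obtain ⟨u, hu⟩ := hsu
    have hu' : ψ ((X.presheaf.stalkSpecializes h).hom u) *
        ψ ((X.presheaf.stalkSpecializes h).hom ↑u⁻¹) = 1 := by
      rw [← map_mul, ← map_mul, u.mul_inv, map_one, map_one]
    refine ⟨_, ⟨a, rfl⟩, _, ⟨s, rfl⟩, ?_, ?_, ?_⟩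
    · rw [RingHom.comp_apply, ← e, ← hu]
      exact left_ne_zero_of_mul_eq_one hu'
    · rw [RingHom.comp_apply, ← e, ← hu, inv_eq_of_mul_eq_one_right hu']
      exact ⟨_, rfl⟩
    · rw [RingHom.comp_apply, RingHom.comp_apply, RingHom.comp_apply, ← e, ← e, ← map_mul,
        ← map_mul]
      exact congrArg (fun t ↦ ψ ((X.presheaf.stalkSpecializes h).hom t)) has

end BranchRings

end KltSurface

namespace KltSurface

/-! ### Centers of valuation rings -/

section Centers

variable {X : Scheme.{0}}

theorem fromSpecStalk_comp_base (sX : X ⟶ Spec (.of ℂ)) (c : X) :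
    X.fromSpecStalk c ≫ sX = Spec.map (CommRingCat.ofHom (baseMap sX c)) := by
  rw [← cancel_mono (Spec (.of ℂ)).toSpecΓ, Category.assoc, Scheme.toSpecΓ_naturality,
    ← Category.assoc, Scheme.fromSpecStalk_toSpecΓ, ← SpecMap_ΓSpecIso_hom, ← Spec.map_comp,
    ← Spec.map_comp]
  congr 1
  change _ = (Scheme.ΓSpecIso (.of ℂ)).hom ≫ (Scheme.ΓSpecIso (.of ℂ)).inv ≫ _
  rw [Iso.hom_inv_id_assoc]

variable {c : X} {K : Type} [Field K] (ψ : X.presheaf.stalk c →+* K)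

/-- The morphism `Spec K ⟶ X` given by a map from a local ring of `X` to `K`. -/
noncomputable def branchMap : Spec (.of K) ⟶ X :=
  Spec.map (CommRingCat.ofHom ψ) ≫ X.fromSpecStalk c

theorem branchMap_residue : branchMap (X.residue c).hom = X.fromSpecResidueField c := rfl

theorem branchMap_comp_base (sX : X ⟶ Spec (.of ℂ)) [Algebra ℂ K]
    (hψ : ∀ z, ψ (baseMap sX c z) = algebraMap ℂ K z) :
    branchMap ψ ≫ sX = Spec.map (CommRingCat.ofHom (algebraMap ℂ K)) := by
  rw [branchMap, Category.assoc, fromSpecStalk_comp_base, ← Spec.map_comp]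
  congr 1
  ext z
  exact hψ z

variable (hs : Function.Surjective ψ)

include hs

theorem branchMap_apply (x : Spec (.of K)) : branchMap ψ x = c := by
  rw [branchMap, Scheme.Hom.comp_apply]
  have : Spec.map (CommRingCat.ofHom ψ) x = IsLocalRing.closedPoint (X.presheaf.stalk c) := by
    refine PrimeSpectrum.ext ?_
    refine (Eq.trans ?_ (ker_eq_maximalIdeal ψ hs) : _)
    change Ideal.comap ψ x.asIdeal = RingHom.ker ψ
    have hx : x.asIdeal = ⊥ := ((Ideal.eq_bot_or_top x.asIdeal).resolve_right x.2.ne_top)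
    rw [hx]
    rfl
  rw [this, Scheme.fromSpecStalk_closedPoint]

/-- The center `p` is the image of the closed point. The stalk map into `V` and the specialization
map followed by `ψ` induce the same morphism to `X`, and `Spec` of the stalk is a monomorphism into
`X`, so they agree in `K`. -/
theorem exists_branchRing_le (V : ValuationSubring K) (φ : Spec (.of V) ⟶ X)
    (hφ : Spec.map (CommRingCat.ofHom (algebraMap V K)) ≫ φ = branchMap ψ) :
    ∃ (p : X) (h : c ⤳ p), branchRing ψ h ≤ V.toSubring := by
  let p := φ (IsLocalRing.closedPoint V)
  have hφ' := Scheme.Spec_stalkClosedPointTo_fromSpecStalk φ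
  have hcp : c ⤳ p := by
    have h1 : c ∈ Set.range (X.fromSpecStalk p) := by
      let x : Spec (.of K) := (⊥ : PrimeSpectrum K)
      rw [← branchMap_apply ψ hs x, ← hφ, ← hφ', ← Category.assoc, Scheme.Hom.comp_apply]
      exact ⟨_, rfl⟩
    rwa [Scheme.range_fromSpecStalk] at h1
  refine ⟨p, hcp, ?_⟩
  have e1 : Spec.map (X.presheaf.stalkSpecializes hcp ≫ CommRingCat.ofHom ψ) ≫
      X.fromSpecStalk p = branchMap ψ := by
    exact (congrArg (· ≫ X.fromSpecStalk p) (Spec.map_comp _ _)).trans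
      ((Category.assoc _ _ _).trans
        (congrArg (_ ≫ ·) (Scheme.SpecMap_stalkSpecializes_fromSpecStalk hcp)))
  have e2 : Spec.map (Scheme.stalkClosedPointTo φ ≫ CommRingCat.ofHom (algebraMap V K)) ≫
      X.fromSpecStalk p = branchMap ψ :=
    (congrArg (· ≫ X.fromSpecStalk p) (Spec.map_comp _ _)).trans
      ((Category.assoc _ _ _).trans ((congrArg (_ ≫ ·) hφ').trans hφ))
  have h2 : Spec.map (Scheme.stalkClosedPointTo φ ≫ CommRingCat.ofHom (algebraMap V K)) =
      Spec.map (X.presheaf.stalkSpecializes hcp ≫ CommRingCat.ofHom ψ) := by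
    rw [← cancel_mono (X.fromSpecStalk p)]
    exact e2.trans e1.symm
  have h3 := Spec.map_injective h2
  rintro _ ⟨a, rfl⟩
  have h4 := congrArg (fun f ↦ f.hom a) h3
  change ψ ((X.presheaf.stalkSpecializes hcp).hom a) ∈ V.toSubring
  have h5 : ψ ((X.presheaf.stalkSpecializes hcp).hom a) =
    ((Scheme.stalkClosedPointTo φ).hom a : V) := h4.symm
  rw [h5]
  exact SetLike.coe_mem _

/-- The map from `𝒪_{X,p}` to a valuation ring containing its image. -/
noncomputable def toValuationSubring {ψ : X.presheaf.stalk c →+* K} {V : ValuationSubring K} {p : X}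
    {h : c ⤳ p} (hV : branchRing ψ h ≤ V.toSubring) : X.presheaf.stalk p →+* V :=
  (ψ.comp (X.presheaf.stalkSpecializes h).hom).codRestrict V.toSubring
    fun a ↦ hV (mem_branchRing ψ h a)

omit hs in
theorem map_algebraMap_comp_toValuationSubring {V : ValuationSubring K} {p : X} {h : c ⤳ p}
    (hV : branchRing ψ h ≤ V.toSubring) :
    Spec.map (CommRingCat.ofHom (algebraMap V K)) ≫
      Spec.map (CommRingCat.ofHom (toValuationSubring hV)) ≫ X.fromSpecStalk p = branchMap ψ := by
  rw [branchMap, ← Scheme.SpecMap_stalkSpecializes_fromSpecStalk h, ← Spec.map_comp_assoc,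
    ← Spec.map_comp_assoc]
  rfl

/-- The center of a nontrivial valuation ring is the image of the closed point. -/
theorem map_toValuationSubring_closedPoint [IsIntegral X] (hd : ∀ x : X, coheight x ≤ 2)
    (hc1 : coheight c = 1) {V : ValuationSubring K} (hV' : V ≠ ⊤) {p : X} {h : c ⤳ p}
    (hV : branchRing ψ h ≤ V.toSubring) :
    (Spec.map (CommRingCat.ofHom (toValuationSubring hV)) ≫ X.fromSpecStalk p)
      (IsLocalRing.closedPoint V) = p := by
  let τ := toValuationSubring hV
  let q : Ideal (X.presheaf.stalk p) := (IsLocalRing.maximalIdeal V).comap τ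
  have hq : q.IsPrime := Ideal.comap_isPrime _ _
  obtain ⟨z, hz, hqz⟩ := exists_eq_primeAt q hq
  have h1 : (Spec.map (CommRingCat.ofHom (toValuationSubring hV)) ≫ X.fromSpecStalk p)
      (IsLocalRing.closedPoint V) = z := by
    refine Eq.trans ?_ (fromSpecStalk_primeAt hz)
    change X.fromSpecStalk p ⟨q, hq⟩ = _
    congr 1
    exact PrimeSpectrum.ext hqz
  have hcz : c ⤳ z := by
    rw [← primeAt_le_iff h hz, ← hqz]
    intro a ha
    have : τ a = 0 := Subtype.ext ((eq_zero_iff_mem_primeAt ψ hs h a).mpr ha)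
    change τ a ∈ IsLocalRing.maximalIdeal V
    rw [this]
    exact zero_mem _
  -- If the closed point went to `c`, all denominators `s` that do not vanish at `c` would be units
  -- of `V`, and `V` would be all of `K`.
  have hne : c ≠ z := by
    rintro rfl
    refine hV' (eq_top_iff.mpr fun y _ ↦ ?_)
    obtain ⟨b, rfl⟩ := hs y
    let _ := (X.presheaf.stalkSpecializes h).hom.toAlgebra
    have hloc := isLocalization_stalkSpecializes h
    obtain ⟨⟨a, s⟩, has⟩ := IsLocalization.surj (primeAt h).primeCompl b
    have hs1 : τ s ∉ IsLocalRing.maximalIdeal V := fun h2 ↦ s.2 (by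
      have : (s : X.presheaf.stalk p) ∈ q := h2
      rw [hqz] at this
      exact this)
    obtain ⟨u, hu⟩ := not_not.mp hs1
    have h3 : ψ b * (u : V) = (τ a : V) := by
      rw [hu]
      exact (map_mul ψ _ _).symm.trans (congrArg ψ has)
    have h4 : ψ b = (τ a * (↑u⁻¹ : V) : V) := by
      rw [MulMemClass.coe_mul, ← h3, mul_assoc, ← MulMemClass.coe_mul, u.mul_inv]
      exact (mul_one _).symm
    rw [h4]
    exact SetLike.coe_mem _
  rw [h1]
  have hcl := isClosed_of_specializes hd hc1 hcz hne
  have : p ∈ closure {z} := hz.mem_closure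
  rw [hcl.closure_eq] at this
  exact this.symm

variable [Algebra ℂ K] (sX : X ⟶ Spec (.of ℂ))

-- Two centers give two lifts of one valuative square, which coincide by separatedness; each center
-- is recovered as the image of the closed point.
omit [Algebra ℂ K] in
theorem eq_of_branchRing_le [IsIntegral X] [IsSeparated sX] (hd : ∀ x : X, coheight x ≤ 2)
    (hc1 : coheight c = 1) {V : ValuationSubring K} (hV' : V ≠ ⊤) {p p' : X} {h : c ⤳ p}
    {h' : c ⤳ p'} (hV : branchRing ψ h ≤ V.toSubring) (hVp' : branchRing ψ h' ≤ V.toSubring) :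
    p = p' := by
  rw [← map_toValuationSubring_closedPoint ψ hs hd hc1 hV' hV,
    ← map_toValuationSubring_closedPoint ψ hs hd hc1 hV' hVp']
  have key : ∀ {p : X} {h : c ⤳ p} (hV : branchRing ψ h ≤ V.toSubring),
      (Spec.map (CommRingCat.ofHom (toValuationSubring hV)) ≫ X.fromSpecStalk p) ≫ sX =
        Spec.map (CommRingCat.ofHom ((toValuationSubring hV).comp (baseMap sX p))) := by
    intro p h hV
    rw [Category.assoc, fromSpecStalk_comp_base, ← Spec.map_comp]
    rfl
  have hbase : (toValuationSubring hV).comp (baseMap sX p) =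
      (toValuationSubring hVp').comp (baseMap sX p') := by
    ext z
    have h1 : ψ ((X.presheaf.stalkSpecializes h).hom (baseMap sX p z)) =
        ψ ((X.presheaf.stalkSpecializes h').hom (baseMap sX p' z)) := by
      rw [stalkSpecializes_baseMap, stalkSpecializes_baseMap]
    exact h1
  let S : ValuativeCommSq sX :=
    { R := V, K := K, i₁ := branchMap ψ, i₂ := _,
      commSq := ⟨(congrArg (· ≫ sX) (map_algebraMap_comp_toValuationSubring ψ hV)).symm.trans
        ((Category.assoc _ _ _).trans (congrArg (_ ≫ ·) (key hV)))⟩ }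
  have hS := IsSeparated.valuativeCriterion sX S
  let l₁ : S.commSq.LiftStruct :=
    ⟨_, map_algebraMap_comp_toValuationSubring ψ hV, key hV⟩
  let l₂ : S.commSq.LiftStruct :=
    ⟨_, map_algebraMap_comp_toValuationSubring ψ hVp', (key hVp').trans (by rw [← hbase])⟩
  exact congrArg (fun l : S.commSq.LiftStruct ↦ l.l (IsLocalRing.closedPoint V))
    (Subsingleton.elim l₁ l₂)

omit hs in
/-- The structure map from `ℂ` to a valuation ring over `ℂ`. -/
noncomputable def baseToValuationSubring {V : ValuationSubring K}
    (hV : (algebraMap ℂ K).range ≤ V.toSubring) : ℂ →+* V :=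
  (algebraMap ℂ K).codRestrict V.toSubring fun z ↦ hV ⟨z, rfl⟩

/-- A valuation ring has a center if `Spec K ⟶ X` lifts to a scheme proper over the base. -/
theorem exists_branchRing_le_of_isProper {Z W : Scheme.{0}} (i : Z ⟶ X) (g : Z ⟶ W) [IsProper g]
    (j : Spec (.of K) ⟶ Z) (hj : j ≫ i = branchMap ψ) (t : Spec (.of ℂ) ⟶ W)
    (ht : j ≫ g = Spec.map (CommRingCat.ofHom (algebraMap ℂ K)) ≫ t)
    {V : ValuationSubring K} (hV : (algebraMap ℂ K).range ≤ V.toSubring) :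
    ∃ (p : X) (h : c ⤳ p), branchRing ψ h ≤ V.toSubring := by
  have hcomp : Spec.map (CommRingCat.ofHom (algebraMap ℂ K)) ≫ t =
      Spec.map (CommRingCat.ofHom (algebraMap V K)) ≫
        Spec.map (CommRingCat.ofHom (baseToValuationSubring hV)) ≫ t := by
    rw [← Spec.map_comp_assoc]
    rfl
  let S : ValuativeCommSq g :=
    { R := V, K := K, i₁ := j, i₂ := Spec.map (CommRingCat.ofHom (baseToValuationSubring hV)) ≫ t
      commSq := ⟨ht.trans hcomp⟩ }
  have hex : ValuativeCriterion.Existence g := by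
    have : (ValuativeCriterion.Existence ⊓ @QuasiCompact) g := by
      rw [← UniversallyClosed.eq_valuativeCriterion]
      infer_instance
    exact this.1
  obtain ⟨l, hl, -⟩ := (hex S).exists_lift
  exact exists_branchRing_le ψ hs V (l ≫ i)
    ((Category.assoc _ _ _).symm.trans ((congrArg (· ≫ i) hl).trans hj))

end Centers

/-! ### Complete and contracted curves as complete models -/

section Residue

variable {X : Scheme.{0}} (sX : X ⟶ Spec (.of ℂ))

/-- The residue field at a point as a `ℂ`-algebra. -/
@[reducible] noncomputable def residueFieldAlgebra (c : X) : Algebra ℂ (X.residueField c) :=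
  ((X.residue c).hom.comp (baseMap sX c)).toAlgebra

/-- The local rings of the curve with generic point `c` at its closed points. -/
noncomputable def curveAlg (c : X) (p : {p : X // IsClosed ({p} : Set X) ∧ c ⤳ p}) :
    letI := residueFieldAlgebra sX c
    Subalgebra ℂ (X.residueField c) :=
  letI := residueFieldAlgebra sX c
  branchAlg (X.residue c).hom sX (fun _ ↦ rfl) p.2.2

/-- A closed immersion induces isomorphisms of residue fields, so `Spec κ(c) ⟶ X` factors through
the proper curve `Z`, to which the valuative criterion applies. -/
theorem exists_center_of_isCompleteCurve {c : X} (hc : IsCompleteCurve sX c) :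
    letI := residueFieldAlgebra sX c
    ∀ V : ValuationSubring (X.residueField c),
      (algebraMap ℂ (X.residueField c)).range ≤ V.toSubring →
      ∃ (p : X) (h : c ⤳ p), branchRing (X.residue c).hom h ≤ V.toSubring := by
  let _ := residueFieldAlgebra sX c
  intro V hV
  obtain ⟨-, Z, i, hZ, hi, rfl, hp⟩ := hc
  have hbij : IsIso (i.residueFieldMap (genericPoint Z)) := by
    rw [ConcreteCategory.isIso_iff_bijective]
    refine ⟨RingHom.injective _, fun y ↦ ?_⟩
    obtain ⟨b, rfl⟩ := Z.residue_surjective _ y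
    obtain ⟨a, rfl⟩ := i.stalkMap_surjective _ b
    exact ⟨X.residue _ a, congrArg (fun φ ↦ φ.hom a) (Scheme.residue_residueFieldMap i (genericPoint Z))⟩
  let j : Spec (X.residueField (i (genericPoint Z))) ⟶ Z :=
    Spec.map (inv (i.residueFieldMap (genericPoint Z))) ≫ Z.fromSpecResidueField _
  have hj : j ≫ i = X.fromSpecResidueField _ := by
    rw [Category.assoc, ← Scheme.Hom.SpecMap_residueFieldMap_fromSpecResidueField,
      ← Spec.map_comp_assoc, IsIso.hom_inv_id, Spec.map_id, Category.id_comp]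
  refine exists_branchRing_le_of_isProper (K := X.residueField (i (genericPoint Z)))
    (X.residue (i (genericPoint Z))).hom Ideal.Quotient.mk_surjective i (i ≫ sX) j hj (𝟙 _) ?_ hV
  rw [← Category.assoc, hj, Category.comp_id, ← branchMap_residue]
  exact branchMap_comp_base _ sX fun _ ↦ rfl

/-- A contracted curve is complete because `ε` is proper: the composite `Spec κ(c) ⟶ Y` factors
through a closed point, that is, through `Spec ℂ`, so any valuation ring containing `ℂ` yields a
valuative square for `ε`. -/
theorem exists_center_of_isContracted [LocallyOfFiniteType sX] {Y : Scheme.{0}}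
    (sY : Y ⟶ Spec (.of ℂ)) [LocallyOfFiniteType sY] (ε : X ⟶ Y) [IsProper ε] (hε : ε ≫ sY = sX)
    {c : X} (hc : IsContracted ε c) :
    letI := residueFieldAlgebra sX c
    ∀ V : ValuationSubring (X.residueField c),
      (algebraMap ℂ (X.residueField c)).range ≤ V.toSubring →
      ∃ (p : X) (h : c ⤳ p), branchRing (X.residue c).hom h ≤ V.toSubring := by
  let _ := residueFieldAlgebra sX c
  intro V hV
  refine exists_branchRing_le_of_isProper (K := X.residueField c) (X.residue c).hom
    Ideal.Quotient.mk_surjective (𝟙 X) ε (X.fromSpecResidueField c) (Category.comp_id _)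
    (pointOfClosedPoint sY (ε c) hc.2) ?_ hV
  have h1 : Spec.map (CommRingCat.ofHom (algebraMap ℂ (X.residueField c))) =
      Spec.map (ε.residueFieldMap c) ≫ Spec.map (residueFieldIsoBase sY (ε c) hc.2).inv := by
    rw [SpecMap_residueFieldIsoBase_inv,
      Scheme.Hom.SpecMap_residueFieldMap_fromSpecResidueField_assoc, hε, ← branchMap_residue]
    exact (branchMap_comp_base _ sX fun _ ↦ rfl).symm
  rw [h1, pointOfClosedPoint, Category.assoc,
    ← Spec.map_comp_assoc _ _ (Y.fromSpecResidueField _), Iso.hom_inv_id, Spec.map_id,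
    Category.id_comp, Scheme.Hom.SpecMap_residueFieldMap_fromSpecResidueField]

theorem isCompleteModel_curveAlg [IsIntegral X] [LocallyOfFiniteType sX] [IsSeparated sX]
    (hd : ∀ x : X, coheight x ≤ 2) {c : X} (hc1 : coheight c = 1) (hcl : ¬ IsClosed {c}) :
    letI := residueFieldAlgebra sX c
    (∀ V : ValuationSubring (X.residueField c),
      (algebraMap ℂ (X.residueField c)).range ≤ V.toSubring →
      ∃ (p : X) (h : c ⤳ p), branchRing (X.residue c).hom h ≤ V.toSubring) →
    IsCompleteModel (curveAlg sX c) := by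
  let _ := residueFieldAlgebra sX c
  intro hex
  have hs : Function.Surjective (X.residue c).hom := Ideal.Quotient.mk_surjective
  refine ⟨fun p ↦ ?_, fun V hV ↦ ?_⟩
  · exact isCurvePoint_branchAlg _ hs sX _ hd hc1 _ fun h ↦ hcl (h ▸ p.2.1)
  · obtain ⟨p, h, hp⟩ := hex V hV.2
    -- A center at `c` itself would make `V` the whole residue field.
    have hne : c ≠ p := by
      rintro rfl
      refine hV.1 (eq_top_iff.mpr fun y _ ↦ ?_)
      obtain ⟨b, rfl⟩ := hs y
      have h1 := mem_branchRing (X.residue c).hom h b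
      rw [TopCat.Presheaf.stalkSpecializes_refl] at h1
      exact hp h1
    refine ⟨⟨p, isClosed_of_specializes hd hc1 h hne, h⟩, hp, fun p' hp' ↦ Subtype.ext ?_⟩
    exact eq_of_branchRing_le _ hs sX hd hc1 hV.1 hp' hp

end Residue

end KltSurface

namespace KltSurface

/-! ### Finiteness of intersections and of divisors of functions -/

section Finiteness

/-- Each of the finitely many irreducible pieces has a generic point, which is closed, so the piece
is a single point. -/
theorem finite_of_forall_isClosed_singleton {T : Type*} [TopologicalSpace T]
    [TopologicalSpace.NoetherianSpace T] [QuasiSober T] {S : Set T} (hS : IsClosed S)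
    (h : ∀ x ∈ S, IsClosed ({x} : Set T)) : S.Finite := by
  obtain ⟨C, hfin, hC, hirr, rfl⟩ :=
    TopologicalSpace.NoetherianSpace.exists_finite_set_isClosed_irreducible hS
  refine hfin.sUnion fun s hs ↦ ?_
  obtain ⟨g, hg⟩ := QuasiSober.sober (hirr s hs) (hC s hs)
  have hgs : g ∈ s := hg.mem
  rw [← hg.def, (h g ⟨s, hs, hgs⟩).closure_eq]
  exact Set.finite_singleton g

variable {X : Scheme.{0}}

theorem finite_specializations [TopologicalSpace.NoetherianSpace X]
    (hd : ∀ x : X, coheight x ≤ 2) {c z : X} (hc : coheight c = 1) (hz : coheight z = 1)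
    (hne : z ≠ c) : {p : X | c ⤳ p ∧ z ⤳ p}.Finite := by
  have : {p : X | c ⤳ p ∧ z ⤳ p} = closure {c} ∩ closure {z} := by
    ext p
    simp [specializes_iff_mem_closure]
  rw [this]
  refine finite_of_forall_isClosed_singleton (isClosed_closure.inter isClosed_closure) ?_
  rintro p ⟨hp1, hp2⟩
  refine isClosed_of_specializes hd hc (specializes_iff_mem_closure.mpr hp1) ?_
  rintro rfl
  exact hne (eq_of_specializes_of_coheight_eq_one hz hc (specializes_iff_mem_closure.mpr hp2))

variable [IsIntegral X]

/-- A prime divisor outside `U` is the generic point of one of the finitely many irreducible pieces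
of the complement: a proper generization has codimension zero and lies in `U`. -/
theorem finite_coheight_eq_one_diff [TopologicalSpace.NoetherianSpace X] (U : X.Opens)
    (hU : genericPoint X ∈ U) : {z : X | coheight z = 1 ∧ z ∉ U}.Finite := by
  obtain ⟨C, hfin, hC, hirr, heq⟩ :=
    TopologicalSpace.NoetherianSpace.exists_finite_set_isClosed_irreducible U.2.isClosed_compl
  have hg : ∀ s : Set X, ∃ g : X, s ∈ C → IsGenericPoint g s := fun s ↦ by
    by_cases hs : s ∈ C
    · obtain ⟨g, hg⟩ := QuasiSober.sober (hirr s hs) (hC s hs)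
      exact ⟨g, fun _ ↦ hg⟩
    · exact ⟨genericPoint X, fun h ↦ absurd h hs⟩
  choose g hg using hg
  refine (hfin.image g).subset ?_
  rintro z ⟨hz, hzU⟩
  have h1 : z ∈ ⋃₀ C := heq ▸ hzU
  obtain ⟨s, hs, hzs⟩ := h1
  refine ⟨s, hs, ?_⟩
  have h2 : g s ⤳ z := (hg s hs).specializes hzs
  by_contra hne
  have h3 := coheight_add_one_le (lt_of_specializes h2 hne)
  rw [hz] at h3
  have h4 : coheight (g s) = 0 := by
    have : coheight (g s) + 1 ≤ 0 + 1 := by simpa using h3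
    simpa using (ENat.add_le_add_iff_right ENat.one_ne_top).mp this
  have h5 : g s ∈ ⋃₀ C := ⟨s, hs, (hg s hs).mem⟩
  rw [← heq, eq_genericPoint_of_coheight_eq_zero h4] at h5
  exact h5 hU

theorem finite_ord_ne_zero [IsLocallyNoetherian X] [TopologicalSpace.NoetherianSpace X]
    {f : X.functionField} (hf : f ≠ 0) : {z : X | X.ord f z ≠ 0}.Finite := by
  obtain ⟨U, -, f', hU, rfl, hf'⟩ := exists_isUnit_germ_eq X f hf
  refine (finite_coheight_eq_one_diff U (((genericPoint_spec X).mem_open_set_iff U.2).mpr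
    (by simpa using Set.nonempty_coe_sort.mp hU))).subset fun z hz ↦ ?_
  refine ⟨?_, fun hzU ↦ hz (Scheme.ord_of_isUnit hf' hzU)⟩
  by_contra h
  exact hz (Scheme.ord_eq_zero_of_coheight_neq_one h _)

end Finiteness

/-! ### Restricting rational functions to a curve -/

section Values

variable {X : Scheme.{0}} [IsIntegral X]

/-- The rational function `f` is a unit at `p`. -/
def IsUnitAt (p : X) (f : X.functionField) : Prop :=
  ∃ u : (X.presheaf.stalk p)ˣ, algebraMap (X.presheaf.stalk p) X.functionField u = f

theorem valueAt_algebraMap (c : X) (a : X.presheaf.stalk c) :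
    valueAt c (algebraMap _ X.functionField a) = (X.residue c).hom a := by
  have h : ∃ b : X.presheaf.stalk c, algebraMap (X.presheaf.stalk c) X.functionField b =
      algebraMap _ X.functionField a := ⟨a, rfl⟩
  rw [valueAt, dif_pos h]
  exact congrArg _ (IsFractionRing.injective (X.presheaf.stalk c) X.functionField h.choose_spec)

theorem valueAt_algebraMap_of_specializes {c p : X} (h : c ⤳ p) (a : X.presheaf.stalk p) :
    valueAt c (algebraMap _ X.functionField a) =
      (X.residue c).hom ((X.presheaf.stalkSpecializes h).hom a) := by
  rw [← algebraMap_stalkSpecializes h, valueAt_algebraMap]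

theorem valueAt_one (c : X) : valueAt c (1 : X.functionField) = 1 := by
  rw [← map_one (algebraMap (X.presheaf.stalk c) X.functionField), valueAt_algebraMap, map_one]

namespace IsUnitAt

variable {p c : X} {f g : X.functionField}

theorem inv (hf : IsUnitAt p f) : IsUnitAt p f⁻¹ := by
  obtain ⟨u, rfl⟩ := hf
  refine ⟨u⁻¹, eq_inv_of_mul_eq_one_left ?_⟩
  rw [← map_mul, u.inv_mul, map_one]

theorem specializes (hf : IsUnitAt p f) (h : c ⤳ p) : IsUnitAt c f := by
  obtain ⟨u, rfl⟩ := hf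
  exact ⟨Units.map (X.presheaf.stalkSpecializes h).hom.toMonoidHom u,
    algebraMap_stalkSpecializes h u⟩

theorem valueAt_mul (hf : IsUnitAt c f) (hg : IsUnitAt c g) :
    valueAt c (f * g) = valueAt c f * valueAt c g := by
  obtain ⟨u, rfl⟩ := hf
  obtain ⟨v, rfl⟩ := hg
  rw [← map_mul, valueAt_algebraMap, valueAt_algebraMap, valueAt_algebraMap, map_mul]

theorem valueAt_ne_zero (hf : IsUnitAt c f) : valueAt c f ≠ 0 := by
  intro h
  have := hf.valueAt_mul hf.inv
  obtain ⟨u, rfl⟩ := hf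
  rw [mul_inv_cancel₀, valueAt_one, h, zero_mul] at this
  · exact one_ne_zero this
  · exact (map_ne_zero_iff _ (IsFractionRing.injective _ _)).mpr u.ne_zero

theorem ne_zero (hf : IsUnitAt c f) : f ≠ 0 := by
  obtain ⟨u, rfl⟩ := hf
  exact (map_ne_zero_iff _ (IsFractionRing.injective _ _)).mpr u.ne_zero

theorem valueAt_inv (hf : IsUnitAt c f) : valueAt c f⁻¹ = (valueAt c f)⁻¹ := by
  refine eq_inv_of_mul_eq_one_left ?_
  rw [← hf.inv.valueAt_mul hf, inv_mul_cancel₀ hf.ne_zero, valueAt_one]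

theorem valueAt_mem (hf : IsUnitAt p f) (h : c ⤳ p) : valueAt c f ∈ curveLocalRing c p h := by
  obtain ⟨u, rfl⟩ := hf
  rw [valueAt_algebraMap_of_specializes h]
  exact ⟨u, rfl⟩

theorem valueAt_inv_mem (hf : IsUnitAt p f) (h : c ⤳ p) :
    (valueAt c f)⁻¹ ∈ curveLocalRing c p h := by
  rw [← (hf.specializes h).valueAt_inv]
  exact hf.inv.valueAt_mem h

end IsUnitAt

theorem isUnitAt_div_of_ord_eq [IsLocallyNoetherian X]
    (hn : ∀ x : X, IsIntegrallyClosed (X.presheaf.stalk x)) {p : X} {f g : X.functionField}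
    (hf : f ≠ 0) (hg : g ≠ 0)
    (h : ∀ z : X, coheight z = 1 → z ⤳ p → X.ord f z = X.ord g z) : IsUnitAt p (f / g) := by
  obtain ⟨u, hu⟩ := exists_unit_of_ord_eq p hn hf hg h
  exact ⟨u, by rw [← hu, mul_div_assoc, div_self hg, mul_one]⟩

end Values

/-! ### Degrees of divisors on curves -/

section Degree

variable {X : Scheme.{0}} [IsIntegral X] [IsLocallyNoetherian X]

/-- The functions `f x` are local equations of `m D`, for a divisor `D` with finitely many
components. -/
structure IsLocalSystem (D : X → ℚ) (m : ℕ) (f : X → X.functionField) : Prop where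
  finite : {z : X | coheight z = 1 ∧ D z ≠ 0}.Finite
  ne_zero : ∀ x, f x ≠ 0
  ord_eq : ∀ x z : X, coheight z = 1 → z ⤳ x → ((X.ord (f x) z : ℤ) : ℚ) = m * D z

namespace IsLocalSystem

variable {D E : X → ℚ} {m n : ℕ} {f g : X → X.functionField}

theorem mul (hf : IsLocalSystem D m f) (hg : IsLocalSystem E m g) :
    IsLocalSystem (D + E) m (f * g) := by
  refine ⟨(hf.finite.union hg.finite).subset ?_, fun x ↦ mul_ne_zero (hf.ne_zero x) (hg.ne_zero x),
    fun x z hz h ↦ ?_⟩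
  · rintro z ⟨hz, hz'⟩
    by_contra hcon
    simp only [Set.mem_union, Set.mem_ofPred_eq, hz, true_and, not_or, not_not] at hcon
    exact hz' (by simp [hcon.1, hcon.2])
  · rw [Pi.mul_apply, Scheme.ord_mul (hf.ne_zero x) (hg.ne_zero x), Int.cast_add,
      hf.ord_eq x z hz h, hg.ord_eq x z hz h, Pi.add_apply, mul_add]

/-- A multiple `a / b` of a divisor. -/
theorem zpow (hf : IsLocalSystem D m f) {q : ℚ} {a : ℤ} {b : ℕ} (hq : q * b = a) :
    IsLocalSystem (q • D) (m * b) (f ^ a) := by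
  refine ⟨hf.finite.subset ?_, fun x ↦ zpow_ne_zero a (hf.ne_zero x), fun x z hz h ↦ ?_⟩
  · rintro z ⟨hz, hz'⟩
    exact ⟨hz, fun h ↦ hz' (by simp [h])⟩
  · rw [Pi.pow_apply, ord_zpow z (hf.ne_zero x), Int.cast_mul, hf.ord_eq x z hz h, ← hq,
      Pi.smul_apply, smul_eq_mul]
    push_cast
    ring

theorem isUnitAt_div_of_specializes (hn : ∀ x : X, IsIntegrallyClosed (X.presheaf.stalk x))
    (hf : IsLocalSystem D m f) {c p : X} (h : c ⤳ p) : IsUnitAt c (f p / f c) :=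
  isUnitAt_div_of_ord_eq hn (hf.ne_zero p) (hf.ne_zero c) fun z hz h' ↦ by
    exact_mod_cast (hf.ord_eq p z hz (h'.trans h)).trans (hf.ord_eq c z hz h').symm

theorem div (hf : IsLocalSystem D m f) (hg : IsLocalSystem D m g) :
    IsLocalSystem (0 : X → ℚ) 1 (f / g) := by
  refine ⟨by simp, fun x ↦ div_ne_zero (hf.ne_zero x) (hg.ne_zero x), fun x z hz h ↦ ?_⟩
  rw [Pi.div_apply, div_eq_mul_inv, Scheme.ord_mul (hf.ne_zero x) (inv_ne_zero (hg.ne_zero x)),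
    ord_inv z (hg.ne_zero x), Int.cast_add, Int.cast_neg, hf.ord_eq x z hz h, hg.ord_eq x z hz h]
  simp

end IsLocalSystem


variable {sX : X ⟶ Spec (.of ℂ)} (hX : IsNormalSurface sX)

include hX

omit [IsIntegral X] [IsLocallyNoetherian X] in
theorem IsNormalSurface.coheight_le (x : X) : coheight x ≤ 2 :=
  coheight_le_of_topologicalKrullDim hX.dim_eq_two x

omit [IsIntegral X] in
theorem IsNormalSurface.noetherianSpace : TopologicalSpace.NoetherianSpace X := by
  have := hX.quasiCompact
  have : CompactSpace X := QuasiCompact.compactSpace_of_compactSpace sX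
  have : IsNoetherian X := {}
  infer_instance

omit hX in
variable (sX) in
/-- `c` is the generic point of a curve satisfying the existence part of the valuative criterion of
properness. -/
structure IsModelCurve (c : X) : Prop where
  coheight_eq : coheight c = 1
  center : letI := residueFieldAlgebra sX c
    ∀ V : ValuationSubring (X.residueField c),
      (algebraMap ℂ (X.residueField c)).range ≤ V.toSubring →
      ∃ (p : X) (h : c ⤳ p), branchRing (X.residue c).hom h ≤ V.toSubring

variable {c : X}

theorem IsModelCurve.isCompleteModel (hc : IsModelCurve sX c) (hcl : ¬ IsClosed {c}) :
    letI := residueFieldAlgebra sX c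
    IsCompleteModel (curveAlg sX c) :=
  have := hX.locallyOfFiniteType
  have := hX.separated
  isCompleteModel_curveAlg sX hX.coheight_le hc.coheight_eq hcl hc.center

theorem IsModelCurve.isCurveField (hc : IsModelCurve sX c) :
    letI := residueFieldAlgebra sX c
    IsCurveField ℂ (X.residueField c) :=
  letI := residueFieldAlgebra sX c
  have := hX.locallyOfFiniteType
  isCurveField_branch (X.residue c).hom Ideal.Quotient.mk_surjective sX (fun _ ↦ rfl)
    hX.coheight_le hc.coheight_eq

omit [IsLocallyNoetherian X] hX in
/-- A closed point has no degree. -/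
theorem curveDegree_of_isClosed (hcl : IsClosed ({c} : Set X)) {f : X → X.functionField}
    (hf : f c ≠ 0) : curveDegree f c = 0 := by
  rw [curveDegree]
  refine (finsum_congr fun p ↦ ?_).trans finsum_zero
  obtain ⟨p, hp, h⟩ := p
  have : p ∈ closure {c} := h.mem_closure
  rw [hcl.closure_eq] at this
  obtain rfl : p = c := this
  rw [div_self hf, valueAt_one, fracOrd_one]

/-- At a point `p` of the curve lying on no other component of `div (f c)` or `D`, the functions `f
p` and `f c` have equal orders along all prime divisors through `p`, so their quotient is a unit.
Only finitely many points are excluded. -/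
theorem finite_nonUnitLocus (hc : coheight c = 1) (hcl : ¬ IsClosed ({c} : Set X)) {D : X → ℚ}
    {m : ℕ} {f : X → X.functionField} (hf : IsLocalSystem D m f) :
    letI := residueFieldAlgebra sX c
    (nonUnitLocus (curveAlg sX c) fun p ↦ valueAt c (f p.1 / f c)).Finite := by
  let _ := residueFieldAlgebra sX c
  have := hX.noetherianSpace
  let T : Set X := {z | coheight z = 1 ∧ z ≠ c ∧ (X.ord (f c) z ≠ 0 ∨ D z ≠ 0)}
  have hT : T.Finite := by
    refine ((finite_ord_ne_zero (hf.ne_zero c)).union hf.finite).subset ?_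
    rintro z ⟨hz, -, h | h⟩
    · exact Or.inl h
    · exact Or.inr ⟨hz, h⟩
  have hfin : (⋃ z ∈ T, {p : X | c ⤳ p ∧ z ⤳ p}).Finite :=
    hT.biUnion fun z hz ↦ finite_specializations hX.coheight_le hc hz.1 hz.2.1
  refine (hfin.preimage Subtype.val_injective.injOn).subset fun p hp ↦ ?_
  by_contra hcon
  simp only [Set.mem_preimage, Set.mem_iUnion, not_exists] at hcon
  refine hp ?_
  have hu : IsUnitAt p.1 (f p.1 / f c) := by
    refine isUnitAt_div_of_ord_eq hX.normal (hf.ne_zero _) (hf.ne_zero _) fun z hz h ↦ ?_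
    have h1 := hf.ord_eq p.1 z hz h
    by_cases hzc : z = c
    · subst hzc
      exact_mod_cast h1.trans (hf.ord_eq z z hz (specializes_refl _)).symm
    · have h2 : z ∉ T := fun hzT ↦ hcon z hzT ⟨p.2.2, h⟩
      have h3 : X.ord (f c) z = 0 ∧ D z = 0 := by
        by_contra h4
        rw [not_and_or] at h4
        exact h2 ⟨hz, hzc, h4⟩
      rw [h3.2, mul_zero] at h1
      rw [h3.1]
      exact_mod_cast h1
  exact ⟨hu.valueAt_mem p.2.2, hu.valueAt_inv_mem p.2.2⟩

omit [IsIntegral X] [IsLocallyNoetherian X] hX in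
theorem support_fracOrd_subset {h : {p : X // IsClosed ({p} : Set X) ∧ c ⤳ p} → X.residueField c}
    (hA : letI := residueFieldAlgebra sX c; IsCompleteModel (curveAlg sX c)) :
    letI := residueFieldAlgebra sX c
    (Function.support fun p ↦ fracOrd (curveLocalRing c p.1 p.2.2) (h p)) ⊆
      nonUnitLocus (curveAlg sX c) h := by
  let _ := residueFieldAlgebra sX c
  intro p hp hcon
  exact hp ((hA.point p).ordRing.fracOrd_eq_zero hcon.1 hcon.2)

variable {D E : X → ℚ} {m n : ℕ} {f g : X → X.functionField}

theorem curveDegree_mul (hc : IsModelCurve sX c) (hf : IsLocalSystem D m f)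
    (hg : IsLocalSystem E n g) :
    curveDegree (f * g) c = curveDegree f c + curveDegree g c := by
  by_cases hcl : IsClosed ({c} : Set X)
  · rw [curveDegree_of_isClosed hcl (mul_ne_zero (hf.ne_zero c) (hg.ne_zero c)),
      curveDegree_of_isClosed hcl (hf.ne_zero c), curveDegree_of_isClosed hcl (hg.ne_zero c),
      add_zero]
  let _ := residueFieldAlgebra sX c
  have hA := hc.isCompleteModel hX hcl
  have hfin := finite_nonUnitLocus hX hc.coheight_eq hcl hf
  have hfin' := finite_nonUnitLocus hX hc.coheight_eq hcl hg
  rw [curveDegree, curveDegree, curveDegree,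
    ← finsum_add_distrib (hfin.subset (support_fracOrd_subset hA))
      (hfin'.subset (support_fracOrd_subset hA))]
  refine finsum_congr fun p ↦ ?_
  have h1 := hf.isUnitAt_div_of_specializes hX.normal p.2.2
  have h2 := hg.isUnitAt_div_of_specializes hX.normal p.2.2
  rw [Pi.mul_apply, Pi.mul_apply, mul_div_mul_comm, h1.valueAt_mul h2]
  exact (hA.point p).ordRing.fracOrd_mul h1.valueAt_ne_zero h2.valueAt_ne_zero

/-- Local equations of the zero divisor are units `f p` at `p`. They drop out of the local orders,
and what is left is the degree of the principal divisor of the single function `(f c)⁻¹` restricted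
to the curve. -/
theorem curveDegree_eq_zero (hc : IsModelCurve sX c) (hf : IsLocalSystem 0 m f) :
    curveDegree f c = 0 := by
  by_cases hcl : IsClosed ({c} : Set X)
  · exact curveDegree_of_isClosed hcl (hf.ne_zero c)
  let _ := residueFieldAlgebra sX c
  have hA := hc.isCompleteModel hX hcl
  have hfin := finite_nonUnitLocus hX hc.coheight_eq hcl hf
  have hu : ∀ p, IsUnitAt p (f p) := fun p ↦ by
    have := isUnitAt_div_of_ord_eq hX.normal (hf.ne_zero p) one_ne_zero (p := p)
      fun z hz h ↦ by
        rw [ord_one]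
        have h1 := hf.ord_eq p z hz h
        rw [Pi.zero_apply, mul_zero] at h1
        exact_mod_cast h1
    rwa [div_one] at this
  have hval : ∀ p : {p : X // IsClosed ({p} : Set X) ∧ c ⤳ p},
      valueAt c (f p.1 / f c) = valueAt c (f p.1) * valueAt c (f c)⁻¹ := fun p ↦ by
    rw [div_eq_mul_inv, ((hu p).specializes p.2.2).valueAt_mul (hu c).inv]
  have hw0 := (hu c).inv.valueAt_ne_zero
  rw [← hA.finsum_const (hc.isCurveField hX) _ hw0]
  · refine finsum_congr fun p ↦ ?_
    have h1 := (hu p).specializes p.2.2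
    rw [hval]
    refine ((hA.point p).ordRing.fracOrd_mul h1.valueAt_ne_zero hw0).trans ?_
    rw [(hA.point p).ordRing.fracOrd_eq_zero ((hu p).valueAt_mem p.2.2)
      ((hu p).valueAt_inv_mem p.2.2), zero_add]
  · refine hfin.subset fun p hp hcon ↦ hp ?_
    have h1 := (hu p).specializes p.2.2
    have h2 : valueAt c (f c)⁻¹ = valueAt c (f p.1 / f c) * (valueAt c (f p.1))⁻¹ := by
      rw [hval, mul_right_comm, mul_inv_cancel₀ h1.valueAt_ne_zero, one_mul]
    have h3 : (valueAt c (f c)⁻¹)⁻¹ = (valueAt c (f p.1 / f c))⁻¹ * valueAt c (f p.1) := by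
      rw [h2, mul_inv, inv_inv]
    constructor
    · rw [h2]
      exact mul_mem hcon.1 ((hu p).valueAt_inv_mem p.2.2)
    · rw [h3]
      exact mul_mem hcon.2 ((hu p).valueAt_mem p.2.2)

/-- The quotient of two systems for the same divisor is a system for the zero divisor. -/
theorem curveDegree_congr (hc : IsModelCurve sX c) (hf : IsLocalSystem D m f)
    (hg : IsLocalSystem D m g) : curveDegree f c = curveDegree g c := by
  have h1 := curveDegree_mul hX hc hg (hf.div hg)
  have h2 : g * (f / g) = f := by
    ext x
    exact mul_div_cancel₀ _ (hg.ne_zero x)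
  rw [h2, curveDegree_eq_zero hX hc (hf.div hg), add_zero] at h1
  exact h1

theorem curveDegree_zpow (hc : IsModelCurve sX c) (hf : IsLocalSystem D m f) (a : ℤ) :
    curveDegree (f ^ a) c = a * curveDegree f c := by
  have hz : ∀ a : ℤ, IsLocalSystem ((a : ℚ) • D) (m * 1) (f ^ a) := fun a ↦
    hf.zpow (by simp)
  have hone : ∀ x, f x ≠ 0 := hf.ne_zero
  have hadd : ∀ a b : ℤ, curveDegree (f ^ (a + b)) c = curveDegree (f ^ a) c +
      curveDegree (f ^ b) c := fun a b ↦ by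
    rw [← curveDegree_mul hX hc (hz a) (hz b)]
    congr 1
    ext x
    exact zpow_add₀ (hone x) a b
  let φ : ℤ →+ ℤ := AddMonoidHom.mk' (fun a ↦ curveDegree (f ^ a) c) hadd
  have h1 : φ a = a • φ 1 := by
    rw [← map_zsmul, smul_eq_mul, mul_one]
  have h2 : φ 1 = curveDegree f c := by
    change curveDegree (f ^ (1 : ℤ)) c = _
    rw [zpow_one]
  rw [h2] at h1
  exact h1

omit hX in
/-- The degree of the divisor `D` on the curve `c` is `r`. -/
def HasDegree (D : X → ℚ) (c : X) (r : ℚ) : Prop :=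
  ∃ (m : ℕ) (f : X → X.functionField), 0 < m ∧ IsLocalSystem D m f ∧ r = curveDegree f c / m

/-- Both systems are raised to the common multiple `m n`. Hence the arbitrary choices in `inter` do
not matter. -/
theorem HasDegree.eq {r s : ℚ} (hc : IsModelCurve sX c) (hr : HasDegree D c r)
    (hs : HasDegree D c s) : r = s := by
  obtain ⟨m, f, hm, hf, rfl⟩ := hr
  obtain ⟨n, g, hn, hg, rfl⟩ := hs
  have h1 : IsLocalSystem D (m * n) (f ^ (n : ℤ)) := by
    simpa using hf.zpow (q := 1) (a := n) (b := n) (by simp)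
  have h2 : IsLocalSystem D (m * n) (g ^ (m : ℤ)) := by
    simpa [mul_comm n m] using hg.zpow (q := 1) (a := m) (b := m) (by simp)
  have h3 := curveDegree_congr hX hc h1 h2
  rw [curveDegree_zpow hX hc hf, curveDegree_zpow hX hc hg] at h3
  rw [div_eq_div_iff (by positivity) (by positivity)]
  have h4 : ((n : ℤ) * curveDegree f c : ℚ) = (m : ℤ) * curveDegree g c := by exact_mod_cast h3
  push_cast at h4
  linarith

theorem HasDegree.smul {r : ℚ} (hc : IsModelCurve sX c) (hr : HasDegree D c r) (q : ℚ) :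
    HasDegree (q • D) c (q * r) := by
  obtain ⟨m, f, hm, hf, rfl⟩ := hr
  refine ⟨m * q.den, f ^ q.num, Nat.mul_pos hm q.pos, hf.zpow (Rat.mul_den_eq_num q), ?_⟩
  rw [curveDegree_zpow hX hc hf]
  have h1 : (q.den : ℚ) ≠ 0 := by exact_mod_cast q.den_nz
  have h2 : (m : ℚ) ≠ 0 := by positivity
  rw [Nat.cast_mul, Int.cast_mul, ← Rat.mul_den_eq_num q]
  field_simp

theorem HasDegree.add {r s : ℚ} (hc : IsModelCurve sX c) (hr : HasDegree D c r)
    (hs : HasDegree E c s) : HasDegree (D + E) c (r + s) := by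
  obtain ⟨m, f, hm, hf, rfl⟩ := hr
  obtain ⟨n, g, hn, hg, rfl⟩ := hs
  have h1 : IsLocalSystem D (m * n) (f ^ (n : ℤ)) := by
    simpa using hf.zpow (q := 1) (a := n) (b := n) (by simp)
  have h2 : IsLocalSystem E (m * n) (g ^ (m : ℤ)) := by
    simpa [mul_comm n m] using hg.zpow (q := 1) (a := m) (b := m) (by simp)
  refine ⟨m * n, _, Nat.mul_pos hm hn, h1.mul h2, ?_⟩
  rw [curveDegree_mul hX hc h1 h2, curveDegree_zpow hX hc hf, curveDegree_zpow hX hc hg]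
  push_cast
  field_simp

theorem IsQCartier.exists_isLocalSystem {D : AlgebraicCycle X ℚ} (hD : IsQCartier D) :
    0 < hD.2.choose.1 ∧ IsLocalSystem D hD.2.choose.1 hD.2.choose.2 := by
  have h := hD.2.choose_spec
  have := hX.noetherianSpace
  refine ⟨h.1, ⟨?_, fun x ↦ (h.2 x).1, fun x ↦ (h.2 x).2⟩⟩
  refine (D.locallyFiniteSupport.finite_inter_support_of_isCompact isCompact_univ).subset ?_
  rintro z ⟨-, hz⟩
  exact ⟨trivial, hz⟩

theorem hasDegree_inter {D : AlgebraicCycle X ℚ} (hD : IsQCartier D) (c : X) :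
    HasDegree D c (inter D c) := by
  obtain ⟨h1, h2⟩ := hD.exists_isLocalSystem hX
  exact ⟨_, _, h1, h2, by rw [inter, dif_pos hD]⟩

omit hX in
theorem HasDegree.isQCartier {r : ℚ} {D : AlgebraicCycle X ℚ} (hD : IsWeilDivisor D)
    (h : HasDegree D c r) : IsQCartier D := by
  obtain ⟨m, f, hm, hf, -⟩ := h
  exact ⟨hD, ⟨(m, f), hm, fun x ↦ ⟨hf.ne_zero x, hf.ord_eq x⟩⟩⟩

end Degree

end KltSurface

namespace KltSurface

/-! ### Symmetry of the intersection product -/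

section Symmetry

theorem ringOrd_ringEquiv {R S : Type*} [CommRing R] [CommRing S] (e : R ≃+* S) (x : R) :
    Ring.ord R x = Ring.ord S (e x) := by
  let _ := e.toRingHom.toAlgebra
  have hsurj : Function.Surjective (algebraMap R S) := e.surjective
  rw [Ring.ord, Ring.ord, ← Module.length_eq_of_surjective (M := S ⧸ Ideal.span {e x}) hsurj]
  let e' : R ≃ₐ[R] S := AlgEquiv.ofRingEquiv (f := e) fun r ↦ rfl
  refine LinearEquiv.length_eq (Ideal.quotientEquivAlg _ _ e' ?_).toLinearEquiv
  rw [Ideal.map_span, Set.image_singleton]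
  rfl

theorem ringOrd_range {A K : Type*} [CommRing A] [Field K] (φ : A →+* K) (q : Ideal A)
    (hq : q = RingHom.ker φ) (a : A) :
    Ring.ord (A ⧸ q) (Ideal.Quotient.mk q a) = Ring.ord φ.range ⟨φ a, a, rfl⟩ := by
  subst hq
  exact ringOrd_ringEquiv (RingHom.quotientKerEquivRange φ) _

variable {X : Scheme.{0}} [IsIntegral X] [IsLocallyNoetherian X]

theorem ord_algebraMap {z : X} (hz : coheight z = 1) {a : X.presheaf.stalk z} (ha : a ≠ 0) :
    X.ord (algebraMap _ X.functionField a) z = (Ring.ord (X.presheaf.stalk z) a).toNat := by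
  have : Ring.KrullDimLE 1 (X.presheaf.stalk z) := krullDimLE_of_coheight_le hz.le
  rw [Scheme.ord_eq_iff hz ((map_ne_zero_iff _ (IsFractionRing.injective _ _)).mpr ha),
    Scheme.ordHom, Ring.ordFrac_eq_ord _ ha]
  refine Ring.ordMonoidWithZeroHom_eq_coe _ (mem_nonZeroDivisors_of_ne_zero ha) ?_
  exact (ENat.natCast_toNat (Ring.ord_ne_top (mem_nonZeroDivisors_of_ne_zero ha))).symm

/-- A prime of the stalk is a generization `t` of `p`. If `t ≠ p`, its codimension is at most one,
and not zero because `b` is a non-zero non-unit at `t`; a non-unit has non-zero order there. -/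
theorem isMaximal_or_eq_primeAt (hd : ∀ x : X, coheight x ≤ 2)
    (hn : ∀ x : X, IsIntegrallyClosed (X.presheaf.stalk x)) {p : X} {b : X.presheaf.stalk p}
    (hb : b ≠ 0) (Q : Ideal (X.presheaf.stalk p)) (hQ : Q.IsPrime) (hbQ : b ∈ Q) :
    Q.IsMaximal ∨ ∃ (t : X) (h : t ⤳ p), coheight t = 1 ∧ t ≠ p ∧ Q = primeAt h ∧
      X.ord (algebraMap _ X.functionField b) t ≠ 0 := by
  obtain ⟨t, h, rfl⟩ := exists_eq_primeAt Q hQ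
  rw [isMaximal_primeAt_iff]
  by_cases htp : t = p
  · exact Or.inl htp
  have hbt : ¬ IsUnit ((X.presheaf.stalkSpecializes h).hom b) := hbQ
  have hb0 : (X.presheaf.stalkSpecializes h).hom b ≠ 0 :=
    (map_ne_zero_iff _ (stalkSpecializes_injective h)).mpr hb
  have h0 : coheight t ≠ 0 := by
    intro h0
    obtain rfl := eq_genericPoint_of_coheight_eq_zero h0
    exact hbt ((isUnit_iff_ne_zero (G₀ := X.functionField)).mpr hb0)
  have h1 : coheight t ≤ 1 := by
    have h2 := (coheight_add_one_le (lt_of_specializes h htp)).trans (hd p)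
    rw [← one_add_one_eq_two] at h2
    exact (ENat.add_le_add_iff_right ENat.one_ne_top).mp h2
  have ht : coheight t = 1 := le_antisymm h1 (Order.one_le_iff_ne_zero.mpr h0)
  refine Or.inr ⟨t, h, ht, htp, rfl, fun hord ↦ hbt ?_⟩
  obtain ⟨u, hu⟩ := isUnitAt_div_of_ord_eq hn (p := t)
    ((map_ne_zero_iff (algebraMap _ X.functionField) (IsFractionRing.injective _ _)).mpr hb)
    one_ne_zero fun z hz hzt ↦ by
      rw [ord_one, eq_of_specializes_of_coheight_eq_one hz ht hzt, hord]
  rw [div_one, ← algebraMap_stalkSpecializes h] at hu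
  rw [← IsFractionRing.injective (X.presheaf.stalk t) X.functionField hu]
  exact u.isUnit

/-- The restriction to a curve of a function that is a unit at its generic point. -/
theorem fracOrd_valueAt_eq {sX : X ⟶ Spec (.of ℂ)} (hX : IsNormalSurface sX) {t p : X}
    (ht : coheight t = 1) (h : t ⤳ p) (hne : t ≠ p) (a : X.presheaf.stalk p)
    (hu : IsUnitAt t (algebraMap _ X.functionField a)) :
    a ∉ primeAt h ∧ Ring.ord (X.presheaf.stalk p ⧸ primeAt h) (Ideal.Quotient.mk _ a) ≠ ⊤ ∧
      fracOrd (curveLocalRing t p h) (valueAt t (algebraMap _ X.functionField a)) =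
        (Ring.ord (X.presheaf.stalk p ⧸ primeAt h) (Ideal.Quotient.mk _ a)).toNat := by
  have := hX.locallyOfFiniteType
  let _ := residueFieldAlgebra sX t
  have hord : IsOrdRing (curveLocalRing t p h) :=
    (isCurvePoint_branchAlg (X.residue t).hom Ideal.Quotient.mk_surjective sX (fun _ ↦ rfl)
      hX.coheight_le ht h hne).ordRing
  let φ := (X.residue t).hom.comp (X.presheaf.stalkSpecializes h).hom
  have hker : primeAt h = RingHom.ker φ := by
    ext b
    exact (eq_zero_iff_mem_primeAt (X.residue t).hom Ideal.Quotient.mk_surjective h b).symm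
  have h0 := hu.valueAt_ne_zero
  rw [valueAt_algebraMap_of_specializes h] at h0 ⊢
  have h1 := ringOrd_range φ _ hker a
  refine ⟨fun ha ↦ h0 ?_, ?_, ?_⟩
  · rw [hker] at ha
    exact ha
  · rw [h1]
    exact hord.ord_ne_top _ fun hc ↦ h0 (congrArg Subtype.val hc)
  · rw [h1]
    exact hord.fracOrd_coe ⟨φ a, a, rfl⟩ fun hc ↦ h0 (congrArg Subtype.val hc)

/-- The contribution of `p` to the degree of a divisor with local equation `f` on the curve `t`. -/
noncomputable def localDegree (f : X.functionField) (t p : X) : ℤ :=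
  open Classical in
  if h : t ⤳ p ∧ t ≠ p then fracOrd (curveLocalRing t p h.1) (valueAt t f) else 0

/-- The local statement is `sum_ord_mul_ord_comm` in the stalk at `p`: the components of `g` are the
curves of `T` with multiplicity `n`, and those of `f` are the curves of `S` with multiplicity `m`.
-/
theorem sum_localDegree_comm {sX : X ⟶ Spec (.of ℂ)} (hX : IsNormalSurface sX) {S T : Finset X}
    (hST : Disjoint S T) (hS : ∀ s ∈ S, coheight s = 1) (hT : ∀ t ∈ T, coheight t = 1) {p : X}
    {m n : ℕ} {f g : X.functionField} (hf0 : f ≠ 0) (hg0 : g ≠ 0)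
    (hfS : ∀ s ∈ S, s ⤳ p → X.ord f s = m) (hfS' : ∀ z ∉ S, coheight z = 1 → z ⤳ p → X.ord f z = 0)
    (hgT : ∀ t ∈ T, t ⤳ p → X.ord g t = n)
    (hgT' : ∀ z ∉ T, coheight z = 1 → z ⤳ p → X.ord g z = 0) :
    n * ∑ t ∈ T, localDegree f t p = m * ∑ s ∈ S, localDegree g s p := by
  classical
  obtain ⟨a, rfl⟩ := exists_eq_of_ord_nonneg p hX.normal hf0 fun z hz h ↦ by
    by_cases hzS : z ∈ S
    · rw [hfS z hzS h]
      positivity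
    · rw [hfS' z hzS hz h]
  obtain ⟨b, rfl⟩ := exists_eq_of_ord_nonneg p hX.normal hg0 fun z hz h ↦ by
    by_cases hzS : z ∈ T
    · rw [hgT z hzS h]
      positivity
    · rw [hgT' z hzS hz h]
  have ha0 : a ≠ 0 := fun h ↦ hf0 (by rw [h, map_zero])
  have hb0 : b ≠ 0 := fun h ↦ hg0 (by rw [h, map_zero])
  have hunit : ∀ (S : Finset X) (a : X.presheaf.stalk p), a ≠ 0 →
      (∀ z ∉ S, coheight z = 1 → z ⤳ p → X.ord (algebraMap _ X.functionField a) z = 0) →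
      ∀ t ∉ S, coheight t = 1 → t ⤳ p → IsUnitAt t (algebraMap _ X.functionField a) := by
    intro S a ha0 hS t htS ht htp
    have := isUnitAt_div_of_ord_eq hX.normal (p := t)
      ((map_ne_zero_iff (algebraMap _ X.functionField) (IsFractionRing.injective _ _)).mpr ha0)
      one_ne_zero fun z hz h ↦ by
        rw [ord_one, eq_of_specializes_of_coheight_eq_one hz ht h]
        exact hS t htS ht htp
    rwa [div_one] at this
  let S' := S.filter fun s ↦ s ⤳ p ∧ s ≠ p
  let T' := T.filter fun t ↦ t ⤳ p ∧ t ≠ p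
  have hS' : ∀ s : S', s.1 ∈ S ∧ s.1 ⤳ p ∧ s.1 ≠ p := fun s ↦ Finset.mem_filter.mp s.2
  have hT' : ∀ t : T', t.1 ∈ T ∧ t.1 ⤳ p ∧ t.1 ≠ p := fun t ↦ Finset.mem_filter.mp t.2
  let qS : S' → Ideal (X.presheaf.stalk p) := fun s ↦ primeAt (hS' s).2.1
  let qT : T' → Ideal (X.presheaf.stalk p) := fun t ↦ primeAt (hT' t).2.1
  have hsum : ∀ (S : Finset X) (f : X.functionField), ∑ s ∈ S, localDegree f s p =
      ∑ s : S.filter (fun s ↦ s ⤳ p ∧ s ≠ p), localDegree f s.1 p := by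
    intro S f
    rw [Finset.sum_coe_sort _ fun s ↦ localDegree f s p]
    refine (Finset.sum_filter_of_ne fun s _ hs ↦ ?_).symm
    by_contra hcon
    exact hs (dif_neg hcon)
  have hvS := fun s : S' ↦ fracOrd_valueAt_eq hX (hS _ (hS' s).1) (hS' s).2.1 (hS' s).2.2 b
    (hunit T b hb0 hgT' _ (Finset.disjoint_left.mp hST (hS' s).1) (hS _ (hS' s).1) (hS' s).2.1)
  have hvT := fun t : T' ↦ fracOrd_valueAt_eq hX (hT _ (hT' t).1) (hT' t).2.1 (hT' t).2.2 a
    (hunit S a ha0 hfS' _ (Finset.disjoint_right.mp hST (hT' t).1) (hT _ (hT' t).1) (hT' t).2.1)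
  let _ : ∀ s : S', Algebra (X.presheaf.stalk p) (X.presheaf.stalk s.1) := fun s ↦
    (X.presheaf.stalkSpecializes (hS' s).2.1).hom.toAlgebra
  let _ : ∀ t : T', Algebra (X.presheaf.stalk p) (X.presheaf.stalk t.1) := fun t ↦
    (X.presheaf.stalkSpecializes (hT' t).2.1).hom.toAlgebra
  have : ∀ s : S', IsLocalization.AtPrime (X.presheaf.stalk s.1) (qS s) := fun s ↦
    isLocalization_stalkSpecializes (hS' s).2.1
  have : ∀ t : T', IsLocalization.AtPrime (X.presheaf.stalk t.1) (qT t) := fun t ↦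
    isLocalization_stalkSpecializes (hT' t).2.1
  have hordnat : ∀ (S' S : Finset X) (hp : ∀ s : S', s.1 ⤳ p), (∀ s : S', s.1 ∈ S) →
      (∀ s ∈ S, coheight s = 1) → ∀ a : X.presheaf.stalk p, a ≠ 0 → ∀ m : ℕ,
      (∀ s ∈ S, s ⤳ p → X.ord (algebraMap _ X.functionField a) s = m) → ∀ s : S',
      (Ring.ord (X.presheaf.stalk s.1)
        ((X.presheaf.stalkSpecializes (hp s)).hom a)).toNat = m := by
    intro S' S hp hS' hS a ha m hord s
    have h1 := ord_algebraMap (hS _ (hS' s))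
      ((map_ne_zero_iff _ (stalkSpecializes_injective (hp s))).mpr ha)
    rw [algebraMap_stalkSpecializes, hord _ (hS' s) (hp s)] at h1
    exact_mod_cast h1.symm
  have hpS : ∀ s : S', (qS s).IsPrime := fun s ↦ by infer_instance
  have hpT : ∀ s : T', (qT s).IsPrime := fun s ↦ by infer_instance
  have main := sum_ord_mul_ord_comm a b ha0 hb0 qT qS (fun t : T' ↦ X.presheaf.stalk t.1)
    (fun s : S' ↦ X.presheaf.stalk s.1) ?_ ?_ ?_ ?_ (fun t ↦ (hvT t).1) (fun t ↦ (hvT t).2.1)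
    (fun s ↦ (hvS s).1) (fun s ↦ (hvS s).2.1) ?_ ?_
  · have hm : ∀ s : S', (Ring.ord (X.presheaf.stalk s.1)
        (algebraMap (X.presheaf.stalk p) (X.presheaf.stalk s.1) a)).toNat = m := fun s ↦
      hordnat S' S (fun s ↦ (hS' s).2.1) (fun s ↦ (hS' s).1) hS a ha0 m hfS s
    have hn : ∀ s : T', (Ring.ord (X.presheaf.stalk s.1)
        (algebraMap (X.presheaf.stalk p) (X.presheaf.stalk s.1) b)).toNat = n := fun s ↦
      hordnat T' T (fun s ↦ (hT' s).2.1) (fun s ↦ (hT' s).1) hT b hb0 n hgT s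
    simp only [hm, hn, ← Finset.mul_sum] at main
    rw [hsum, hsum]
    have e1 : ∀ t : T', localDegree (algebraMap _ X.functionField a) t.1 p =
        (Ring.ord (X.presheaf.stalk p ⧸ qT t) (Ideal.Quotient.mk _ a)).toNat := fun t ↦ by
      rw [localDegree, dif_pos (hT' t).2]
      exact (hvT t).2.2
    have e2 : ∀ t : S', localDegree (algebraMap _ X.functionField b) t.1 p =
        (Ring.ord (X.presheaf.stalk p ⧸ qS t) (Ideal.Quotient.mk _ b)).toNat := fun t ↦ by
      rw [localDegree, dif_pos (hS' t).2]
      exact (hvS t).2.2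
    rw [Finset.sum_congr rfl fun t _ ↦ e1 t, Finset.sum_congr rfl fun t _ ↦ e2 t]
    exact_mod_cast main
  · intro t t' h
    exact Subtype.ext (eq_of_specializes_of_coheight_eq_one (hT _ (hT' t).1) (hT _ (hT' t').1)
      ((primeAt_le_iff _ _).mp h))
  · exact fun t h ↦ (hT' t).2.2 ((isMaximal_primeAt_iff _).mp h)
  · intro t t' h
    exact Subtype.ext (eq_of_specializes_of_coheight_eq_one (hS _ (hS' t).1) (hS _ (hS' t').1)
      ((primeAt_le_iff _ _).mp h))
  · exact fun t h ↦ (hS' t).2.2 ((isMaximal_primeAt_iff _).mp h)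
  · intro Q hQ haQ
    refine (isMaximal_or_eq_primeAt hX.coheight_le hX.normal ha0 Q hQ haQ).imp_right ?_
    rintro ⟨t, h, ht, htp, rfl, hord⟩
    have htS : t ∈ S := by
      by_contra htS
      exact hord (hfS' t htS ht h)
    exact ⟨⟨t, Finset.mem_filter.mpr ⟨htS, h, htp⟩⟩, rfl⟩
  · intro Q hQ haQ
    refine (isMaximal_or_eq_primeAt hX.coheight_le hX.normal hb0 Q hQ haQ).imp_right ?_
    rintro ⟨t, h, ht, htp, rfl, hord⟩
    have htS : t ∈ T := by
      by_contra htS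
      exact hord (hgT' t htS ht h)
    exact ⟨⟨t, Finset.mem_filter.mpr ⟨htS, h, htp⟩⟩, rfl⟩

omit [IsLocallyNoetherian X] in
/-- The degree on a curve `c` in terms of local equations which are trivial at `c`. -/
theorem curveDegree_eq_finsum_localDegree {f : X → X.functionField} {c : X} (hfc : f c = 1) :
    curveDegree f c = ∑ᶠ p ∈ {p : X | IsClosed ({p} : Set X)}, localDegree (f p) c p := by
  classical
  have h1 : ∀ p : {p : X // IsClosed ({p} : Set X) ∧ c ⤳ p},
      fracOrd (curveLocalRing c p.1 p.2.2) (valueAt c (f p.1 / f c)) =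
        localDegree (f p.1) c p.1 := by
    rintro ⟨p, hp, h⟩
    rw [hfc, div_one, localDegree]
    split_ifs with h2
    · rfl
    · have hcp : c = p := by
        by_contra hne
        exact h2 ⟨h, hne⟩
      subst hcp
      rw [hfc, valueAt_one, fracOrd_one]
  rw [curveDegree, finsum_congr h1, ← finsum_mem_range Subtype.val_injective
    (f := fun p ↦ localDegree (f p) c p)]
  refine finsum_mem_inter_support_eq _ _ _ ?_
  ext p
  constructor
  · rintro ⟨⟨q, rfl⟩, hq⟩
    exact ⟨q.2.1, hq⟩
  · rintro ⟨hp, hp'⟩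
    refine ⟨⟨⟨p, hp, ?_⟩, rfl⟩, hp'⟩
    by_contra hcon
    exact hp' (dif_neg fun h' ↦ hcon h'.1)

/-- The indicator function of a finite set of prime divisors. -/
noncomputable def indicatorDivisor (S : Finset X) : X → ℚ :=
  open Classical in
  fun x ↦ if x ∈ S then 1 else 0

/-- Only one prime divisor passes through the generic point `t`, namely `t` itself, so if it does
not occur in `D` the equation at `t` may be taken to be `1`. The degree on `t` then needs no
denominators. -/
theorem IsLocalSystem.update {D : X → ℚ} {m : ℕ} {f : X → X.functionField}
    (hf : IsLocalSystem D m f) (T : Finset X) (hT : ∀ t ∈ T, coheight t = 1)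
    (hDT : ∀ t ∈ T, D t = 0) :
    IsLocalSystem D m (open Classical in fun x ↦ if x ∈ T then 1 else f x) := by
  refine ⟨hf.finite, fun x ↦ ?_, fun x z hz h ↦ ?_⟩
  · split_ifs
    exacts [one_ne_zero, hf.ne_zero x]
  · split_ifs with hx
    · obtain rfl := eq_of_specializes_of_coheight_eq_one hz (hT x hx) h
      rw [ord_one, hDT z hx]
      simp
    · exact hf.ord_eq x z hz h

theorem finite_support_localDegree {sX : X ⟶ Spec (.of ℂ)} (hX : IsNormalSurface sX) {D : X → ℚ}
    {m : ℕ} {f : X → X.functionField} (hf : IsLocalSystem D m f) {c : X} (hc : coheight c = 1)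
    (hfc : f c = 1) :
    ({p : X | IsClosed ({p} : Set X)} ∩ Function.support fun p ↦ localDegree (f p) c p).Finite := by
  have := hX.locallyOfFiniteType
  by_cases hcl : IsClosed ({c} : Set X)
  · refine Set.Finite.subset Set.finite_empty ?_
    rintro p ⟨-, hp⟩
    refine hp (dif_neg fun h ↦ h.2 ?_)
    have : p ∈ closure {c} := h.1.mem_closure
    rw [hcl.closure_eq] at this
    exact this.symm
  let _ := residueFieldAlgebra sX c
  refine ((finite_nonUnitLocus hX hc hcl hf).image Subtype.val).subset ?_
  rintro p ⟨hpc, hp⟩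
  have hcp : c ⤳ p ∧ c ≠ p := by
    by_contra hcon
    exact hp (dif_neg hcon)
  refine ⟨⟨p, hpc, hcp.1⟩, fun hcon ↦ hp ?_, rfl⟩
  refine (dif_pos hcp).trans ?_
  simp only [hfc, div_one] at hcon
  exact (isCurvePoint_branchAlg (X.residue c).hom Ideal.Quotient.mk_surjective sX (fun _ ↦ rfl)
      hX.coheight_le hc hcp.1 hcp.2).ordRing.fracOrd_eq_zero hcon.1 hcon.2

/-- Symmetry of the intersection product of reduced divisors without common components. -/
theorem sum_curveDegree_comm {sX : X ⟶ Spec (.of ℂ)} (hX : IsNormalSurface sX) {S T : Finset X}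
    (hST : Disjoint S T) (hS : ∀ s ∈ S, IsModelCurve sX s) (hT : ∀ t ∈ T, IsModelCurve sX t)
    {m n : ℕ} {f g : X → X.functionField} (hf : IsLocalSystem (indicatorDivisor S) m f)
    (hg : IsLocalSystem (indicatorDivisor T) n g) :
    n * ∑ t ∈ T, curveDegree f t = m * ∑ s ∈ S, curveDegree g s := by
  classical
  -- Normalized so that each degree is a sum over closed points of the restriction of `f' p` or `g'
  -- p`, the same function for all curves through `p`.
  let f' : X → X.functionField := fun x ↦ if x ∈ T then 1 else f x
  let g' : X → X.functionField := fun x ↦ if x ∈ S then 1 else g x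
  have hT' : ∀ t ∈ T, coheight t = 1 := fun t ht ↦ (hT t ht).coheight_eq
  have hS' : ∀ t ∈ S, coheight t = 1 := fun t ht ↦ (hS t ht).coheight_eq
  have hf' : IsLocalSystem (indicatorDivisor S) m f' := by
    convert hf.update T hT' fun t ht ↦ if_neg (Finset.disjoint_right.mp hST ht)
  have hg' : IsLocalSystem (indicatorDivisor T) n g' := by
    convert hg.update S hS' fun t ht ↦ if_neg (Finset.disjoint_left.mp hST ht)
  have hf1 : ∀ t ∈ T, f' t = 1 := fun t ht ↦ if_pos ht
  have hg1 : ∀ t ∈ S, g' t = 1 := fun t ht ↦ if_pos ht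
  rw [Finset.sum_congr rfl fun t ht ↦ (curveDegree_congr hX (hT t ht) hf hf').trans
      (curveDegree_eq_finsum_localDegree (hf1 t ht)),
    Finset.sum_congr rfl fun t ht ↦ (curveDegree_congr hX (hS t ht) hg hg').trans
      (curveDegree_eq_finsum_localDegree (hg1 t ht))]
  simp only [finsum_mem_def]
  -- Summing over the points last reduces the claim to the symmetry at each single point.
  rw [← finsum_sum_comm, ← finsum_sum_comm, mul_finsum, mul_finsum]
  · refine finsum_congr fun p ↦ ?_
    by_cases hp : IsClosed ({p} : Set X)
    · simp only [Set.indicator_of_mem (show p ∈ {p : X | IsClosed ({p} : Set X)} from hp)]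
      have hval : ∀ (S : Finset X) (m : ℕ) (f : X → X.functionField),
          IsLocalSystem (indicatorDivisor S) m f → (∀ s ∈ S, coheight s = 1) →
          (∀ s ∈ S, s ⤳ p → X.ord (f p) s = m) ∧
          (∀ z ∉ S, coheight z = 1 → z ⤳ p → X.ord (f p) z = 0) := by
        intro S m f hf hS
        refine ⟨fun s hs h ↦ ?_, fun z hz hz' h ↦ ?_⟩
        · have := hf.ord_eq p s (hS s hs) h
          rw [indicatorDivisor, if_pos hs, mul_one] at this
          exact_mod_cast this
        · have := hf.ord_eq p z hz' h
          rw [indicatorDivisor, if_neg hz, mul_zero] at this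
          exact_mod_cast this
      exact sum_localDegree_comm hX hST hS' hT' (hf'.ne_zero p) (hg'.ne_zero p)
        (hval S m f' hf' hS').1 (hval S m f' hf' hS').2 (hval T n g' hg' hT').1
        (hval T n g' hg' hT').2
    · simp only [Set.indicator_of_notMem (show p ∉ {p : X | IsClosed ({p} : Set X)} from hp),
        Finset.sum_const_zero, mul_zero]
  · intro s hs
    rw [Function.HasFiniteSupport, Set.support_indicator]
    exact finite_support_localDegree hX hg' (hS' s hs) (hg1 s hs)
  · intro t ht
    rw [Function.HasFiniteSupport, Set.support_indicator]
    exact finite_support_localDegree hX hf' (hT' t ht) (hf1 t ht)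

end Symmetry

end KltSurface

namespace KltSurface

/-! ### Proper birational morphisms in codimension one -/

section Birational

variable {X Y : Scheme.{0}} [IsIntegral X] [IsIntegral Y] (ε : X ⟶ Y)
  (h : ε (genericPoint X) = genericPoint Y)

theorem pullbackFun_algebraMap (x : X) (b : Y.presheaf.stalk (ε x)) :
    pullbackFun ε h (algebraMap _ Y.functionField b) =
      algebraMap _ X.functionField ((ε.stalkMap x).hom b) := by
  have hx : genericPoint X ⤳ x := genericPoint_specializes x
  have h1 := Scheme.Hom.stalkSpecializes_stalkMap ε (genericPoint X) x hx
  have h2 := Y.presheaf.stalkSpecializes_comp (specializes_of_eq h)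
    (genericPoint_specializes (ε x))
  refine Eq.trans ?_ (congrArg (fun φ ↦ φ.hom b) h1)
  exact congrArg (fun φ ↦ (ε.stalkMap (genericPoint X)).hom (φ.hom b)) h2

include h in
theorem stalkMap_injective (x : X) : Function.Injective (ε.stalkMap x).hom := by
  intro a b hab
  have h1 : pullbackFun ε h (algebraMap _ Y.functionField a) =
      pullbackFun ε h (algebraMap _ Y.functionField b) := by
    rw [pullbackFun_algebraMap, pullbackFun_algebraMap, hab]
  exact IsFractionRing.injective (Y.presheaf.stalk (ε x)) Y.functionField
    ((KltSurface.pullbackFun ε h).injective h1)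


variable [IsLocallyNoetherian X] [IsLocallyNoetherian Y]
  {sX : X ⟶ Spec (.of ℂ)} {sY : Y ⟶ Spec (.of ℂ)} (hX : IsNormalSurface sX)
  (hY : IsNormalSurface sY) (hb : Function.Bijective (pullbackFun ε h))

omit h [IsIntegral X] [IsIntegral Y] [IsLocallyNoetherian X] [IsLocallyNoetherian Y] in
theorem isClosed_image_of_isClosed [IsProper ε] {x : X} (hx : IsClosed ({x} : Set X)) :
    IsClosed ({ε x} : Set Y) := by
  have := ε.isClosedMap _ hx
  rwa [Set.image_singleton] at this

-- The image is not closed, so its codimension is at most one. If it were the generic point of `Y`,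
-- the stalk at `c` would contain the whole function field, and non-zero elements of its maximal
-- ideal would be units.
include hY hb in
omit [IsLocallyNoetherian X] in
theorem coheight_map_eq_one {c : X} (hc : coheight c = 1) (hcl : ¬ IsClosed ({ε c} : Set Y)) :
    coheight (ε c) = 1 := by
  refine le_antisymm ?_ (Order.one_le_iff_ne_zero.mpr fun h0 ↦ ?_)
  · have h1 : ∃ y, ε c ⤳ y ∧ ε c ≠ y := by
      by_contra hcon
      push Not at hcon
      refine hcl (closure_eq_iff_isClosed.mp (subset_antisymm (fun y hy ↦ ?_) subset_closure))
      exact (hcon y (specializes_iff_mem_closure.mpr hy)).symm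
    obtain ⟨y, hy, hne⟩ := h1
    have h2 := (coheight_add_one_le (lt_of_specializes hy hne)).trans (hY.coheight_le y)
    rw [← one_add_one_eq_two] at h2
    exact (ENat.add_le_add_iff_right ENat.one_ne_top).mp h2
  · have h1 := eq_genericPoint_of_coheight_eq_zero h0
    have hne : genericPoint X ≠ c := by
      rintro rfl
      rw [coheight_genericPoint] at hc
      exact zero_ne_one hc
    have h2 : ¬ IsLocalRing.maximalIdeal (X.presheaf.stalk c) ≤
        primeAt (genericPoint_specializes c) := by
      rw [← primeAt_self, primeAt_le_iff]
      exact fun h' ↦ hne ((genericPoint_specializes c).antisymm h').eq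
    obtain ⟨a, ha, ha'⟩ := SetLike.not_le_iff_exists.mp h2
    have ha0 : a ≠ 0 := fun h ↦ ha' (h ▸ zero_mem _)
    obtain ⟨f, hf⟩ := hb.2 (algebraMap _ X.functionField a)
    have hsurj : ∃ b : Y.presheaf.stalk (ε c), algebraMap _ Y.functionField b = f := by
      have h3 : ε c ⤳ genericPoint Y := specializes_of_eq h1
      exact ⟨(Y.presheaf.stalkSpecializes h3).hom f, by
        refine (algebraMap_stalkSpecializes (X := Y) h3 f).trans ?_
        have := Y.presheaf.stalkSpecializes_refl (genericPoint Y)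
        exact congrArg (fun φ ↦ φ.hom f) this⟩
    obtain ⟨b, rfl⟩ := hsurj
    rw [pullbackFun_algebraMap] at hf
    have h4 := IsFractionRing.injective (X.presheaf.stalk c) X.functionField hf
    have hb0 : b ≠ 0 := fun h ↦ ha0 (by rw [← h4, h, map_zero])
    have h5 : IsUnit b := by
      by_contra h5
      have h6 : b ∈ primeAt (specializes_refl (ε c)) := by
        rw [primeAt_self]
        exact h5
      have h7 := (primeAt_le_iff (specializes_refl (ε c)) (genericPoint_specializes (ε c))).mpr
        (specializes_of_eq h1) h6
      have h8 : ¬ IsUnit ((Y.presheaf.stalkSpecializes (genericPoint_specializes (ε c))).hom b) :=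
        h7
      refine h8 ((isUnit_iff_ne_zero (G₀ := Y.functionField)).mpr ?_)
      exact (map_ne_zero_iff _ (stalkSpecializes_injective _)).mpr hb0
    have h9 : IsUnit a := by
      rw [← h4]
      exact h5.map (ε.stalkMap c).hom
    exact ha h9

-- The stalk at `ε c` is a discrete valuation ring dominated by the stalk at `c` inside the same
-- field, and valuation rings are maximal for domination.
include h hY hb in
omit [IsLocallyNoetherian X] in
theorem stalkMap_surjective_of_not_isClosed {c : X} (hc : coheight c = 1)
    (hcl : ¬ IsClosed ({ε c} : Set Y)) : Function.Surjective (ε.stalkMap c).hom := by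
  intro b
  have hdvr := isDiscreteValuationRing_stalk (ε c) (hY.normal _)
    (coheight_map_eq_one ε h hY hb hc hcl)
  obtain ⟨f, hf⟩ := hb.2 (algebraMap _ X.functionField b)
  suffices ∃ a : Y.presheaf.stalk (ε c), algebraMap _ Y.functionField a = f by
    obtain ⟨a, rfl⟩ := this
    rw [pullbackFun_algebraMap] at hf
    exact ⟨a, IsFractionRing.injective (X.presheaf.stalk c) X.functionField hf⟩
  rcases ValuationRing.isInteger_or_isInteger (Y.presheaf.stalk (ε c)) f with ⟨a, ha⟩ | ⟨a, ha⟩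
  · exact ⟨a, ha⟩
  · by_cases hf0 : f = 0
    · exact ⟨0, by rw [hf0, map_zero]⟩
    have h1 : (ε.stalkMap c).hom a * b = 1 := by
      apply IsFractionRing.injective (X.presheaf.stalk c) X.functionField
      rw [map_mul, ← pullbackFun_algebraMap ε h, ha, ← hf, ← map_mul, inv_mul_cancel₀ hf0, map_one,
        map_one]
    have h2 : IsUnit a := isUnit_of_map_unit (ε.stalkMap c).hom a (IsUnit.of_mul_eq_one _ h1)
    obtain ⟨u, rfl⟩ := h2
    refine ⟨↑u⁻¹, ?_⟩
    have h3 : algebraMap _ Y.functionField (u : Y.presheaf.stalk (ε c)) *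
        algebraMap _ Y.functionField ((u⁻¹ : (Y.presheaf.stalk (ε c))ˣ) :
          Y.presheaf.stalk (ε c)) = 1 := by
      rw [← map_mul, u.mul_inv, map_one]
    rw [eq_inv_of_mul_eq_one_right h3, ha, inv_inv]

include hY hb in
theorem ord_pullbackFun {c : X} (hc : coheight c = 1) (hcl : ¬ IsClosed ({ε c} : Set Y))
    {f : Y.functionField} (hf : f ≠ 0) : X.ord (pullbackFun ε h f) c = Y.ord f (ε c) := by
  have hy := coheight_map_eq_one ε h hY hb hc hcl
  let e := RingEquiv.ofBijective (ε.stalkMap c).hom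
    ⟨stalkMap_injective ε h c, stalkMap_surjective_of_not_isClosed ε h hY hb hc hcl⟩
  have key : ∀ b : Y.presheaf.stalk (ε c), b ≠ 0 →
      X.ord (pullbackFun ε h (algebraMap _ Y.functionField b)) c =
        Y.ord (algebraMap _ Y.functionField b) (ε c) := by
    intro b hb0
    rw [pullbackFun_algebraMap, ord_algebraMap hc
      ((map_ne_zero_iff _ (stalkMap_injective ε h c)).mpr hb0), ord_algebraMap hy hb0]
    exact congrArg (fun n : ℕ∞ ↦ (n.toNat : ℤ)) (ringOrd_ringEquiv e b).symm
  obtain ⟨a, b, hb0, rfl⟩ := IsFractionRing.div_surjective (A := Y.presheaf.stalk (ε c)) f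
  have hb1 := nonZeroDivisors.ne_zero hb0
  have ha1 : a ≠ 0 := by
    rintro rfl
    exact hf (by rw [map_zero, zero_div])
  have hinj := IsFractionRing.injective (Y.presheaf.stalk (ε c)) Y.functionField
  have ha2 := (map_ne_zero_iff _ hinj).mpr ha1
  have hb2 := (map_ne_zero_iff _ hinj).mpr hb1
  rw [div_eq_mul_inv, map_mul, map_inv₀, Scheme.ord_mul (by simpa using ha2) (by simpa using hb2),
    Scheme.ord_mul ha2 (inv_ne_zero hb2), ord_inv _ (by simpa using hb2), ord_inv _ hb2,
    key a ha1, key b hb1]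

-- The stalks at `c` and `c'` are both the stalk of `Y` at the common image. The resulting two
-- morphisms from `Spec` of this valuation ring to `X` agree generically, hence everywhere by
-- separatedness; so `c` specializes to `c'`, and the codimensions agree.
include h hX hY hb in
theorem eq_of_map_eq {c c' : X} (hc : coheight c = 1) (hc' : coheight c' = 1)
    (hcl : ¬ IsClosed ({ε c} : Set Y)) (hcc : ε c' = ε c) : c' = c := by
  have := hX.separated
  have hcl' : ¬ IsClosed ({ε c'} : Set Y) := by rwa [hcc]
  let e := RingEquiv.ofBijective (ε.stalkMap c').hom
    ⟨stalkMap_injective ε h c', stalkMap_surjective_of_not_isClosed ε h hY hb hc' hcl'⟩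
  have hsp : ε c ⤳ ε c' := specializes_of_eq hcc.symm
  let φ : X.presheaf.stalk c' →+* X.presheaf.stalk c := ((ε.stalkMap c).hom.comp
    (Y.presheaf.stalkSpecializes hsp).hom).comp e.symm.toRingHom
  have hφ : ∀ b, algebraMap _ X.functionField (φ b) = algebraMap _ X.functionField b := by
    intro b
    obtain ⟨a, rfl⟩ := e.surjective b
    have h1 : φ (e a) = (ε.stalkMap c).hom ((Y.presheaf.stalkSpecializes hsp).hom a) :=
      congrArg (fun x ↦ (ε.stalkMap c).hom ((Y.presheaf.stalkSpecializes hsp).hom x))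
        (e.symm_apply_apply a)
    rw [h1, ← pullbackFun_algebraMap ε h, algebraMap_stalkSpecializes, pullbackFun_algebraMap]
    rfl
  have hbase : φ.comp (baseMap sX c') = baseMap sX c := by
    ext z
    apply IsFractionRing.injective (X.presheaf.stalk c) X.functionField
    refine (hφ _).trans ?_
    exact (stalkSpecializes_baseMap sX (genericPoint_specializes c') z).trans
      (stalkSpecializes_baseMap sX (genericPoint_specializes c) z).symm
  have hgen : ∀ x : X, Spec.map (CommRingCat.ofHom (algebraMap (X.presheaf.stalk x)
      X.functionField)) ≫ X.fromSpecStalk x = X.fromSpecStalk (genericPoint X) := fun x ↦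
    Scheme.SpecMap_stalkSpecializes_fromSpecStalk (genericPoint_specializes x)
  have hdvr := isDiscreteValuationRing_stalk c (hX.normal _) hc
  have h1 : X.fromSpecStalk c ≫ sX = Spec.map (CommRingCat.ofHom (baseMap sX c)) :=
    fromSpecStalk_comp_base sX c
  have h2 : (Spec.map (CommRingCat.ofHom φ) ≫ X.fromSpecStalk c') ≫ sX =
      Spec.map (CommRingCat.ofHom (baseMap sX c)) := by
    rw [Category.assoc, fromSpecStalk_comp_base, ← Spec.map_comp, ← hbase]
    rfl
  have h3 : Spec.map (CommRingCat.ofHom (algebraMap (X.presheaf.stalk c) X.functionField)) ≫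
      Spec.map (CommRingCat.ofHom φ) ≫ X.fromSpecStalk c' =
        X.fromSpecStalk (genericPoint X) := by
    have h4 : CommRingCat.ofHom φ ≫
        CommRingCat.ofHom (algebraMap (X.presheaf.stalk c) X.functionField) =
        CommRingCat.ofHom (algebraMap (X.presheaf.stalk c') X.functionField) := by
      ext b
      exact hφ b
    rw [← hgen c', ← Spec.map_comp_assoc, h4]
  let S : ValuativeCommSq sX :=
    { R := X.presheaf.stalk c, K := X.functionField, i₁ := X.fromSpecStalk (genericPoint X), i₂ := _
      commSq := ⟨(congrArg (· ≫ sX) (hgen c)).symm.trans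
        ((Category.assoc _ _ _).trans (congrArg (_ ≫ ·) h1))⟩ }
  have hS := IsSeparated.valuativeCriterion sX S
  let l₁ : S.commSq.LiftStruct := ⟨_, hgen c, h1⟩
  let l₂ : S.commSq.LiftStruct := ⟨_, h3, h2⟩
  have h5 : X.fromSpecStalk c (IsLocalRing.closedPoint _) =
      X.fromSpecStalk c' (Spec.map (CommRingCat.ofHom φ) (IsLocalRing.closedPoint _)) :=
    congrArg (fun l : S.commSq.LiftStruct ↦ l.l (IsLocalRing.closedPoint (X.presheaf.stalk c)))
      (Subsingleton.elim l₁ l₂)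
  rw [Scheme.fromSpecStalk_closedPoint] at h5
  have h6 : c ∈ Set.range (X.fromSpecStalk c') := ⟨_, h5.symm⟩
  rw [Scheme.range_fromSpecStalk] at h6
  exact (eq_of_specializes_of_coheight_eq_one hc hc' h6).symm

include h hY hb in
omit [IsLocallyNoetherian X] in
theorem residueDegree_eq_one {c : X} (hc : coheight c = 1) (hcl : ¬ IsClosed ({ε c} : Set Y)) :
    ε.residueDegree c = 1 := by
  let _ := (ε.residueFieldMap c).hom.toAlgebra
  have hsurj : Function.Surjective (ε.residueFieldMap c).hom := by
    intro y
    obtain ⟨b, rfl⟩ := X.residue_surjective _ y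
    obtain ⟨a, rfl⟩ := stalkMap_surjective_of_not_isClosed ε h hY hb hc hcl b
    exact ⟨Y.residue _ a, congrArg (fun φ ↦ φ.hom a) (Scheme.residue_residueFieldMap ε c)⟩
  have e : Y.residueField (ε c) ≃ₗ[Y.residueField (ε c)] X.residueField c :=
    LinearEquiv.ofBijective (Algebra.linearMap _ _)
      ⟨(ε.residueFieldMap c).hom.injective, hsurj⟩
  rw [Scheme.Hom.residueDegree, ← e.finrank_eq]
  exact CommSemiring.finrank_self _

-- `c` is the only point contributing to the coefficient at `ε c`, and the residue field extension
-- has degree one.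
include h hX hY hb in
theorem pushforward_apply [IsProper ε] {D : AlgebraicCycle X ℚ} {c : X} (hc : coheight c = 1)
    (hcl : ¬ IsClosed ({ε c} : Set Y)) : pushforward ε D (ε c) = D c := by
  have hy := coheight_map_eq_one ε h hY hb hc hcl
  rw [pushforward, AlgebraicCycle.map, Function.locallyFinsupp.map_apply,
    finsum_mem_inter_support_eq' _ _ {c}, finsum_mem_singleton]
  · have hw : AlgebraicCycle.mapCoeff ε (fun x : X ↦ coheight x) (fun y : Y ↦ coheight y) c = 1 :=
      (if_pos (hc.trans hy.symm)).trans (residueDegree_eq_one ε h hY hb hc hcl)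
    rw [hw, Nat.cast_one, mul_one]
  intro x hx
  refine ⟨fun hxc ↦ ?_, fun hxc ↦ congrArg ε hxc⟩
  have hxc' : ε x = ε c := hxc
  have hcoh : coheight x = coheight (ε x) := by
    by_contra hne
    have hw : AlgebraicCycle.mapCoeff ε (fun x : X ↦ coheight x) (fun y : Y ↦ coheight y) x = 0 :=
      if_neg hne
    exact hx (by simp only [hw, Nat.cast_zero, mul_zero])
  exact eq_of_map_eq ε h hX hY hb hc (hcoh.trans (hxc' ▸ hy)) hcl hxc'

omit h [IsIntegral X] [IsIntegral Y] [IsLocallyNoetherian X] [IsLocallyNoetherian Y] in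
theorem pushforward_ne_zero [IsProper ε] {D : AlgebraicCycle X ℚ} {y : Y}
    (hy : pushforward ε D y ≠ 0) : ∃ x, ε x = y ∧ D x ≠ 0 ∧ coheight y = coheight x := by
  rw [pushforward, AlgebraicCycle.map, Function.locallyFinsupp.map_apply] at hy
  obtain ⟨x, rfl, hx⟩ := exists_ne_zero_of_finsum_mem_ne_zero hy
  refine ⟨x, rfl, left_ne_zero_of_mul hx, ?_⟩
  by_contra hne
  exact hx (by rw [AlgebraicCycle.mapCoeff, if_neg fun h ↦ hne h.symm, Nat.cast_zero, mul_zero])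

end Birational

end KltSurface

/-! ### The projection formula -/

namespace KltSurface

theorem fracOrd_map {K L : Type*} [Field K] [Field L] (θ : K →+* L) {A : Subring K}
    (hA : IsOrdRing A) {u : K} (hu : u ≠ 0) : fracOrd (A.map θ) (θ u) = fracOrd A u := by
  let e : A ≃+* A.map θ := A.equivMapOfInjective θ θ.injective
  obtain ⟨a, b, ha, hb, h⟩ := hA.exists_eq_div u hu
  have he : ∀ a : A, ((e a : A.map θ) : L) = θ a := fun a ↦ rfl
  have htop : ∀ y : A.map θ, y ≠ 0 → Ring.ord (A.map θ) y ≠ ⊤ := by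
    intro y hy
    obtain ⟨x, rfl⟩ := e.surjective y
    rw [← ringOrd_ringEquiv e]
    exact hA.ord_ne_top x fun hx ↦ hy (by rw [hx, map_zero])
  rw [fracOrd_eq A hA.ord_ne_top u a b ha hb h,
    fracOrd_eq (A.map θ) htop (θ u) (e a) (e b) (by simpa using ha) (by simpa using hb)
      (by rw [he, he, ← map_mul, h]), ← ringOrd_ringEquiv e, ← ringOrd_ringEquiv e]

section Projection

variable {X Y : Scheme.{0}} [IsIntegral X] [IsIntegral Y] [IsLocallyNoetherian X]
  [IsLocallyNoetherian Y] (ε : X ⟶ Y) (h : ε (genericPoint X) = genericPoint Y)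
  {sX : X ⟶ Spec (.of ℂ)} {sY : Y ⟶ Spec (.of ℂ)} (hX : IsNormalSurface sX)
  (hY : IsNormalSurface sY) (hb : Function.Bijective (pullbackFun ε h))

include hX hY hb in
/-- The projection formula for a curve which is not contracted. -/
theorem curveDegree_pullback [IsProper ε] (hε : ε ≫ sY = sX) {c : X} (hc : IsModelCurve sX c)
    (hcl : ¬ IsClosed ({ε c} : Set Y)) {D : Y → ℚ} {D' : X → ℚ} {m : ℕ}
    {f : Y → Y.functionField} (hf : IsLocalSystem D m f)
    (hg : IsLocalSystem D' m fun x ↦ pullbackFun ε h (f (ε x))) :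
    curveDegree (fun x ↦ pullbackFun ε h (f (ε x))) c = curveDegree f (ε c) := by
  have := hX.locallyOfFiniteType
  have := hY.locallyOfFiniteType
  have := hY.separated
  have hc1 := hc.coheight_eq
  have hy := coheight_map_eq_one ε h hY hb hc1 hcl
  have hclX : ¬ IsClosed ({c} : Set X) := fun h' ↦ hcl (isClosed_image_of_isClosed ε h')
  let _ := residueFieldAlgebra sX c
  let _ := residueFieldAlgebra sY (ε c)
  let θ : Y.residueField (ε c) →+* X.residueField c := (ε.residueFieldMap c).hom
  have hθ : ∀ b, θ ((Y.residue (ε c)).hom b) = (X.residue c).hom ((ε.stalkMap c).hom b) := fun b ↦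
    congrArg (fun φ ↦ φ.hom b) (Scheme.residue_residueFieldMap ε c)
  -- The residue fields at `c` and `ε c` agree, so the local rings of the image curve are read
  -- inside `κ(c)`; both curves thus have the same function field and the same places.
  let ψ : Y.presheaf.stalk (ε c) →+* X.residueField c := (X.residue c).hom.comp (ε.stalkMap c).hom
  have hψs : Function.Surjective ψ := (X.residue_surjective c).comp
    (stalkMap_surjective_of_not_isClosed ε h hY hb hc1 hcl)
  have hψ : ∀ z, ψ (baseMap sY (ε c) z) = algebraMap ℂ (X.residueField c) z := fun z ↦
    congrArg (X.residue c).hom (stalkMap_baseMap sX sY ε hε c z)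
  let B : {q : Y // IsClosed ({q} : Set Y) ∧ ε c ⤳ q} → Subalgebra ℂ (X.residueField c) :=
    fun q ↦ branchAlg ψ sY hψ q.2.2
  have hBring : ∀ q, (B q).toSubring = (curveLocalRing (ε c) q.1 q.2.2).map θ := by
    intro q
    ext y
    constructor
    · rintro ⟨a, rfl⟩
      exact ⟨_, ⟨a, rfl⟩, hθ _⟩
    · rintro ⟨_, ⟨a, rfl⟩, rfl⟩
      exact ⟨a, (hθ _).symm⟩
  let π : {p : X // IsClosed ({p} : Set X) ∧ c ⤳ p} → {q : Y // IsClosed ({q} : Set Y) ∧ ε c ⤳ q} :=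
    fun p ↦ ⟨ε p.1, isClosed_image_of_isClosed ε p.2.1, p.2.2.map ε.continuous⟩
  have hu : ∀ q : {q : Y // IsClosed ({q} : Set Y) ∧ ε c ⤳ q}, IsUnitAt (ε c) (f q.1 / f (ε c)) :=
    fun q ↦ hf.isUnitAt_div_of_specializes hY.normal q.2.2
  have hval : ∀ u, IsUnitAt (ε c) u → valueAt c (pullbackFun ε h u) = θ (valueAt (ε c) u) := by
    rintro _ ⟨u, rfl⟩
    rw [pullbackFun_algebraMap, valueAt_algebraMap, valueAt_algebraMap, hθ]
  have hB : ∀ q, IsCurvePoint (B q) := fun q ↦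
    isCurvePoint_branchAlg ψ hψs sY hψ hY.coheight_le hy q.2.2 fun h' ↦ hcl (h' ▸ q.2.1)
  have hord : ∀ q : {q : Y // IsClosed ({q} : Set Y) ∧ ε c ⤳ q},
      IsOrdRing (curveLocalRing (ε c) q.1 q.2.2) := fun q ↦
    (isCurvePoint_branchAlg (Y.residue (ε c)).hom (Y.residue_surjective _) sY (fun _ ↦ rfl)
      hY.coheight_le hy q.2.2 fun h' ↦ hcl (h' ▸ q.2.1)).ordRing
  have hA := hc.isCompleteModel hX hclX
  let H : {q : Y // IsClosed ({q} : Set Y) ∧ ε c ⤳ q} → X.residueField c := fun q ↦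
    θ (valueAt (ε c) (f q.1 / f (ε c)))
  have hHval : ∀ p, valueAt c (pullbackFun ε h (f (ε p.1)) / pullbackFun ε h (f (ε c))) =
      H (π p) := by
    intro p
    rw [← map_div₀]
    exact hval _ (hu (π p))
  have main := hA.finsum_comp hB ?_ π ?_ ?_ H
    (fun q ↦ (map_ne_zero_iff _ θ.injective).mpr (hu q).valueAt_ne_zero) ?_ ?_
  · rw [curveDegree, curveDegree]
    refine (finsum_congr fun p ↦ ?_).trans (main.symm.trans (finsum_congr fun q ↦ ?_))
    · rw [hHval]
      rfl
    · rw [hBring]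
      exact fracOrd_map θ (hord q) (hu q).valueAt_ne_zero
  · intro V hV q q' hq hq'
    exact Subtype.ext (eq_of_branchRing_le ψ hψs sY hY.coheight_le hy hV.1 hq hq')
  · rintro p _ ⟨a, rfl⟩
    refine ⟨(ε.stalkMap p.1).hom a, ?_⟩
    have := Scheme.Hom.stalkSpecializes_stalkMap ε c p.1 p.2.2
    exact congrArg (fun φ ↦ (X.residue c).hom (φ.hom a)) this.symm
  · have h1 : ∃ p, c ⤳ p ∧ c ≠ p := by
      by_contra hcon
      push Not at hcon
      refine hclX (closure_eq_iff_isClosed.mp (subset_antisymm (fun y hy ↦ ?_) subset_closure))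
      exact (hcon y (specializes_iff_mem_closure.mpr hy)).symm
    obtain ⟨p, hp, hne⟩ := h1
    exact ⟨⟨p, isClosed_of_specializes hX.coheight_le hc1 hp hne, hp⟩⟩
  · refine (finite_nonUnitLocus hY hy hcl hf).subset fun q hq hcon ↦ hq ⟨?_, ?_⟩
    · have : H q ∈ (B q).toSubring := by
        rw [hBring]
        exact ⟨_, hcon.1, rfl⟩
      exact this
    · have : (H q)⁻¹ ∈ (B q).toSubring := by
        rw [hBring]
        exact ⟨_, hcon.2, map_inv₀ θ _⟩
      exact this
  · refine (finite_nonUnitLocus hX hc1 hclX hg).subset fun p hp hcon ↦ hp ?_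
    change H (π p) ∈ _ ∧ (H (π p))⁻¹ ∈ _
    rw [← hHval]
    exact hcon

end Projection

/-! ### Vanishing of degrees -/

section Vanishing

variable {X : Scheme.{0}} [IsIntegral X]

theorem curveDegree_eq_zero_of_const {f : X → X.functionField} {c : X} (h0 : f c ≠ 0)
    (h : ∀ p, c ⤳ p → f p = f c) : curveDegree f c = 0 := by
  rw [curveDegree]
  refine (finsum_congr fun p ↦ ?_).trans finsum_zero
  rw [h p.1 p.2.2, div_self h0, valueAt_one, fracOrd_one]

variable [IsLocallyNoetherian X]

/-- No component of `D` meets the curve, so the local equations may be replaced by `1` along it. -/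
theorem hasDegree_zero_of_disjoint {D : X → ℚ} {c : X} {r : ℚ} (hD : HasDegree D c r)
    (h : ∀ z, coheight z = 1 → D z ≠ 0 → Disjoint (closure {z}) (closure {c})) :
    HasDegree D c 0 := by
  classical
  obtain ⟨m, f, hm, hf, -⟩ := hD
  refine ⟨m, fun x ↦ if c ⤳ x then 1 else f x, hm, ⟨hf.finite, fun x ↦ ?_, fun x z hz hzx ↦ ?_⟩, ?_⟩
  · split_ifs
    exacts [one_ne_zero, hf.ne_zero x]
  · split_ifs with hx
    · have : D z = 0 := by
        by_contra hDz
        exact (Set.disjoint_left.mp (h z hz hDz)) (specializes_iff_mem_closure.mp hzx)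
          (specializes_iff_mem_closure.mp hx)
      rw [this, ord_one]
      simp
    · exact hf.ord_eq x z hz hzx
  · rw [curveDegree_eq_zero_of_const]
    · simp
    · rw [if_pos (specializes_refl c)]
      exact one_ne_zero
    · intro p hp
      rw [if_pos hp, if_pos (specializes_refl c)]

end Vanishing

end KltSurface

namespace KltSurface

/-! ### The linear algebra of the chain -/

section Chain

/-- A solution of the linear system given by a negative definite chain is nonnegative at the places
where the right hand side is positive. -/
theorem nonneg_of_chain {k : ℕ} {E a ℓ : ℕ → ℚ} {N : ℕ → ℕ} (hE : E (k + 1) = 0)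
    (h0 : a 0 * E 0 = N 0 + ℓ 0 + E 1)
    (h : ∀ j < k, a (j + 1) * E (j + 1) = N (j + 1) + E j + E (j + 2))
    (ha0 : 1 ≤ a 0) (ha : ∀ j < k, 2 ≤ a (j + 1)) (hℓ : -1 ≤ ℓ 0) (i : ℕ) (hi : i ≤ k)
    (hN : 0 < N i) : 0 ≤ E i := by
  -- Concavity at negative entries: the second difference is `(a - 2) E - N`.
  have hstep : ∀ j < k, E (j + 1) ≤ 0 → E (j + 2) - E (j + 1) ≤ E (j + 1) - E j - N (j + 1) := by
    intro j hj hneg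
    have h1 := h j hj
    have h2 : (a (j + 1) - 2) * E (j + 1) ≤ 0 :=
      mul_nonpos_of_nonneg_of_nonpos (by linarith [ha j hj]) hneg
    linarith
  -- If `E` failed to increase at a negative entry, concavity would keep it decreasing up to index
  -- `k + 1`, where it is zero.
  have hmono : ∀ j ≤ k, E j < 0 → E j < E (j + 1) := by
    intro j hj hneg
    by_contra! hle
    have key : ∀ d, j + d ≤ k → E (j + d + 1) ≤ E (j + d) ∧ E (j + d) < 0 := by
      intro d
      induction d with
      | zero => exact fun _ ↦ ⟨hle, hneg⟩
      | succ d ih =>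
        intro hd
        obtain ⟨h1, h2⟩ := ih (by omega)
        have h3 := hstep (j + d) (by omega) (by linarith)
        have h4 : (0 : ℚ) ≤ N (j + d + 1) := by positivity
        exact ⟨by rw [← add_assoc]; linarith, by rw [← add_assoc]; linarith⟩
    obtain ⟨h1, h2⟩ := key (k - j) (by omega)
    rw [Nat.add_sub_cancel' hj, hE] at h1
    rw [Nat.add_sub_cancel' hj] at h2
    linarith
  -- With `E j ≥ 0`, concavity would make the increment after `j + 1` negative, against `hmono`.
  have hback : ∀ j, j + 1 ≤ k → E (j + 1) < 0 → E j < 0 := by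
    intro j hj hneg
    by_contra! hcon
    have h1 := hstep j hj hneg.le
    have h2 := hmono (j + 1) hj hneg
    have h4 : (0 : ℚ) ≤ N (j + 1) := by positivity
    linarith
  -- The first increment is `(a 0 - 1) E 0 - N 0 - ℓ 0 ≤ 1 - N 0`; later ones only lose further
  -- `N`'s.
  have hincr : ∀ j ≤ k, E j < 0 → E (j + 1) - E j ≤ 1 - N j := by
    intro j
    induction j with
    | zero =>
      intro _ hneg
      have : (a 0 - 1) * E 0 ≤ 0 := mul_nonpos_of_nonneg_of_nonpos (by linarith) hneg.le
      rw [zero_add]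
      linarith
    | succ j ih =>
      intro hj hneg
      have h1 := ih (by omega) (hback j hj hneg)
      have h2 := hstep j hj hneg.le
      have h4 : (0 : ℚ) ≤ N j := by positivity
      rw [add_assoc j 1 1]
      linarith
  -- Integrality enters here: `N i ≥ 1` bounds the increment by `0`, but `hmono` makes it positive.
  by_contra! hneg
  have h1 := hincr i hi hneg
  have h2 := hmono i hi hneg
  have h3 : (1 : ℚ) ≤ N i := by exact_mod_cast hN
  linarith

/-- The matrix is tridiagonal with ones next to the diagonal, so each row of the system is a
three-term recursion. -/
theorem sum_nonneg_of_chain {k : ℕ} {M : Fin (k + 1) → Fin (k + 1) → ℚ} {n : Fin (k + 1) → ℕ}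
    {e ℓ : Fin (k + 1) → ℚ} (hM0 : M 0 0 ≤ -1) (hM : ∀ i : Fin k, M i.succ i.succ ≤ -2)
    (hadj : ∀ i : Fin k, M i.castSucc i.succ = 1) (hsymm : ∀ i j, i ≠ j → M i j = M j i)
    (hdisj : ∀ i j : Fin (k + 1), (i : ℕ) + 1 < j → M i j = 0)
    (hℓ0 : -1 ≤ ℓ 0) (hℓ : ∀ i : Fin k, ℓ i.succ = 0)
    (heq : ∀ j, ℓ j + n j + ∑ i, e i * M i j = 0) : 0 ≤ ∑ i, e i * n i := by
  -- Extension by zero supplies the boundary value `E (k + 1) = 0`.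
  let E : ℕ → ℚ := fun j ↦ if h : j < k + 1 then e ⟨j, h⟩ else 0
  let N : ℕ → ℕ := fun j ↦ if h : j < k + 1 then n ⟨j, h⟩ else 0
  let a : ℕ → ℚ := fun j ↦ if h : j < k + 1 then -M ⟨j, h⟩ ⟨j, h⟩ else 0
  let l : ℕ → ℚ := fun j ↦ if h : j < k + 1 then ℓ ⟨j, h⟩ else 0
  have hMval : ∀ i j : Fin (k + 1), M i j = (if (i : ℕ) = j then M j j else 0) +
      (if (i : ℕ) + 1 = j then 1 else 0) + (if (i : ℕ) = j + 1 then 1 else 0) := by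
    intro i j
    have hadj' : ∀ i j : Fin (k + 1), (i : ℕ) + 1 = j → M i j = 1 := by
      intro i j hij
      have := hadj ⟨i, by omega⟩
      convert this using 2
      · rfl
      · exact Fin.ext hij.symm
    rcases lt_trichotomy (i : ℕ) j with h | h | h
    · rw [if_neg h.ne, if_neg (by omega : ¬ (i : ℕ) = j + 1)]
      split_ifs with h1
      · rw [hadj' i j h1]; ring
      · rw [hdisj i j (by omega)]; ring
    · obtain rfl := Fin.ext h
      simp
    · rw [if_neg h.ne', if_neg (by omega : ¬ (i : ℕ) + 1 = j), hsymm i j (by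
        rintro rfl
        exact lt_irrefl _ h)]
      split_ifs with h1
      · rw [hadj' j i h1.symm]; ring
      · rw [hdisj j i (by omega)]; ring
  have hrow : ∀ j : ℕ, ∀ hj : j < k + 1, a j * E j =
      N j + l j + (if j = 0 then 0 else E (j - 1)) + E (j + 1) := by
    intro j hj
    have h1 := heq ⟨j, hj⟩
    have h2 : ∑ i, e i * M i ⟨j, hj⟩ = ∑ i ∈ Finset.range (k + 1), E i *
        ((if i = j then M ⟨j, hj⟩ ⟨j, hj⟩ else 0) + (if i + 1 = j then 1 else 0) +
          (if i = j + 1 then 1 else 0)) := by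
      rw [← Fin.sum_univ_eq_sum_range (fun i ↦ E i *
        ((if i = j then M ⟨j, hj⟩ ⟨j, hj⟩ else 0) + (if i + 1 = j then 1 else 0) +
          (if i = j + 1 then 1 else 0)))]
      refine Finset.sum_congr rfl fun i _ ↦ ?_
      rw [hMval]
      simp only [E, i.2, dif_pos]
    have h3 : ∑ i ∈ Finset.range (k + 1), E i * (if i + 1 = j then 1 else 0) =
        if j = 0 then 0 else E (j - 1) := by
      rcases j with _ | j
      · simp
      · simp only [Nat.add_right_cancel_iff, mul_ite, mul_one, mul_zero, Finset.sum_ite_eq',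
          Finset.mem_range, Nat.add_one_ne_zero, if_false, Nat.add_sub_cancel]
        rw [if_pos (by omega)]
    have h4 : ∑ i ∈ Finset.range (k + 1), E i * (if i = j + 1 then 1 else 0) = E (j + 1) := by
      simp only [mul_ite, mul_one, mul_zero, Finset.sum_ite_eq', Finset.mem_range]
      split_ifs with h
      · rfl
      · have h' : E (j + 1) = 0 := dif_neg h
        exact h'.symm
    have h5 : ∑ i ∈ Finset.range (k + 1), E i * (if i = j then M ⟨j, hj⟩ ⟨j, hj⟩ else 0) =
        - (a j * E j) := by
      simp only [mul_ite, mul_zero, Finset.sum_ite_eq', Finset.mem_range, if_pos hj, a, dif_pos hj]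
      ring
    simp only [mul_add, Finset.sum_add_distrib, h3, h4, h5] at h2
    rw [h2] at h1
    simp only [N, l, dif_pos hj]
    linarith
  have hfin := nonneg_of_chain (k := k) (E := E) (a := a) (ℓ := l) (N := N) (dif_neg (by omega))
    (by simpa using hrow 0 (by omega)) (fun j hj ↦ by
      have h1 := hrow (j + 1) (by omega)
      have h2 : l (j + 1) = 0 := (dif_pos (by omega : j + 1 < k + 1)).trans (hℓ ⟨j, hj⟩)
      rw [h2, add_zero, if_neg (Nat.succ_ne_zero j), Nat.add_sub_cancel] at h1
      exact h1)
    (le_neg_of_le_neg (show M 0 0 ≤ -1 from hM0))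
    (fun j hj ↦ by
      have h1 := hM ⟨j, hj⟩
      simp only [a, dif_pos (by omega : j + 1 < k + 1)]
      linarith [show M ⟨j + 1, by omega⟩ ⟨j + 1, by omega⟩ ≤ -2 from h1])
    (by simp only [l, Nat.zero_lt_succ, dif_pos]; exact hℓ0)
  refine Finset.sum_nonneg fun i _ ↦ ?_
  -- The sign of `e i` is controlled only where `n i > 0`; the other terms vanish.
  rcases Nat.eq_zero_or_pos (n i) with h | h
  · simp [h]
  · have h1 := hfin i (by omega) (by simpa only [N, i.2, dif_pos] using h)
    simp only [E, i.2, dif_pos] at h1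
    exact mul_nonneg h1 (by positivity)

end Chain

end KltSurface

namespace KltSurface

/-! ### Intersection numbers of reduced divisors -/

section Assembly

variable {X : Scheme.{0}}

theorem coe_reducedDivisor (C : Finset X) :
    ((reducedDivisor C : AlgebraicCycle X ℚ) : X → ℚ) = indicatorDivisor C := by
  classical
  have key : ∀ S : Finset X, ∀ x, (∑ c ∈ S, Function.locallyFinsuppWithin.single c (1 : ℚ) :
      AlgebraicCycle X ℚ) x = if x ∈ S then 1 else 0 := by
    intro S x
    induction S using Finset.induction_on with
    | empty => simp
    | insert a s ha ih =>
      rw [Finset.sum_insert ha, Function.locallyFinsuppWithin.coe_add, Pi.add_apply, ih,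
        Function.locallyFinsuppWithin.single_apply]
      by_cases hxa : x = a
      · subst hxa
        simp [ha]
      · simp [hxa]
  ext x
  rw [reducedDivisor, indicatorDivisor]
  convert key C x

theorem reducedDivisor_apply_mem {C : Finset X} {x : X} (hx : x ∈ C) :
    (reducedDivisor C : AlgebraicCycle X ℚ) x = 1 := by
  rw [coe_reducedDivisor]
  exact if_pos hx

theorem reducedDivisor_apply_notMem {C : Finset X} {x : X} (hx : x ∉ C) :
    (reducedDivisor C : AlgebraicCycle X ℚ) x = 0 := by
  rw [coe_reducedDivisor]
  exact if_neg hx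

theorem isWeilDivisor_reducedDivisor {C : Finset X} (hC : ∀ c ∈ C, coheight c = 1) :
    IsWeilDivisor (reducedDivisor C) := fun x hx ↦ by
  by_contra hcon
  exact hx (reducedDivisor_apply_notMem fun h ↦ hcon (hC x h))

variable [IsIntegral X] [IsLocallyNoetherian X] {sX : X ⟶ Spec (.of ℂ)} (hX : IsNormalSurface sX)

/-- `inter` is `0` by default, so a non-zero intersection number certifies that the divisor is
`ℚ`-Cartier. -/
theorem isQCartier_of_inter_ne_zero {D : AlgebraicCycle X ℚ} {c : X} (h : inter D c ≠ 0) :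
    IsQCartier D := by
  by_contra hD
  exact h (dif_neg hD)

theorem interDivisor_reducedDivisor (D : AlgebraicCycle X ℚ) (C : Finset X) :
    interDivisor D (reducedDivisor C) = ∑ c ∈ C, inter D c := by
  rw [interDivisor, finsum_eq_sum_of_support_subset (s := C)]
  · exact Finset.sum_congr rfl fun c hc ↦ by rw [reducedDivisor_apply_mem hc, one_mul]
  · intro c hc
    by_contra hcon
    exact hc (by simp only [reducedDivisor_apply_notMem hcon, zero_mul])

include hX

theorem HasDegree.sum {c : X} (hc : IsModelCurve sX c) {ι : Type*} (s : Finset ι) {D : ι → X → ℚ}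
    {r : ι → ℚ} (h : ∀ i ∈ s, HasDegree (D i) c (r i)) :
    HasDegree (∑ i ∈ s, D i) c (∑ i ∈ s, r i) := by
  classical
  induction s using Finset.induction_on with
  | empty =>
    rw [Finset.sum_empty, Finset.sum_empty]
    refine ⟨1, fun _ ↦ 1, one_pos, ⟨by simp, fun _ ↦ one_ne_zero, fun x z _ _ ↦ ?_⟩, ?_⟩
    · rw [ord_one]
      simp
    · rw [curveDegree_eq_zero_of_const one_ne_zero fun _ _ ↦ rfl]
      simp
  | insert a s ha ih =>
    rw [Finset.sum_insert ha, Finset.sum_insert ha]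
    exact (h a (Finset.mem_insert_self a s)).add hX hc
      (ih fun i hi ↦ h i (Finset.mem_insert_of_mem hi))

/-- Symmetry of the intersection number of a prime divisor with a reduced divisor. -/
theorem sum_inter_primeDivisor {C : Finset X} (hC : ∀ c ∈ C, IsModelCurve sX c) {s : X}
    (hs : IsModelCurve sX s) (hCQ : IsQCartier (reducedDivisor C))
    (hsQ : IsQCartier (primeDivisor s)) :
    ∑ c ∈ C, inter (primeDivisor s) c = inter (reducedDivisor C) s := by
  classical
  obtain ⟨hm, hf⟩ := hsQ.exists_isLocalSystem hX
  set m := hsQ.2.choose.1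
  set f := hsQ.2.choose.2
  have hval : ∀ c, inter (primeDivisor s) c = curveDegree f c / m := fun c ↦ dif_pos hsQ
  rw [primeDivisor, coe_reducedDivisor] at hf
  have hCs := hasDegree_inter hX hCQ s
  have hss := hasDegree_inter hX hsQ s
  rw [coe_reducedDivisor] at hCs
  rw [primeDivisor, coe_reducedDivisor] at hss
  -- Symmetry needs disjoint supports, so `a` times the prime divisor `s` is split off from `C`; its
  -- contribution, `a` times the self-intersection of `s`, occurs on both sides.
  let a : ℚ := if s ∈ C then 1 else 0
  have hTd := hCs.add hX hs (hss.smul hX hs (-a))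
  have hT : indicatorDivisor C + (-a) • indicatorDivisor {s} = indicatorDivisor (C.erase s) := by
    ext x
    simp only [Pi.add_apply, Pi.smul_apply, smul_eq_mul, indicatorDivisor, Finset.mem_erase,
      Finset.mem_singleton, a]
    by_cases hxs : x = s
    · subst hxs
      by_cases hxC : x ∈ C <;> simp [hxC]
    · by_cases hxC : x ∈ C <;> simp [hxC, hxs]
  rw [hT] at hTd
  obtain ⟨n, g, hn, hg, hgv⟩ := hTd
  have h1 := sum_curveDegree_comm hX (S := {s}) (T := C.erase s)
    (by simp) (by simpa using hs) (fun t ht ↦ hC t (Finset.mem_of_mem_erase ht)) hf hg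
  rw [Finset.sum_singleton] at h1
  have h2 : ∑ c ∈ C.erase s, inter (primeDivisor s) c = curveDegree g s / n := by
    simp only [hval]
    rw [← Finset.sum_div, div_eq_div_iff (by positivity) (by positivity)]
    have h3 : ((n * ∑ t ∈ C.erase s, curveDegree f t : ℤ) : ℚ) =
        ((m * curveDegree g s : ℤ) : ℚ) := by rw [h1]
    push_cast at h3
    linarith
  rw [← hgv] at h2
  by_cases hsC : s ∈ C
  · rw [← Finset.add_sum_erase _ _ hsC, h2]
    simp only [a, if_pos hsC]
    ring
  · rw [Finset.erase_eq_of_notMem hsC] at h2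
    rw [h2]
    simp only [a, if_neg hsC]
    ring

end Assembly

end KltSurface

namespace KltSurface

/-! ### Pull-back and push-forward of divisors -/

section Pullback

variable {X Y : Scheme.{0}} [IsIntegral X] [IsIntegral Y] [IsLocallyNoetherian X]
  [IsLocallyNoetherian Y] (ε : X ⟶ Y) (h : ε (genericPoint X) = genericPoint Y)
  {sX : X ⟶ Spec (.of ℂ)} {sY : Y ⟶ Spec (.of ℂ)} (hX : IsNormalSurface sX)
  (hY : IsNormalSurface sY) (hb : Function.Bijective (pullbackFun ε h))

include hY hb

/-- The pull-back of a `ℚ`-Cartier divisor. -/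
theorem isLocalSystem_pullbackFun {D : Y → ℚ} {m : ℕ} (hm : 0 < m) {f : Y → Y.functionField}
    (hf : IsLocalSystem D m f) {D' : X → ℚ} (hfin : {z : X | coheight z = 1 ∧ D' z ≠ 0}.Finite)
    (hD : ∀ z, coheight z = 1 → ¬ IsClosed ({ε z} : Set Y) → D' z = D (ε z))
    (hD' : ∀ z, IsContracted ε z → D' z = X.ord (pullbackFun ε h (f (ε z))) z / m) :
    IsLocalSystem D' m fun x ↦ pullbackFun ε h (f (ε x)) := by
  refine ⟨hfin, fun x ↦ (map_ne_zero _).mpr (hf.ne_zero _), fun x z hz hzx ↦ ?_⟩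
  have hεzx : ε z ⤳ ε x := hzx.map ε.continuous
  by_cases hcl : IsClosed ({ε z} : Set Y)
  -- Every point of a contracted curve has the same image, so the pulled-back equation at `x` is the
  -- one at `z`, whose order defines `D' z`.
  · have h1 : ε x ∈ closure {ε z} := hεzx.mem_closure
    rw [hcl.closure_eq] at h1
    have h2 : ε x = ε z := h1
    rw [hD' z ⟨hz, hcl⟩, h2, mul_div_cancel₀]
    positivity
  · rw [ord_pullbackFun ε h hY hb hz hcl (hf.ne_zero _), hD z hz hcl]
    exact hf.ord_eq _ _ (coheight_map_eq_one ε h hY hb hz hcl) hεzx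

include hX

/-- The intersection number of the push-forward of a divisor and a push-forward of curves is
computed on curves which are not contracted. -/
theorem interDivisor_pushforward [IsProper ε] {D : AlgebraicCycle Y ℚ} (hD : IsQCartier D)
    {C : Finset X} (hC : ∀ c ∈ C, coheight c = 1) :
    interDivisor D (pushforward ε (reducedDivisor C)) =
      open Classical in
      ∑ c ∈ C.filter fun c ↦ ¬ IsClosed ({ε c} : Set Y), inter D (ε c) := by
  classical
  have hS : ∀ c ∈ C.filter fun c ↦ ¬ IsClosed ({ε c} : Set Y),
      coheight c = 1 ∧ ¬ IsClosed ({ε c} : Set Y) ∧ c ∈ C := fun c hc ↦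
    ⟨hC c (Finset.mem_filter.mp hc).1, (Finset.mem_filter.mp hc).2, (Finset.mem_filter.mp hc).1⟩
  rw [interDivisor, finsum_eq_sum_of_support_subset
    (s := (C.filter fun c ↦ ¬ IsClosed ({ε c} : Set Y)).image ε), Finset.sum_image]
  · refine Finset.sum_congr rfl fun c hc ↦ ?_
    obtain ⟨h1, h2, h3⟩ := hS c hc
    rw [pushforward_apply ε h hX hY hb h1 h2, reducedDivisor_apply_mem h3, one_mul]
  · intro c hc c' hc' hcc
    exact eq_of_map_eq ε h hX hY hb (hS c' hc').1 (hS c hc).1 (hS c' hc').2.1 hcc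
  · intro y hy
    obtain ⟨x, rfl, hx, -⟩ := pushforward_ne_zero ε (left_ne_zero_of_mul hy)
    have hxC : x ∈ C := by
      by_contra hcon
      exact hx (reducedDivisor_apply_notMem hcon)
    simp only [Finset.coe_image, Set.mem_image, Finset.mem_coe, Finset.mem_filter]
    -- A closed point of `Y` in the support would contribute degree zero.
    refine ⟨x, ⟨hxC, fun hcl ↦ right_ne_zero_of_mul hy ?_⟩, rfl⟩
    obtain ⟨-, hf⟩ := hD.exists_isLocalSystem hY
    rw [inter, dif_pos hD, curveDegree_of_isClosed hcl (hf.ne_zero _), Int.cast_zero, zero_div]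

end Pullback

end KltSurface

/-! ### The inequality on the contracted surface -/

open KltSurface in
theorem mainTheorem3
    (X Y : Scheme.{0}) [IsIntegral X] [IsLocallyNoetherian X] [IsIntegral Y] [IsLocallyNoetherian Y]
    (sX : X ⟶ Spec (.of ℂ)) (sY : Y ⟶ Spec (.of ℂ))
    (hX : IsKlt sX) (hY : IsKlt sY)
    (ε : X ⟶ Y) [IsProper ε] (hε : ε ≫ sY = sX) (hbir : IsBirational ε)
    (k : ℕ) (F : Fin (k + 1) → X)
    (hF : IsChainOfRationalCurves sX F)
    (hcontr : ∀ x : X, IsContracted ε x ↔ x ∈ Set.range F)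
    (L : AlgebraicCycle X ℚ) (hL : IsQCartier L)
    (C : Finset X) (hC : ∀ c ∈ C, IsCompleteCurve sX c)
    (h1 : 0 ≤ interDivisor (L + reducedDivisor C) (reducedDivisor C))
    (h2 : ∀ i, ∃ n : ℕ, inter (reducedDivisor C) (F i) = n)
    (h3 : inter (primeDivisor (F 0)) (F 0) ≤ -1 ∧
      (∀ i : Fin k, inter (primeDivisor (F i.succ)) (F i.succ) ≤ -2) ∧
      ∀ i : Fin k, inter (primeDivisor (F i.castSucc)) (F i.succ) = 1)
    (h4 : -1 ≤ inter L (F 0) ∧ inter L (F 0) < 0 ∧ ∀ i : Fin k, inter L (F i.succ) = 0) :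
    0 ≤ interDivisor (pushforward ε L + pushforward ε (reducedDivisor C))
      (pushforward ε (reducedDivisor C)) := by
  classical
  obtain ⟨hgen, hbij⟩ := hbir
  have hXn : IsNormalSurface sX := hX.1
  have hYn : IsNormalSurface sY := hY.1
  have := hXn.locallyOfFiniteType
  have := hYn.locallyOfFiniteType
  -- Otherwise every `inter` of this divisor takes its default value `0`.
  by_cases hQ : IsQCartier (pushforward ε L + pushforward ε (reducedDivisor C))
  swap
  · have h0 : ∀ c, inter (pushforward ε L + pushforward ε (reducedDivisor C)) c = 0 := fun c ↦
      dif_neg hQ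
    rw [interDivisor]
    simp only [h0, mul_zero, finsum_zero, le_refl]
  have hCm : ∀ c ∈ C, IsModelCurve sX c := fun c hc ↦
    ⟨(hC c hc).1, exists_center_of_isCompleteCurve sX (hC c hc)⟩
  have hC1 : ∀ c ∈ C, coheight c = 1 := fun c hc ↦ (hC c hc).1
  have hFc : ∀ i, IsContracted ε (F i) := fun i ↦ (hcontr _).mpr ⟨i, rfl⟩
  have hFm : ∀ i, IsModelCurve sX (F i) := fun i ↦
    ⟨(hFc i).1, exists_center_of_isContracted sX sY ε hε (hFc i)⟩
  have hFQ : ∀ i, IsQCartier (primeDivisor (F i)) := by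
    refine Fin.cases (isQCartier_of_inter_ne_zero (c := F 0) ?_)
      fun i ↦ isQCartier_of_inter_ne_zero (c := F i.succ) ?_
    · linarith [h3.1]
    · linarith [h3.2.1 i]
  obtain ⟨hm, hf⟩ := hQ.exists_isLocalSystem hYn
  have hinter : ∀ y, inter (pushforward ε L + pushforward ε (reducedDivisor C)) y =
      curveDegree hQ.2.choose.2 y / hQ.2.choose.1 := fun y ↦ dif_pos hQ
  generalize hQ.2.choose.1 = m at hm hf hinter
  generalize hQ.2.choose.2 = f at hf hinter
  let g : X → X.functionField := fun x ↦ pullbackFun ε hgen (f (ε x))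
  -- The coefficient of `F i` in the pull-back, minus that in `L + C`; with it `D'` is the pull-back
  -- of the divisor on `Y`.
  let e : Fin (k + 1) → ℚ := fun i ↦
    X.ord (g (F i)) (F i) / m - (L (F i) + indicatorDivisor C (F i))
  let D' : X → ℚ := L + indicatorDivisor C + ∑ i, e i • indicatorDivisor {F i}
  have hD'F : ∀ j, D' (F j) = X.ord (g (F j)) (F j) / m := by
    intro j
    have : ∑ i, e i * indicatorDivisor {F i} (F j) = e j := by
      rw [Finset.sum_eq_single j]
      · simp [indicatorDivisor]
      · intro i _ hij
        have : F j ≠ F i := fun h ↦ hij (hF.injective h).symm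
        simp [indicatorDivisor, this]
      · simp
    simp only [D', Pi.add_apply, Finset.sum_apply, Pi.smul_apply, smul_eq_mul, this, e]
    ring
  have hD'z : ∀ z ∉ Set.range F, D' z = L z + indicatorDivisor C z := by
    intro z hz
    have : ∑ i, e i * indicatorDivisor {F i} z = 0 := by
      refine Finset.sum_eq_zero fun i _ ↦ ?_
      have : z ≠ F i := fun h ↦ hz ⟨i, h.symm⟩
      simp [indicatorDivisor, this]
    simp only [D', Pi.add_apply, Finset.sum_apply, Pi.smul_apply, smul_eq_mul, this]
    ring
  have hg : IsLocalSystem D' m g := by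
    refine isLocalSystem_pullbackFun ε hgen hYn hbij hm hf ?_ ?_ ?_
    · refine (((hL.exists_isLocalSystem hXn).2.finite.union C.finite_toSet).union
        (Set.finite_range F)).subset ?_
      rintro z ⟨hz, hz'⟩
      by_contra hcon
      simp only [Set.mem_union, not_or, Set.mem_ofPred_eq, not_and, not_not, Finset.mem_coe] at hcon
      refine hz' ?_
      rw [hD'z z hcon.2, hcon.1.1 hz, zero_add]
      exact if_neg hcon.1.2
    · intro z hz hcl
      have hzF : z ∉ Set.range F := fun h ↦ hcl ((hcontr z).mpr h).2
      rw [hD'z z hzF, Function.locallyFinsuppWithin.coe_add, Pi.add_apply,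
        pushforward_apply ε hgen hXn hYn hbij hz hcl, pushforward_apply ε hgen hXn hYn hbij hz hcl,
        coe_reducedDivisor]
    · intro z hz
      obtain ⟨j, rfl⟩ := (hcontr z).mp hz
      exact hD'F j
  have hdeg : ∀ c, HasDegree D' c (curveDegree g c / m) := fun c ↦ ⟨m, g, hm, hg, rfl⟩
  -- The pulled-back equations are one and the same function along a contracted curve.
  have hzero : ∀ c, IsContracted ε c → curveDegree g c = 0 := by
    intro c hc
    refine curveDegree_eq_zero_of_const (hg.ne_zero c) fun p hp ↦ ?_
    have h1 : ε p ∈ closure {ε c} := (hp.map ε.continuous).mem_closure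
    rw [hc.2.closure_eq] at h1
    have h2 : ε p = ε c := h1
    simp only [g, h2]
  have hLdeg := hasDegree_inter hXn hL
  have hFdeg : ∀ i c, HasDegree (indicatorDivisor {F i}) c (inter (primeDivisor (F i)) c) :=
    fun i c ↦ by
      have := hasDegree_inter hXn (hFQ i) c
      rwa [primeDivisor, coe_reducedDivisor] at this
  -- `C = D' - L - ∑ e_i F_i` is a combination of `ℚ`-Cartier divisors. `HasDegree` is always taken
  -- on some curve; `F 0` merely serves as one.
  have hCQ : IsQCartier (reducedDivisor C) := by
    have h5 := ((hdeg (F 0)).add hXn (hFm 0) ((hLdeg (F 0)).smul hXn (hFm 0) (-1))).add hXn (hFm 0)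
      (HasDegree.sum hXn (hFm 0) Finset.univ fun i _ ↦
        (hFdeg i (F 0)).smul hXn (hFm 0) (-e i))
    have h6 : D' + (-1 : ℚ) • (L : X → ℚ) + ∑ i, (-e i) • indicatorDivisor {F i} =
        indicatorDivisor C := by
      simp only [D', neg_smul, one_smul, Finset.sum_neg_distrib]
      abel
    rw [h6, ← coe_reducedDivisor] at h5
    exact h5.isQCartier (isWeilDivisor_reducedDivisor hC1)
  have hCdeg : ∀ c, HasDegree (indicatorDivisor C) c (inter (reducedDivisor C) c) := fun c ↦ by
    have := hasDegree_inter hXn hCQ c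
    rwa [coe_reducedDivisor] at this
  have hsplit : ∀ c, IsModelCurve sX c → (curveDegree g c / m : ℚ) =
      inter L c + inter (reducedDivisor C) c + ∑ i, e i * inter (primeDivisor (F i)) c :=
    fun c hc ↦ (hdeg c).eq hXn hc (((hLdeg c).add hXn hc (hCdeg c)).add hXn hc
      (HasDegree.sum hXn hc Finset.univ fun i _ ↦ (hFdeg i c).smul hXn hc (e i)))
  have hLC : ∀ c, IsModelCurve sX c → inter (L + reducedDivisor C) c =
      inter L c + inter (reducedDivisor C) c := by
    intro c hc
    have h5 := (hLdeg c).add hXn hc (hCdeg c)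
    rw [← coe_reducedDivisor, ← Function.locallyFinsuppWithin.coe_add] at h5
    have hW : IsWeilDivisor (L + reducedDivisor C) := by
      intro x hx
      by_contra hcon
      refine hx ?_
      rw [Function.locallyFinsuppWithin.coe_add, Pi.add_apply,
        reducedDivisor_apply_notMem fun h ↦ hcon (hC1 x h), add_zero]
      by_contra h0
      exact hcon (hL.1 x h0)
    exact (hasDegree_inter hXn (h5.isQCartier hW) c).eq hXn hc h5
  choose n hn using h2
  have hchain : 0 ≤ ∑ i, e i * n i := by
    refine sum_nonneg_of_chain (M := fun i j ↦ inter (primeDivisor (F i)) (F j))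
      (ℓ := fun j ↦ inter L (F j)) h3.1 h3.2.1 h3.2.2 (fun i j _ ↦ ?_) (fun i j hij ↦ ?_) h4.1 h4.2.2
      fun j ↦ ?_
    · have := sum_inter_primeDivisor hXn (C := {F j}) (by simpa using hFm j) (hFm i) (hFQ j) (hFQ i)
      rwa [Finset.sum_singleton] at this
    · refine (hFdeg i (F j)).eq hXn (hFm j) (hasDegree_zero_of_disjoint (hFdeg i (F j)) ?_)
      intro z _ hz
      have : z = F i := by
        by_contra hne
        exact hz (by simp [indicatorDivisor, hne])
      rw [this]
      exact hF.disjoint i j hij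
    -- The equation `D' · F j = 0` is the `j`-th row of the linear system.
    · have := hsplit (F j) (hFm j)
      rw [hzero _ (hFc j), Int.cast_zero, zero_div, hn] at this
      exact this.symm
  -- Projection formula; contracted components of `C` may be included on the right, since `D'` has
  -- degree zero on them.
  have hmain : interDivisor (pushforward ε L + pushforward ε (reducedDivisor C))
      (pushforward ε (reducedDivisor C)) = ∑ c ∈ C, (curveDegree g c / m : ℚ) := by
    rw [interDivisor_pushforward ε hgen hXn hYn hbij hQ hC1, Finset.sum_filter]
    refine Finset.sum_congr rfl fun c hc ↦ ?_
    split_ifs with hcl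
    · rw [hzero c ⟨hC1 c hc, hcl⟩, Int.cast_zero, zero_div]
    · rw [hinter, curveDegree_pullback ε hgen hXn hYn hbij hε (hCm c hc) hcl hf hg]
  rw [interDivisor_reducedDivisor, Finset.sum_congr rfl fun c hc ↦ hLC c (hCm c hc)] at h1
  rw [hmain, Finset.sum_congr rfl fun c hc ↦ hsplit c (hCm c hc), Finset.sum_add_distrib,
    Finset.sum_comm]
  refine add_nonneg h1 ?_
  -- By symmetry the correction term is `∑ e_i (C · F_i)`.
  simp only [← Finset.mul_sum, sum_inter_primeDivisor hXn hCm (hFm _) hCQ (hFQ _), hn]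
  exact hchain
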